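/- Let $\mu_{\mathrm B}=\mathcal N(m_{\mathrm B},\Sigma_{\mathrm B})$ be a Gaussian measure on $\mathbb R^d$ with arbitrary mean $m_{\mathrm B}\in\mathbb R^d$ and arbitrary (symmetric) positive definite covariance matrix $\Sigma_{\mathrm B}$, and let $\rho_{\mathrm B}=\frac{\mathrm d\mu_{\mathrm B}}{\mathrm dx}$. Let $\rho_*$ be a probability density on $\mathbb R^d$ with $\rho_*\log\rho_*\in L^1(\mathbb R^d)$ such that, for some $M>0$ and $\sigma_\bullet>0$, $$\rho_*(x)\le \frac{1}{(2\pi\sigma_\bullet^2)^{d/2}}\,e^{-\frac{\|x\|^2}{2\sigma_\bullet^2}}\qquad\text{for all }\|x\|\ge M,$$ and let $\mu_*$ be the measure with $\frac{\mathrm d\mu_*}{\mathrm dx}=\rho_*$. Then for every $T>0$ and $\varepsilon>0$ there is $\theta=(w,a,b):[0,T]\to\mathbb R^d\times\mathbb R^d\times\mathbb R$, piecewise constant with finitely many switches (that is, constant on each interval $[t_{k-1},t_k)$ of some subdivision $0=t_0<t_1<\dots<t_K=T$), such that the following holds. The continuity equation $$\partial_t\rho(t,x)+\operatorname{div}\big(w(t)\,(a(t)^\top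 x+b(t))_+\,\rho(t,x)\big)=0\ \text{ in }[0,T]\times\mathbb R^d,\qquad \rho(0,\cdot)=\rho_{\mathrm B},$$ has a weak solution $\rho\in C^0([0,T];L^1(\mathbb R^d))\cap L^\infty([0,T]\times\mathbb R^d)$, and every such solution satisfies $\rho(T,\cdot)>0$ almost everywhere, $\rho_*\log\frac{\rho_*}{\rho(T,\cdot)}\in L^1(\mathbb R^d)$ and $$\int_{\mathbb R^d}\rho_*(x)\log\frac{\rho_*(x)}{\rho(T,x)}\,\mathrm dx\le\varepsilon .$$ Equivalently, $\mathsf{KL}\big(\mu_*\,\|\,\Phi^T_{\theta\#}\mu_{\mathrm B}\big)\le\varepsilon$, where $\Phi^T_\theta:\mathbb R^d\to\mathbb R^d$, $x\mapsto x(T)$, is the (existing and unique) time-$T$ flow map of $\dot x(t)=w(t)\,(a(t)^\top x(t)+b(t))_+$, $x(0)=x$. -/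

import Mathlib

open MeasureTheory Set Filter Topology
open scoped ENNReal

noncomputable section

namespace NeuralFlow

/-- `ℝ^d` with its Euclidean norm. -/
abbrev E (d : ℕ) : Type := EuclideanSpace ℝ (Fin d)

/-- The parameters `(w, a, b) ∈ ℝ^d × ℝ^d × ℝ`. -/
abbrev Param (d : ℕ) : Type := E d × E d × ℝ

/-- The perceptron velocity field `v(x, (w, a, b)) = w (aᵀ x + b)_+`. -/
def velocity {d : ℕ} (x : E d) (p : Param d) : E d :=
  max (inner ℝ p.2.1 x + p.2.2) 0 • p.1

/-- `θ` is piecewise constant on `[0, T]` with finitely many switches: there is a subdivision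
`0 = t_0 < t_1 < ⋯ < t_K = T` such that `θ` is constant on every `[t_k, t_{k+1})`. -/
def IsPiecewiseConstant {d : ℕ} (T : ℝ) (θ : ℝ → Param d) : Prop :=
  ∃ (K : ℕ) (t : Fin (K + 1) → ℝ) (p : Fin K → Param d),
    StrictMono t ∧ t 0 = 0 ∧ t (Fin.last K) = T ∧
      ∀ k : Fin K, ∀ s ∈ Ico (t k.castSucc) (t k.succ), θ s = p k

/-- `Φ` is the flow on `[0, T]` of `ẋ(t) = v(x(t), θ(t))`: for every `x`, the curve `t ↦ Φ t x` is
the (Carathéodory) solution that starts at `x`. -/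
structure IsFlow {d : ℕ} (T : ℝ) (θ : ℝ → Param d) (Φ : ℝ → E d → E d) : Prop where
  continuousOn : ∀ x, ContinuousOn (fun t => Φ t x) (Icc 0 T)
  eq_integral : ∀ x, ∀ t ∈ Icc (0 : ℝ) T, Φ t x = x + ∫ s in (0 : ℝ)..t, velocity (Φ s x) (θ s)

/-- `ρ ∈ C⁰([0, T]; L¹)`, bounded in `L^∞` uniformly in time, solves
`∂_t ρ + div (v(x, θ(t)) ρ) = 0` on `[0, T] × ℝ^d` with `ρ(0) = ρB`, in the sense of distributions,
i.e. tested against compactly supported `C¹` functions of `x`. -/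
structure IsSolution {d : ℕ} (T : ℝ) (θ : ℝ → Param d) (ρB : E d → ℝ)
    (ρ : ℝ → (E d →₁[volume] ℝ)) : Prop where
  continuousOn : ContinuousOn ρ (Icc 0 T)
  bounded : ∃ C : ℝ, ∀ t ∈ Icc (0 : ℝ) T, ∀ᵐ x, |ρ t x| ≤ C
  initial : ρ 0 =ᵐ[volume] ρB
  weak_eq : ∀ φ : E d → ℝ, ContDiff ℝ 1 φ → HasCompactSupport φ → ∀ t ∈ Icc (0 : ℝ) T,
    ∫ x, φ x * ρ t x = (∫ x, φ x * ρB x) +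
      ∫ s in (0 : ℝ)..t, ∫ x, fderiv ℝ φ x (velocity x (θ s)) * ρ s x

/-- `ρ` is a probability density on `ℝ^d`. -/
structure IsProbDensity {d : ℕ} (ρ : E d → ℝ) : Prop where
  nonneg : ∀ x, 0 ≤ ρ x
  integrable : Integrable ρ
  integral_eq_one : ∫ x, ρ x = 1

/-- The measure `ρ dx`. -/
def densityMeasure {d : ℕ} (ρ : E d → ℝ) : Measure (E d) :=
  volume.withDensity fun x => ENNReal.ofReal (ρ x)

/-- The Lebesgue density `dμ/dx`. -/
def lebesgueDensity {d : ℕ} (μ : Measure (E d)) (x : E d) : ℝ :=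
  (μ.rnDeriv volume x).toReal

end NeuralFlow

end

/-!
In logarithmic form, the density transported by the flow of a control is an explicit pullback: if
`Ψ` is the inverse of the time-`T` flow map, with Jacobian `e^ℓ`, it is `e^ℓ (ρ_B ∘ Ψ)`. Flows of
perceptron fields run backwards are again flows of perceptron fields, and rescaling `w` changes
their duration, so every finite composition of such flows occurs as `Ψ`. These compositions include
all positive definite affine maps, so that `ρ_B` may be replaced by the standard Gaussian density
`γ`, and it remains to bound `∫ ρ (log ρ - log γ ∘ Ψ - ℓ)`.

A neuron with `w ⟂ a` generates a shear, and one with `w ∥ a` a dilation of a half-space.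
Conjugating a dilation by shears along steep barriers confines it, in the limit, to a cylinder.
Hence the maps that send, coordinate by coordinate, each cell of a grid of a large box into a
region of prescribed Gaussian mass are limits of compositions. Prescribing (up to a small error) the
masses of `ρ` on the cells makes the pullback of `γ` close to the average of `ρ` over the cells, and
these averages converge to `ρ` in the sense of entropy. Outside the box the maps grow at most
linearly, uniformly in the box and the mesh, and the second moment of `ρ` makes the contribution of
the complement small.

Every weak solution is the pushforward along the characteristics: testing it against `ψ` composed
with the flow shows that its integrals are constant along the flow. The flow is only Lipschitz in
space, so it is first approximated by a smooth one.
-/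

noncomputable section

namespace NeuralFlow

variable {d : ℕ}

/-! ### Changes of variables -/

section ChangeOfVariables

variable {α : Type*} [MeasurableSpace α] {μ : Measure α}

/-- `Ψ` is an injective change of variables with Jacobian determinant `e^ℓ` for the measure `μ`,
that is `Ψ_# (e^ℓ μ) = μ`. Jacobians are kept in logarithmic form because the divergence only
involves their logarithms. -/
structure HasLogJacobian (μ : Measure α) (Ψ : α → α) (ℓ : α → ℝ) : Prop where
  measurableEmbedding : MeasurableEmbedding Ψ
  measurable_log : Measurable ℓ
  map_withDensity : (μ.withDensity fun x => ENNReal.ofReal (Real.exp (ℓ x))).map Ψ = μ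

namespace HasLogJacobian

variable {Ψ Ψ₁ Ψ₂ : α → α} {ℓ ℓ₁ ℓ₂ : α → ℝ}

lemma id : HasLogJacobian μ (id : α → α) 0 :=
  ⟨MeasurableEmbedding.id, measurable_const, by simp⟩

lemma measurable_ofReal_exp (h : HasLogJacobian μ Ψ ℓ) :
    Measurable fun x => ENNReal.ofReal (Real.exp (ℓ x)) :=
  h.measurable_log.exp.ennreal_ofReal

lemma lintegral_comp (h : HasLogJacobian μ Ψ ℓ) (f : α → ℝ≥0∞) :
    ∫⁻ x, ENNReal.ofReal (Real.exp (ℓ x)) * f (Ψ x) ∂μ = ∫⁻ x, f x ∂μ := by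
  conv_rhs => rw [← h.map_withDensity]
  rw [h.measurableEmbedding.lintegral_map, lintegral_withDensity_eq_lintegral_mul_non_measurable₀ _
    h.measurable_ofReal_exp.aemeasurable (by simp)]
  rfl

lemma comp (h₂ : HasLogJacobian μ Ψ₂ ℓ₂) (h₁ : HasLogJacobian μ Ψ₁ ℓ₁) :
    HasLogJacobian μ (Ψ₂ ∘ Ψ₁) (fun x => ℓ₁ x + ℓ₂ (Ψ₁ x)) := by
  have hemb := h₂.measurableEmbedding.comp h₁.measurableEmbedding
  refine ⟨hemb, h₁.measurable_log.add
    (h₂.measurable_log.comp h₁.measurableEmbedding.measurable), ?_⟩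
  ext s hs
  have hs' := hemb.measurable hs
  rw [Measure.map_apply hemb.measurable hs, withDensity_apply _ hs', ← lintegral_indicator hs',
    ← lintegral_indicator_one hs, ← h₂.lintegral_comp (s.indicator 1),
    ← h₁.lintegral_comp (fun x => _ * s.indicator 1 (Ψ₂ x))]
  refine lintegral_congr fun x => ?_
  by_cases hx : Ψ₂ (Ψ₁ x) ∈ s
  · simp [indicator, hx, Real.exp_add, ENNReal.ofReal_mul (Real.exp_pos _).le]
  · simp [indicator, hx]

lemma quasiMeasurePreserving (h : HasLogJacobian μ Ψ ℓ) :
    Measure.QuasiMeasurePreserving Ψ μ μ := by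
  refine ⟨h.measurableEmbedding.measurable, ?_⟩
  conv_rhs => rw [← h.map_withDensity]
  exact (withDensity_absolutelyContinuous' h.measurable_ofReal_exp.aemeasurable
    (ae_of_all _ fun x => by simp [Real.exp_pos])).map h.measurableEmbedding.measurable

lemma ae_comp_iff (h : HasLogJacobian μ Ψ ℓ) {P : α → Prop} :
    (∀ᵐ x ∂μ, P (Ψ x)) ↔ ∀ᵐ x ∂μ, P x := by
  conv_rhs => rw [← h.map_withDensity]
  rw [h.measurableEmbedding.ae_map_iff, ae_withDensity_iff h.measurable_ofReal_exp]
  simp [Real.exp_pos]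

variable {F : Type*} [NormedAddCommGroup F] [NormedSpace ℝ F]

lemma integral_comp (h : HasLogJacobian μ Ψ ℓ) (f : α → F) :
    ∫ x, Real.exp (ℓ x) • f (Ψ x) ∂μ = ∫ x, f x ∂μ := by
  conv_rhs => rw [← h.map_withDensity]
  rw [h.measurableEmbedding.integral_map, integral_withDensity_eq_integral_toReal_smul
    h.measurable_ofReal_exp (ae_of_all _ fun _ => ENNReal.ofReal_lt_top)]
  simp only [ENNReal.toReal_ofReal (Real.exp_pos _).le]

lemma integrable_comp (h : HasLogJacobian μ Ψ ℓ) {f : α → F} (hf : Integrable f μ) :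
    Integrable (fun x => Real.exp (ℓ x) • f (Ψ x)) μ := by
  rw [← h.map_withDensity, h.measurableEmbedding.integrable_map_iff,
    integrable_withDensity_iff_integrable_smul' h.measurable_ofReal_exp
      (ae_of_all _ fun _ => ENNReal.ofReal_lt_top)] at hf
  simpa only [ENNReal.toReal_ofReal (Real.exp_pos _).le] using! hf

end HasLogJacobian

end ChangeOfVariables

/-! ### The flow of one perceptron field -/

/-- The primitive `∫₀ᵗ e^{cs} ds`, which is `t` when `c = 0`. -/
def expPrimitive (c t : ℝ) : ℝ := if c = 0 then t else (Real.exp (c * t) - 1) / c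

lemma expPrimitive_zero_left (t : ℝ) : expPrimitive 0 t = t := if_pos rfl

lemma expPrimitive_zero_right (c : ℝ) : expPrimitive c 0 = 0 := by
  unfold expPrimitive; split_ifs <;> simp

lemma mul_expPrimitive (c t : ℝ) : c * expPrimitive c t = Real.exp (c * t) - 1 := by
  unfold expPrimitive
  split_ifs with h
  · simp [h]
  · field_simp

lemma expPrimitive_add (c s t : ℝ) :
    expPrimitive c (s + t) = expPrimitive c t + expPrimitive c s * Real.exp (c * t) := by
  unfold expPrimitive
  split_ifs with h
  · simp [h, add_comm]
  · rw [mul_add, Real.exp_add]; field_simp; ring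

lemma expPrimitive_div (c : ℝ) {τ : ℝ} (hτ : τ ≠ 0) :
    expPrimitive (c / τ) τ = τ * expPrimitive c 1 := by
  unfold expPrimitive
  by_cases h : c = 0
  · simp [h]
  · simp only [div_eq_zero_iff, h, hτ, or_self, if_false]
    field_simp

lemma hasDerivAt_expPrimitive (c t : ℝ) :
    HasDerivAt (expPrimitive c) (Real.exp (c * t)) t := by
  by_cases h : c = 0
  · have heq : expPrimitive c = id := by ext s; simp [expPrimitive, h]
    rw [heq]
    simpa [h] using hasDerivAt_id t
  · have heq : expPrimitive c = fun s => (Real.exp (c * s) - 1) / c := by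
      ext s; simp [expPrimitive, h]
    rw [heq]
    refine (((((hasDerivAt_id t).const_mul c).exp).sub_const 1).div_const c).congr_deriv ?_
    rw [mul_one, mul_div_cancel_right₀ _ h, id]

@[fun_prop]
lemma continuous_expPrimitive (c : ℝ) : Continuous (expPrimitive c) :=
  continuous_iff_continuousAt.2 fun t => (hasDerivAt_expPrimitive c t).continuousAt

section Flow

variable (p : Param d)

/-- The preactivation `aᵀ x + b` of the neuron `(w, a, b)`. -/
def preact (x : E d) : ℝ := inner ℝ p.2.1 x + p.2.2

/-- The rate `aᵀ w` at which a positive preactivation grows along the flow. -/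
def rate : ℝ := inner ℝ p.2.1 p.1

/-- The time-`t` flow map of the autonomous field `velocity · p`. Along a trajectory the positive
part of the preactivation is multiplied by `e^{t aᵀ w}`, which yields the closed form. -/
def flow (t : ℝ) (x : E d) : E d :=
  x + (expPrimitive (rate p) t * max (preact p x) 0) • p.1

/-- The logarithm of the Jacobian determinant of `flow p t`. -/
def flowLogJac (t : ℝ) (x : E d) : ℝ := if 0 < preact p x then rate p * t else 0

lemma velocity_eq (x : E d) : velocity x p = max (preact p x) 0 • p.1 := rfl

lemma hasFDerivAt_preact (x : E d) : HasFDerivAt (preact p) (innerSL ℝ p.2.1) x :=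
  (innerSL ℝ p.2.1).hasFDerivAt.add_const _

@[fun_prop]
lemma contDiff_preact : ContDiff ℝ 1 (preact p) :=
  (innerSL ℝ p.2.1).contDiff.add contDiff_const

@[fun_prop]
lemma continuous_preact : Continuous (preact p) := (contDiff_preact p).continuous

@[fun_prop]
lemma continuous_velocity : Continuous (fun x => velocity x p) := by
  unfold velocity; fun_prop

lemma continuous_flow_uncurry : Continuous (fun z : ℝ × E d => flow p z.1 z.2) := by
  unfold flow; fun_prop

@[fun_prop]
lemma continuous_flow (t : ℝ) : Continuous (flow p t) :=
  (continuous_flow_uncurry p).comp (by fun_prop : Continuous fun x : E d => (t, x))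

@[fun_prop]
lemma continuous_flow_time (x : E d) : Continuous (fun t => flow p t x) :=
  (continuous_flow_uncurry p).comp (by fun_prop : Continuous fun t : ℝ => (t, x))

@[simp]
lemma flow_zero (x : E d) : flow p 0 x = x := by
  simp [flow, expPrimitive_zero_right]

variable {p} in
lemma flow_of_preact_nonpos {x : E d} (h : preact p x ≤ 0) (t : ℝ) : flow p t x = x := by
  simp [flow, max_eq_right h]

variable {p} in
lemma preact_flow_of_pos {x : E d} (h : 0 < preact p x) (t : ℝ) :
    preact p (flow p t x) = Real.exp (rate p * t) * preact p x := by
  have hflow : preact p (flow p t x) =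
      preact p x + (rate p * expPrimitive (rate p) t) * max (preact p x) 0 := by
    simp only [preact, flow, rate, inner_add_right, inner_smul_right]
    ring
  rw [hflow, mul_expPrimitive, max_eq_left h.le]
  ring

lemma preact_flow_pos_iff (t : ℝ) (x : E d) : 0 < preact p (flow p t x) ↔ 0 < preact p x := by
  by_cases h : 0 < preact p x
  · simp only [h, iff_true, preact_flow_of_pos h]
    exact mul_pos (Real.exp_pos _) h
  · rw [flow_of_preact_nonpos (not_lt.1 h)]

lemma max_preact_flow (t : ℝ) (x : E d) :
    max (preact p (flow p t x)) 0 = Real.exp (rate p * t) * max (preact p x) 0 := by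
  by_cases h : 0 < preact p x
  · rw [max_eq_left ((preact_flow_pos_iff p t x).2 h).le, max_eq_left h.le, preact_flow_of_pos h]
  · rw [flow_of_preact_nonpos (not_lt.1 h), max_eq_right (not_lt.1 h), mul_zero]

lemma flow_add (s t : ℝ) (x : E d) : flow p (s + t) x = flow p s (flow p t x) := by
  conv_rhs => rw [flow]
  rw [max_preact_flow, flow, flow, expPrimitive_add]
  module

@[simp]
lemma flow_neg_flow (t : ℝ) (x : E d) : flow p (-t) (flow p t x) = x := by
  rw [← flow_add, neg_add_cancel, flow_zero]

@[simp]
lemma flow_flow_neg (t : ℝ) (x : E d) : flow p t (flow p (-t) x) = x := by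
  rw [← flow_add, add_neg_cancel, flow_zero]

lemma hasDerivAt_flow (t : ℝ) (x : E d) :
    HasDerivAt (fun s => flow p s x) (velocity (flow p t x) p) t := by
  rw [velocity_eq, max_preact_flow]
  exact (((hasDerivAt_expPrimitive (rate p) t).mul_const _).smul_const p.1).const_add x

lemma flowLogJac_add (s t : ℝ) (x : E d) :
    flowLogJac p (s + t) x = flowLogJac p t x + flowLogJac p s (flow p t x) := by
  simp only [flowLogJac, preact_flow_pos_iff]
  split_ifs <;> ring

@[simp]
lemma flowLogJac_zero (x : E d) : flowLogJac p 0 x = 0 := by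
  simp [flowLogJac]

lemma abs_flowLogJac_le (t : ℝ) (x : E d) : |flowLogJac p t x| ≤ |rate p| * |t| := by
  unfold flowLogJac
  split_ifs
  · rw [abs_mul]
  · rw [abs_zero]; positivity

lemma continuous_flowLogJac_time (x : E d) : Continuous (fun t => flowLogJac p t x) := by
  unfold flowLogJac; split_ifs <;> fun_prop

lemma measurableSet_preact_pos : MeasurableSet {x | 0 < preact p x} :=
  measurableSet_lt measurable_const (continuous_preact p).measurable

@[fun_prop]
lemma measurable_flowLogJac (t : ℝ) : Measurable (flowLogJac p t) :=
  Measurable.ite (measurableSet_preact_pos p) measurable_const measurable_const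

/-- `flow p t` as a homeomorphism, with inverse `flow p (-t)`. -/
def flowHomeomorph (t : ℝ) : E d ≃ₜ E d where
  toFun := flow p t
  invFun := flow p (-t)
  left_inv := flow_neg_flow p t
  right_inv := flow_flow_neg p t
  continuous_toFun := continuous_flow p t
  continuous_invFun := continuous_flow p (-t)

lemma measurableEmbedding_flow (t : ℝ) : MeasurableEmbedding (flow p t) :=
  (flowHomeomorph p t).measurableEmbedding

lemma image_flow_preact_pos (t : ℝ) : flow p t '' {x | 0 < preact p x} = {x | 0 < preact p x} := by
  ext y
  constructor
  · rintro ⟨x, hx, rfl⟩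
    exact (preact_flow_pos_iff p t x).2 hx
  · exact fun hy => ⟨flow p (-t) y, (preact_flow_pos_iff p (-t) y).2 hy, flow_flow_neg p t y⟩

/-- The derivative of `flow p t` on the half-space where it moves: a rank-one perturbation of the
identity. -/
def flowDeriv (t : ℝ) : E d →L[ℝ] E d :=
  ContinuousLinearMap.id ℝ (E d) + (innerSL ℝ p.2.1).smulRight (expPrimitive (rate p) t • p.1)

lemma det_flowDeriv (t : ℝ) : (flowDeriv p t).det = Real.exp (rate p * t) := by
  have htransvection : (flowDeriv p t : E d →ₗ[ℝ] E d) =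
      LinearMap.transvection (innerₛₗ ℝ p.2.1) (expPrimitive (rate p) t • p.1) := by
    ext x
    simp [flowDeriv, LinearMap.transvection.apply]
  rw [ContinuousLinearMap.det, htransvection, LinearMap.transvection.det, map_smul,
    innerₛₗ_apply_apply, smul_eq_mul, mul_comm, ← rate, mul_expPrimitive]
  ring

lemma hasFDerivWithinAt_flow (t : ℝ) {x : E d} (hx : 0 < preact p x) :
    HasFDerivWithinAt (flow p t) (flowDeriv p t) {x | 0 < preact p x} x := by
  have haffine : HasFDerivAt (fun x : E d => x + (expPrimitive (rate p) t * preact p x) • p.1)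
      (flowDeriv p t) x := by
    refine ((hasFDerivAt_id x).add (((hasFDerivAt_preact p x).const_mul
      (expPrimitive (rate p) t)).smul_const p.1)).congr_fderiv ?_
    ext1 y
    simp [flowDeriv, smul_smul, mul_comm]
  refine haffine.hasFDerivWithinAt.congr (fun y hy => ?_) ?_
  · rw [flow, max_eq_left (le_of_lt hy)]
  · rw [flow, max_eq_left hx.le]

lemma hasLogJacobian_flow (t : ℝ) : HasLogJacobian volume (flow p t) (flowLogJac p t) := by
  refine ⟨measurableEmbedding_flow p t, measurable_flowLogJac p t, ?_⟩
  set S : Set (E d) := {x | 0 < preact p x}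
  have hS : MeasurableSet S := measurableSet_preact_pos p
  ext s hs
  have hs' : MeasurableSet (flow p t ⁻¹' s) := (continuous_flow p t).measurable hs
  rw [Measure.map_apply (continuous_flow p t).measurable hs, withDensity_apply _ hs',
    ← lintegral_indicator hs', ← lintegral_indicator_one hs,
    ← lintegral_add_compl _ hS, ← lintegral_add_compl (s.indicator 1) hS]
  congr 1
  · conv_rhs => rw [show S = flow p t '' S from (image_flow_preact_pos p t).symm]
    rw [lintegral_image_eq_lintegral_abs_det_fderiv_mul volume hS
      (fun x hx => hasFDerivWithinAt_flow p t hx) (measurableEmbedding_flow p t).injective.injOn]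
    refine setLIntegral_congr_fun hS fun x (hx : 0 < preact p x) => ?_
    by_cases hy : flow p t x ∈ s <;> simp [det_flowDeriv, indicator, flowLogJac, hx, hy]
  · refine setLIntegral_congr_fun hS.compl fun x (hx : ¬ 0 < preact p x) => ?_
    by_cases hy : x ∈ s <;>
      simp [indicator, flowLogJac, hx, flow_of_preact_nonpos (not_lt.1 hx), hy]

end Flow

lemma rate_inv_smul (p : Param d) (τ : ℝ) : rate (τ⁻¹ • p.1, p.2) = rate p / τ := by
  simp [rate, inner_smul_right, div_eq_inv_mul]

lemma flow_inv_smul (p : Param d) {τ : ℝ} (hτ : τ ≠ 0) :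
    flow (τ⁻¹ • p.1, p.2) τ = flow p 1 := by
  ext1 x
  simp only [flow, rate_inv_smul, expPrimitive_div _ hτ, smul_smul]
  congr 2
  rw [mul_right_comm, mul_right_comm τ, mul_inv_cancel₀ hτ, one_mul]
  rfl

lemma flowLogJac_inv_smul (p : Param d) {τ : ℝ} (hτ : τ ≠ 0) :
    flowLogJac (τ⁻¹ • p.1, p.2) τ = flowLogJac p 1 := by
  ext1 x
  simp only [flowLogJac, rate_inv_smul, div_mul_cancel₀ _ hτ, mul_one]
  rfl

/-! ### Compositions of perceptron flows -/

/-- `Ψ` is a composition of finitely many unit-time perceptron flows and `e^ℓ` is its Jacobian.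
Such maps are the flow maps, and also the inverse flow maps, of piecewise constant controls. -/
inductive Reachable : (E d → E d) → (E d → ℝ) → Prop
  | id : Reachable id 0
  | comp_flow {Ψ ℓ} (p : Param d) : Reachable Ψ ℓ →
      Reachable (Ψ ∘ flow p 1) (fun x => flowLogJac p 1 x + ℓ (flow p 1 x))

lemma reachable_flow (p : Param d) : Reachable (flow p 1) (flowLogJac p 1) := by
  simpa [Function.comp_def] using (Reachable.id (d := d)).comp_flow p

namespace Reachable

variable {Ψ Ψ₁ Ψ₂ : E d → E d} {ℓ ℓ₁ ℓ₂ : E d → ℝ}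

lemma comp (h₂ : Reachable Ψ₂ ℓ₂) (h₁ : Reachable Ψ₁ ℓ₁) :
    Reachable (Ψ₂ ∘ Ψ₁) (fun x => ℓ₁ x + ℓ₂ (Ψ₁ x)) := by
  induction h₁ with
  | id => simpa using h₂
  | comp_flow p _ ih => simpa [Function.comp_def, add_assoc] using ih.comp_flow p

lemma hasLogJacobian (h : Reachable Ψ ℓ) : HasLogJacobian volume Ψ ℓ := by
  induction h with
  | id => exact .id
  | comp_flow p _ ih => exact ih.comp (hasLogJacobian_flow p 1)

lemma continuous (h : Reachable Ψ ℓ) : Continuous Ψ := by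
  induction h with
  | id => exact continuous_id
  | comp_flow p _ ih => exact ih.comp (continuous_flow p 1)

lemma exists_abs_log_le (h : Reachable Ψ ℓ) : ∃ C, ∀ x, |ℓ x| ≤ C := by
  induction h with
  | id => exact ⟨0, by simp⟩
  | comp_flow p _ ih =>
    obtain ⟨C, hC⟩ := ih
    exact ⟨|rate p| * |1| + C, fun x =>
      (abs_add_le _ _).trans (add_le_add (abs_flowLogJac_le p 1 x) (hC _))⟩

end Reachable

/-- The flow map at time `n * τ` of the control that equals `p k` on `[k * τ, (k + 1) * τ)`. -/
def stageMap (p : ℕ → Param d) (τ : ℝ) : ℕ → E d → E d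
  | 0 => id
  | n + 1 => flow (p n) τ ∘ stageMap p τ n

/-- The inverse of `stageMap`. -/
def stageInv (p : ℕ → Param d) (τ : ℝ) : ℕ → E d → E d
  | 0 => id
  | n + 1 => stageInv p τ n ∘ flow (p n) (-τ)

/-- The logarithm of the Jacobian of `stageInv`. -/
def stageInvLogJac (p : ℕ → Param d) (τ : ℝ) : ℕ → E d → ℝ
  | 0 => 0
  | n + 1 => fun x => flowLogJac (p n) (-τ) x + stageInvLogJac p τ n (flow (p n) (-τ) x)

section Stage

variable (p : ℕ → Param d) (τ : ℝ)

lemma stageMap_stageInv (n : ℕ) (x : E d) : stageMap p τ n (stageInv p τ n x) = x := by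
  induction n generalizing x with
  | zero => rfl
  | succ n ih => simp [stageInv, stageMap, ih]

lemma continuous_stageMap (n : ℕ) : Continuous (stageMap p τ n) := by
  induction n with
  | zero => exact continuous_id
  | succ n ih => exact (continuous_flow _ _).comp ih

lemma hasLogJacobian_stageInv (n : ℕ) :
    HasLogJacobian volume (stageInv p τ n) (stageInvLogJac p τ n) := by
  induction n with
  | zero => exact .id
  | succ n ih => exact ih.comp (hasLogJacobian_flow (p n) (-τ))

variable {p} in
lemma stageInv_congr {q : ℕ → Param d} {n : ℕ} (h : ∀ k < n, p k = q k) :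
    stageInv p τ n = stageInv q τ n ∧ stageInvLogJac p τ n = stageInvLogJac q τ n := by
  induction n with
  | zero => exact ⟨rfl, rfl⟩
  | succ n ih =>
    obtain ⟨hinv, hlog⟩ := ih fun k hk => h k (hk.trans n.lt_succ_self)
    simp only [stageInv, stageInvLogJac, hinv, hlog, h n n.lt_succ_self, and_self]

end Stage

/- Rescaling `w` by `(-τ)⁻¹` turns a backward stage of duration `τ` into a unit-time flow; hence the
number of stages can be fixed before their duration. -/
lemma Reachable.exists_stageInv_eq {Ψ : E d → E d} {ℓ : E d → ℝ} (h : Reachable Ψ ℓ) :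
    ∃ n : ℕ, 0 < n ∧ ∀ τ : ℝ, τ ≠ 0 → ∃ p : ℕ → Param d,
      stageInv p τ n = Ψ ∧ stageInvLogJac p τ n = ℓ := by
  induction h with
  | id =>
    refine ⟨1, one_pos, fun τ _ => ⟨0, ?_, ?_⟩⟩
    · ext1 x; simp [stageInv, flow]
    · ext1 x; simp [stageInvLogJac, flowLogJac, rate]
  | comp_flow q _ ih =>
    obtain ⟨n, -, hn⟩ := ih
    refine ⟨n + 1, n.succ_pos, fun τ hτ => ?_⟩
    obtain ⟨p, hinv, hlog⟩ := hn τ hτ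
    refine ⟨Function.update p n ((-τ)⁻¹ • q.1, q.2), ?_⟩
    obtain ⟨hinv', hlog'⟩ := stageInv_congr (p := Function.update p n ((-τ)⁻¹ • q.1, q.2))
      (q := p) τ (n := n) fun k hk => Function.update_of_ne hk.ne _ _
    have hτ' : -τ ≠ 0 := neg_ne_zero.2 hτ
    simp only [stageInv, stageInvLogJac, hinv', hlog', Function.update_self, flow_inv_smul q hτ',
      flowLogJac_inv_smul q hτ', hinv, hlog, and_self]

/-! ### Limits of compositions of perceptron flows -/

/-- `(Ψ, ℓ)` is a limit of compositions of perceptron flows: the sequence is eventually equal to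
`(Ψ, ℓ)` at every point, has uniformly linear growth and uniformly bounded Jacobians. The limit map
may be discontinuous, but dominated convergence transfers integral estimates to the sequence. -/
def LimitReachable (Ψ : E d → E d) (ℓ : E d → ℝ) : Prop :=
  ∃ (Ψn : ℕ → E d → E d) (ℓn : ℕ → E d → ℝ) (C : ℝ), 0 ≤ C ∧ (∀ n, Reachable (Ψn n) (ℓn n)) ∧
    (∀ x, ∀ᶠ n in atTop, Ψn n x = Ψ x ∧ ℓn n x = ℓ x) ∧
    (∀ n x, ‖Ψn n x‖ ≤ C * (1 + ‖x‖)) ∧ ∀ n x, |ℓn n x| ≤ C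

namespace LimitReachable

lemma id : LimitReachable (id : E d → E d) 0 :=
  ⟨fun _ => _root_.id, fun _ => 0, 1, zero_le_one, fun _ => .id, fun x => by simp,
    fun _ x => by simp, fun _ x => by simp⟩

lemma comp {Ψ₁ Ψ₂ : E d → E d} {ℓ₁ ℓ₂ : E d → ℝ} (h₂ : LimitReachable Ψ₂ ℓ₂)
    (h₁ : LimitReachable Ψ₁ ℓ₁) :
    LimitReachable (Ψ₂ ∘ Ψ₁) (fun x => ℓ₁ x + ℓ₂ (Ψ₁ x)) := by
  obtain ⟨A, a, C, hC, hA, hA_lim, hA_growth, ha⟩ := h₁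
  obtain ⟨B, b, D, hD, hB, hB_lim, hB_growth, hb⟩ := h₂
  refine ⟨fun n => B n ∘ A n, fun n x => a n x + b n (A n x), D * (1 + C) + C + D,
    by positivity, fun n => (hB n).comp (hA n), fun x => ?_, fun n x => ?_, fun n x => ?_⟩
  · filter_upwards [hA_lim x, hB_lim (Ψ₁ x)] with n h₁ h₂
    simp [h₁.1, h₁.2, h₂.1, h₂.2]
  · calc ‖B n (A n x)‖ ≤ D * (1 + C * (1 + ‖x‖)) := by grw [hB_growth, hA_growth]
      _ ≤ D * (1 + C) * (1 + ‖x‖) := by nlinarith [norm_nonneg x, mul_nonneg hD (norm_nonneg x)]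
      _ ≤ (D * (1 + C) + C + D) * (1 + ‖x‖) := by gcongr; linarith
  · calc |a n x + b n (A n x)| ≤ C + D := (abs_add_le _ _).trans (add_le_add (ha n x) (hb n _))
      _ ≤ D * (1 + C) + C + D := by linarith [show 0 ≤ D * (1 + C) by positivity]

end LimitReachable

/-! ### Shears -/

/-- The `i`-th vector of the standard basis of `ℝ^d`. -/
def basisVec (i : Fin d) : E d := EuclideanSpace.single i 1

@[simp] lemma basisVec_self (i : Fin d) : basisVec i i = 1 := by simp [basisVec]

lemma basisVec_of_ne {i j : Fin d} (h : j ≠ i) : basisVec i j = 0 := by simp [basisVec, h]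

@[simp] lemma norm_basisVec (i : Fin d) : ‖basisVec i‖ = 1 := by simp [basisVec]

@[simp] lemma inner_basisVec_left (i : Fin d) (x : E d) : inner ℝ (basisVec i) x = x i := by
  simp [basisVec, EuclideanSpace.inner_single_left]

/-- `s` does not depend on the `i`-th coordinate, and the shears `x ↦ x ± s(x) e_i` are compositions
of perceptron flows. -/
structure IsShear (i : Fin d) (s : E d → ℝ) : Prop where
  apply_add_smul : ∀ (x : E d) (r : ℝ), s (x + r • basisVec i) = s x
  reachable_add : Reachable (fun x => x + s x • basisVec i) 0
  reachable_sub : Reachable (fun x => x - s x • basisVec i) 0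

namespace IsShear

variable {i : Fin d} {s t : E d → ℝ}

lemma zero (i : Fin d) : IsShear i (fun _ => 0) :=
  ⟨fun _ _ => rfl, by simpa using! Reachable.id, by simpa using! Reachable.id⟩

lemma apply_sub_smul (hs : IsShear i s) (x : E d) (r : ℝ) : s (x - r • basisVec i) = s x := by
  simpa only [neg_smul, ← sub_eq_add_neg] using hs.apply_add_smul x (-r)

lemma add (hs : IsShear i s) (ht : IsShear i t) : IsShear i (fun x => s x + t x) := by
  refine ⟨fun x r => by rw [hs.apply_add_smul, ht.apply_add_smul], ?_, ?_⟩
  · convert ht.reachable_add.comp hs.reachable_add using 1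
    · ext1 x
      simp only [Function.comp, ht.apply_add_smul]
      module
    · ext1; simp
  · convert ht.reachable_sub.comp hs.reachable_sub using 1
    · ext1 x
      simp only [Function.comp, ht.apply_sub_smul]
      module
    · ext1; simp

lemma sum {ι : Type*} (J : Finset ι) {s : ι → E d → ℝ} (h : ∀ j ∈ J, IsShear i (s j)) :
    IsShear i (fun x => ∑ j ∈ J, s j x) := by
  classical
  induction J using Finset.induction_on with
  | empty => simpa using zero i
  | insert a J ha ih =>
    simp only [Finset.sum_insert ha]
    exact (h a (Finset.mem_insert_self _ _)).add
      (ih fun j hj => h j (Finset.mem_insert_of_mem hj))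

end IsShear

/- A neuron whose `w` is orthogonal to `a` preserves its preactivation, so its flow is a shear. -/
lemma reachable_ridge {i j : Fin d} (hij : j ≠ i) (k a b : ℝ) :
    Reachable (fun x : E d => x + (k * max (a * x j + b) 0) • basisVec i) 0 := by
  have hrate : rate (k • basisVec i, a • basisVec j, b) = 0 := by
    simp [rate, inner_smul_left, inner_smul_right, basisVec_of_ne hij]
  convert reachable_flow (k • basisVec i, a • basisVec j, b) using 1
  · ext1 x
    simp [flow, hrate, expPrimitive_zero_left, preact, inner_smul_left, smul_smul, mul_comm]
  · ext1 x
    simp [flowLogJac, hrate]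

lemma isShear_ridge {i j : Fin d} (hij : j ≠ i) (k a b : ℝ) :
    IsShear i (fun x : E d => k * max (a * x j + b) 0) := by
  refine ⟨fun x r => by simp [basisVec_of_ne hij], reachable_ridge hij k a b, ?_⟩
  simpa [sub_eq_add_neg] using reachable_ridge hij (-k) a b

/-! ### Dilations of half-lines, localized to cylinders -/

/-- The dilation by the factor `e^c` of the half-line `(-∞, b]` about `b`. -/
def dilation (b c y : ℝ) : ℝ := y - (Real.exp c - 1) * max (b - y) 0

/-- The logarithm of the derivative of `dilation b c`. -/
def dilationLogDeriv (b c y : ℝ) : ℝ := if y < b then c else 0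

lemma dilation_of_ge {b y : ℝ} (h : b ≤ y) (c : ℝ) : dilation b c y = y := by
  simp [dilation, max_eq_right (sub_nonpos.2 h)]

lemma abs_dilation_sub_le (b c y : ℝ) :
    |dilation b c y - y| ≤ |Real.exp c - 1| * max (b - y) 0 := by
  rw [dilation, sub_sub_cancel_left, abs_neg, abs_mul, abs_of_nonneg (le_max_right (b - y) 0)]

lemma abs_dilationLogDeriv_le (b c y : ℝ) : |dilationLogDeriv b c y| ≤ |c| := by
  unfold dilationLogDeriv; split_ifs <;> simp

lemma reachable_dilation (i : Fin d) (b c : ℝ) :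
    Reachable (fun x : E d => x + (dilation b c (x i) - x i) • basisVec i)
      (fun x => dilationLogDeriv b c (x i)) := by
  have hrate : rate ((-c) • basisVec i, -basisVec i, b) = c := by
    simp [rate, inner_smul_right]
  have hpreact (x : E d) : preact ((-c) • basisVec i, -basisVec i, b) x = b - x i := by
    simp [preact, neg_add_eq_sub]
  have hexp : Real.exp c - 1 = c * expPrimitive c 1 := by rw [mul_expPrimitive, mul_one]
  convert reachable_flow ((-c) • basisVec i, -basisVec i, b) using 1
  · ext1 x
    simp only [flow, hrate, hpreact, smul_smul, dilation, hexp]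
    congr 2
    ring
  · ext1 x
    simp only [flowLogJac, hrate, dilationLogDeriv, hpreact, sub_pos, mul_one]

lemma IsShear.reachable_dilation {i : Fin d} {s : E d → ℝ} (hs : IsShear i s) (b c : ℝ) :
    Reachable (fun x : E d => x + (dilation b c (x i + s x) - (x i + s x)) • basisVec i)
      (fun x => dilationLogDeriv b c (x i + s x)) := by
  convert hs.reachable_sub.comp ((NeuralFlow.reachable_dilation i b c).comp hs.reachable_add)
    using 1
  · ext1 x
    simp only [Function.comp, hs.apply_add_smul, PiLp.add_apply, PiLp.smul_apply, basisVec_self,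
      smul_eq_mul, mul_one]
    module
  · ext1 x; simp

/-- The cylinder of the points whose `j`-th coordinate lies in `[α j, β j)` for all `j ∈ J`. -/
def cylinder {J : Finset (Fin d)} (α β : J → ℝ) : Set (E d) := {x | ∀ j, x j ∈ Ico (α j) (β j)}

lemma add_smul_basisVec_mem_cylinder_iff {i : Fin d} {J : Finset (Fin d)} (hi : i ∉ J)
    (α β : J → ℝ) (x : E d) (r : ℝ) :
    x + r • basisVec i ∈ cylinder α β ↔ x ∈ cylinder α β := by
  refine forall_congr' fun j => ?_
  simp [basisVec_of_ne (ne_of_mem_of_not_mem j.2 hi)]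

open Classical in
/-- Apply `h` to the `i`-th coordinate at the points of `Q`. -/
def localize (i : Fin d) (Q : Set (E d)) (h : ℝ → ℝ) (x : E d) : E d :=
  if x ∈ Q then x + (h (x i) - x i) • basisVec i else x

open Classical in
/-- The logarithm of the Jacobian of `localize i Q h` when `e^l` is the derivative of `h`. -/
def localizeLogJac (i : Fin d) (Q : Set (E d)) (l : ℝ → ℝ) (x : E d) : ℝ :=
  if x ∈ Q then l (x i) else 0

/-- A sum of two ridge functions that tends to `0` on `[α, β)` and to `∞` off it. -/
def wall (α β : ℝ) (n : ℕ) (y : ℝ) : ℝ :=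
  ((n : ℝ) + 1) ^ 2 * max (1 * y + (((n : ℝ) + 1)⁻¹ - β)) 0 +
    ((n : ℝ) + 1) ^ 2 * max ((-1) * y + α) 0

lemma wall_nonneg (α β : ℝ) (n : ℕ) (y : ℝ) : 0 ≤ wall α β n y := by
  unfold wall; positivity

lemma tendsto_natCast_add_one_atTop : Tendsto (fun n : ℕ => (n : ℝ) + 1) atTop atTop :=
  tendsto_atTop_add_const_right _ 1 tendsto_natCast_atTop_atTop

lemma eventually_wall_eq_zero {α β y : ℝ} (hy : y ∈ Ico α β) :
    ∀ᶠ n in atTop, wall α β n y = 0 := by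
  have hlim := tendsto_inv_atTop_zero.comp tendsto_natCast_add_one_atTop
  filter_upwards [hlim.eventually_lt_const (sub_pos.2 hy.2)] with n hn
  rw [Function.comp] at hn
  rw [wall, max_eq_right (by linarith), max_eq_right (by linarith [hy.1]), mul_zero, add_zero]

lemma tendsto_wall_atTop {α β y : ℝ} (hy : y ∉ Ico α β) :
    Tendsto (fun n => wall α β n y) atTop atTop := by
  by_cases hα : α ≤ y
  · have hβ : β ≤ y := not_lt.1 fun h => hy ⟨hα, h⟩
    refine tendsto_atTop_mono (fun n => ?_) tendsto_natCast_add_one_atTop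
    calc (n : ℝ) + 1 = ((n : ℝ) + 1) ^ 2 * ((n : ℝ) + 1)⁻¹ := by field_simp
      _ ≤ ((n : ℝ) + 1) ^ 2 * max (1 * y + (((n : ℝ) + 1)⁻¹ - β)) 0 := by
          gcongr
          exact le_max_of_le_left (by linarith)
      _ ≤ wall α β n y := le_add_of_nonneg_right (by positivity)
  · have hα' : 0 < α - y := sub_pos.2 (not_le.1 hα)
    refine tendsto_atTop_mono (fun n => ?_) (tendsto_natCast_add_one_atTop.atTop_mul_const hα')
    have hn : (1 : ℝ) ≤ (n : ℝ) + 1 := by simp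
    calc ((n : ℝ) + 1) * (α - y) ≤ ((n : ℝ) + 1) ^ 2 * max ((-1) * y + α) 0 := by
          gcongr
          · exact le_self_pow₀ hn two_ne_zero
          · exact le_max_of_le_left (by linarith)
      _ ≤ wall α β n y := le_add_of_nonneg_left (by positivity)

/-- A sum of ridge functions that tends to `0` on a cylinder and to `∞` off it. -/
def barrier {J : Finset (Fin d)} (α β : J → ℝ) (n : ℕ) (x : E d) : ℝ :=
  ∑ j, wall (α j) (β j) n (x j)

section Barrier

variable {J : Finset (Fin d)} {α β : J → ℝ} {x : E d}

lemma isShear_barrier {i : Fin d} (hi : i ∉ J) (α β : J → ℝ) (n : ℕ) :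
    IsShear i (barrier α β n) :=
  .sum Finset.univ fun j _ =>
    have hji := ne_of_mem_of_not_mem j.2 hi
    (isShear_ridge hji _ _ _).add (isShear_ridge hji _ _ _)

lemma barrier_nonneg (α β : J → ℝ) (n : ℕ) (x : E d) :
    0 ≤ barrier α β n x :=
  Finset.sum_nonneg fun _ _ => wall_nonneg _ _ _ _

lemma eventually_barrier_eq_zero (hx : x ∈ cylinder α β) :
    ∀ᶠ n in atTop, barrier α β n x = 0 := by
  filter_upwards [eventually_all.2 fun j => eventually_wall_eq_zero (hx j)] with n hn
  exact Finset.sum_eq_zero fun j _ => hn j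

lemma tendsto_barrier_atTop (hx : x ∉ cylinder α β) :
    Tendsto (fun n => barrier α β n x) atTop atTop := by
  obtain ⟨j, hxj⟩ : ∃ j, x j ∉ Ico (α j) (β j) := not_forall.1 hx
  exact tendsto_atTop_mono (fun n => Finset.single_le_sum
    (f := fun j => wall (α j) (β j) n (x j)) (fun _ _ => wall_nonneg _ _ _ _) (Finset.mem_univ j))
    (tendsto_wall_atTop hxj)

end Barrier

/- Conjugating a dilation by the shear along a steep barrier pushes the points off the cylinder out
of the half-line that is dilated, and leaves those of the cylinder where they are. -/
lemma limitReachable_localize_dilation {i : Fin d} {J : Finset (Fin d)} (hi : i ∉ J)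
    (α β : J → ℝ) (b c : ℝ) :
    LimitReachable (localize i (cylinder α β) (dilation b c))
      (localizeLogJac i (cylinder α β) (dilationLogDeriv b c)) := by
  set κ := |Real.exp c - 1|
  have hκ : 0 ≤ κ := abs_nonneg _
  set y : ℕ → E d → ℝ := fun n x => x i + barrier α β n x
  refine ⟨fun n x => x + (dilation b c (y n x) - y n x) • basisVec i,
    fun n x => dilationLogDeriv b c (y n x), 1 + κ * (1 + |b|) + |c|, by positivity,
    fun n => (isShear_barrier hi α β n).reachable_dilation b c,
    fun x => ?_, fun n x => ?_, fun n x => ?_⟩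
  · by_cases hx : x ∈ cylinder α β
    · filter_upwards [eventually_barrier_eq_zero hx] with n hn
      simp [localize, localizeLogJac, hx, y, hn]
    · filter_upwards [(tendsto_barrier_atTop hx).eventually_ge_atTop (b - x i)] with n hn
      have hy : b ≤ y n x := sub_le_iff_le_add'.1 hn
      simp [localize, localizeLogJac, hx, dilation_of_ge hy, dilationLogDeriv, hy.not_gt]
  · have hby : b - y n x ≤ |b| + ‖x‖ := by
      have hxi : -x i ≤ ‖x‖ := (neg_le_abs _).trans (PiLp.norm_apply_le x i)
      linarith [barrier_nonneg α β n x, le_abs_self b]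
    calc ‖x + (dilation b c (y n x) - y n x) • basisVec i‖
        ≤ ‖x‖ + |dilation b c (y n x) - y n x| := by
          grw [norm_add_le, norm_smul, norm_basisVec, mul_one, Real.norm_eq_abs]
      _ ≤ ‖x‖ + κ * (|b| + ‖x‖) := by
          grw [abs_dilation_sub_le, max_le hby (by positivity)]
      _ ≤ (1 + κ * (1 + |b|)) * (1 + ‖x‖) := by
          nlinarith [norm_nonneg x, mul_nonneg (mul_nonneg hκ (abs_nonneg b)) (norm_nonneg x)]
      _ ≤ (1 + κ * (1 + |b|) + |c|) * (1 + ‖x‖) := by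
          grw [← abs_nonneg c, add_zero]
  · exact (abs_dilationLogDeriv_le _ _ _).trans (le_add_of_nonneg_left (by positivity))

/-- `h` is a composition of dilations of half-lines and `e^l` is its derivative. -/
inductive LineReachable : (ℝ → ℝ) → (ℝ → ℝ) → Prop
  | id : LineReachable id 0
  | dilation_comp {h l} (b c : ℝ) : LineReachable h l →
      LineReachable (dilation b c ∘ h) (fun y => l y + dilationLogDeriv b c (h y))

lemma LineReachable.limitReachable_localize {h l : ℝ → ℝ} (hl : LineReachable h l) {i : Fin d}
    {J : Finset (Fin d)} (hi : i ∉ J) (α β : J → ℝ) :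
    LimitReachable (localize i (cylinder α β) h) (localizeLogJac i (cylinder α β) l) := by
  induction hl with
  | id =>
    convert LimitReachable.id (d := d) using 1
    · ext1 x; simp [localize]
    · ext1 x; simp [localizeLogJac]
  | dilation_comp b c _ ih =>
    convert (limitReachable_localize_dilation hi α β b c).comp ih using 1
    · ext1 x
      by_cases hx : x ∈ cylinder α β
      · simp only [localize, hx, if_true, Function.comp, PiLp.add_apply, PiLp.smul_apply,
          add_smul_basisVec_mem_cylinder_iff hi, basisVec_self, smul_eq_mul, mul_one]
        rw [add_sub_cancel]
        module
      · simp [localize, hx]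
    · ext1 x
      by_cases hx : x ∈ cylinder α β
      · simp [localize, localizeLogJac, hx, add_smul_basisVec_mem_cylinder_iff hi]
      · simp [localize, localizeLogJac, hx]

/-! ### Piecewise linear maps of the line -/

/- Dilating `(-∞, b]` after `h`, where `h a = b`, changes the slope to the left of `a` only. -/
lemma LineReachable.exists_change_slope_left {h l : ℝ → ℝ} (hl : LineReachable h l)
    {a b s s' : ℝ} (hs : 0 < s) (hs' : 0 < s') (hge : ∀ z, a ≤ z → b ≤ h z)
    (hlt : ∀ z < a, h z = b + s * (z - a) ∧ l z = Real.log s) :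
    ∃ h' l', LineReachable h' l' ∧ (∀ z, a ≤ z → h' z = h z ∧ l' z = l z) ∧
      ∀ z < a, h' z = b + s' * (z - a) ∧ l' z = Real.log s' := by
  refine ⟨_, _, hl.dilation_comp b (Real.log (s' / s)), fun z hz => ?_, fun z hz => ?_⟩
  · simp [dilation_of_ge (hge z hz), dilationLogDeriv, (hge z hz).not_gt]
  · obtain ⟨hz_eq, hz_log⟩ := hlt z hz
    have hz_lt : h z < b := by
      rw [hz_eq]
      exact add_lt_of_neg_right b (mul_neg_of_pos_of_neg hs (sub_neg.2 hz))
    rw [Function.comp, dilation, dilationLogDeriv, max_eq_left (sub_nonneg.2 hz_lt.le),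
      if_pos hz_lt, Real.exp_log (div_pos hs' hs), Real.log_div hs'.ne' hs.ne', hz_log, hz_eq]
    exact ⟨by field_simp; ring, by ring⟩

/-- `h` interpolates linearly between the points `(y j, v j)`, `m ≤ j ≤ n`, has slope `s` to the
left of `y m` and slope `1` to the right of `y n`; and `e^l` is the derivative of `h`. -/
structure IsInterpolation (y v : ℕ → ℝ) (m n : ℕ) (s : ℝ) (h l : ℝ → ℝ) : Prop where
  of_ge : ∀ z, y n ≤ z → h z = z ∧ l z = 0
  of_mem : ∀ j ∈ Ico m n, ∀ z ∈ Ico (y j) (y (j + 1)),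
    h z = v j + (v (j + 1) - v j) / (y (j + 1) - y j) * (z - y j) ∧
      l z = Real.log ((v (j + 1) - v j) / (y (j + 1) - y j))
  of_lt : ∀ z < y m, h z = v m + s * (z - y m) ∧ l z = Real.log s
  le_apply : ∀ z, y m ≤ z → v m ≤ h z

lemma exists_isInterpolation {y v : ℕ → ℝ} {m n : ℕ} (hy : StrictMono y)
    (hv : ∀ j < n, v j < v (j + 1)) (hn : y n = v n) (hmn : m ≤ n) {s : ℝ} (hs : 0 < s) :
    ∃ h l, LineReachable h l ∧ IsInterpolation y v m n s h l := by
  induction hmn using Nat.decreasingInduction generalizing s with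
  | self =>
    obtain ⟨h, l, hr, hge, hlt⟩ := LineReachable.id.exists_change_slope_left (a := y n) (b := y n)
      one_pos hs (fun z hz => hz) (fun z _ => by simp)
    exact ⟨h, l, hr, hge, fun j hj => absurd hj.1 hj.2.not_ge, hn ▸ hlt,
      fun z hz => hn ▸ (hge z hz).1.symm ▸ hz⟩
  | of_succ m hm ih =>
    have hΔy := sub_pos.2 (hy m.lt_succ_self)
    have hΔv := sub_pos.2 (hv m hm)
    set s₁ := (v (m + 1) - v m) / (y (m + 1) - y m)
    have hs₁ : 0 < s₁ := div_pos hΔv hΔy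
    obtain ⟨h, l, hr, hI⟩ := ih hs₁
    have hlin : ∀ z < y (m + 1), h z = v m + s₁ * (z - y m) := fun z hz => by
      have hs₁m : s₁ * (y (m + 1) - y m) = v (m + 1) - v m := div_mul_cancel₀ _ hΔy.ne'
      linarith [(hI.of_lt z hz).1]
    have hge : ∀ z, y m ≤ z → v m ≤ h z := fun z hz => by
      rcases lt_or_ge z (y (m + 1)) with hz' | hz'
      · rw [hlin z hz']
        exact le_add_of_nonneg_right (mul_nonneg hs₁.le (sub_nonneg.2 hz))
      · exact (sub_pos.1 hΔv).le.trans (hI.le_apply z hz')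
    have hlt : ∀ z < y m, h z = v m + s₁ * (z - y m) ∧ l z = Real.log s₁ := fun z hz =>
      have hz' := hz.trans (hy m.lt_succ_self)
      ⟨hlin z hz', (hI.of_lt z hz').2⟩
    obtain ⟨h', l', hr', hge', hlt'⟩ := hr.exists_change_slope_left hs₁ hs hge hlt
    refine ⟨h', l', hr', fun z hz => ?_, fun j hj z hz => ?_, hlt', fun z hz => ?_⟩
    · rw [(hge' z ((hy.monotone hm.le).trans hz)).1, (hge' z ((hy.monotone hm.le).trans hz)).2]
      exact hI.of_ge z hz
    · have hz' := hge' z ((hy.monotone hj.1).trans hz.1)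
      rw [hz'.1, hz'.2]
      rcases hj.1.eq_or_lt with rfl | hmj
      · exact ⟨hlin z hz.2, (hI.of_lt z hz.2).2⟩
      · exact hI.of_mem j ⟨hmj, hj.2⟩ z hz
    · exact (hge' z hz).1.symm ▸ hge z hz

lemma IsInterpolation.apply_mem_Icc {y v : ℕ → ℝ} {m n : ℕ} {s : ℝ} {h l : ℝ → ℝ}
    (hI : IsInterpolation y v m n s h l) {j : ℕ} (hj : j ∈ Ico m n) (hv : v j ≤ v (j + 1)) {z : ℝ}
    (hz : z ∈ Ico (y j) (y (j + 1))) : h z ∈ Icc (v j) (v (j + 1)) := by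
  have hslope : 0 ≤ (v (j + 1) - v j) / (y (j + 1) - y j) :=
    div_nonneg (sub_nonneg.2 hv) (sub_nonneg.2 (hz.1.trans hz.2.le))
  rw [(hI.of_mem j hj z hz).1]
  refine ⟨le_add_of_nonneg_right (mul_nonneg hslope (sub_nonneg.2 hz.1)), ?_⟩
  calc v j + (v (j + 1) - v j) / (y (j + 1) - y j) * (z - y j)
      ≤ v j + (v (j + 1) - v j) / (y (j + 1) - y j) * (y (j + 1) - y j) := by grw [hz.2]
    _ = v (j + 1) := by
      rw [div_mul_cancel₀ _ (sub_pos.2 (hz.1.trans_lt hz.2)).ne', add_sub_cancel]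

/-! ### Grids of the line -/

/-- The `c`-th of the nodes that divide `[-R, R]` into `N` equal cells. -/
def gridPoint (R : ℝ) (N c : ℕ) : ℝ := -R + 2 * R * c / N

/-- The `c`-th of the `N` equal cells of `[-R, R)`. -/
def gridIco (R : ℝ) (N c : ℕ) : Set ℝ := Ico (gridPoint R N c) (gridPoint R N (c + 1))

/-- The index of the cell of `[-R, R)` that contains `z`. -/
def gridIndex (R : ℝ) (N : ℕ) (z : ℝ) : ℕ := ⌊(z + R) * N / (2 * R)⌋₊

lemma gridPoint_zero (R : ℝ) (N : ℕ) : gridPoint R N 0 = -R := by simp [gridPoint]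

lemma gridPoint_succ_sub (R : ℝ) (N c : ℕ) :
    gridPoint R N (c + 1) - gridPoint R N c = 2 * R / N := by
  simp only [gridPoint]; push_cast; ring

section Grid

variable {R : ℝ} {N : ℕ}

lemma gridPoint_self (hN : 0 < N) (R : ℝ) : gridPoint R N N = R := by
  unfold gridPoint; field_simp; ring

lemma strictMono_gridPoint (hR : 0 < R) (hN : 0 < N) : StrictMono (gridPoint R N) :=
  strictMono_nat_of_lt_succ fun c => by rw [← sub_pos, gridPoint_succ_sub]; positivity

lemma gridPoint_le_iff (hR : 0 < R) (hN : 0 < N) {c : ℕ} {z : ℝ} :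
    gridPoint R N c ≤ z ↔ c ≤ (z + R) * N / (2 * R) := by
  have hN' : (0 : ℝ) < N := Nat.cast_pos.2 hN
  rw [gridPoint, neg_add_le_iff_le_add, add_comm R, div_le_iff₀ hN', le_div_iff₀ (by positivity),
    mul_comm (c : ℝ)]

lemma mem_gridIco_iff (hR : 0 < R) (hN : 0 < N) {c : ℕ} {z : ℝ} :
    z ∈ gridIco R N c ↔ -R ≤ z ∧ gridIndex R N z = c := by
  rw [gridIco, mem_Ico, ← not_le, gridPoint_le_iff hR hN, gridPoint_le_iff hR hN, not_le,
    Nat.cast_add_one]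
  have hneg : -R ≤ z ↔ 0 ≤ (z + R) * N / (2 * R) := by
    rw [← gridPoint_zero R N, gridPoint_le_iff hR hN, Nat.cast_zero]
  rw [hneg]
  exact ⟨fun h => ⟨c.cast_nonneg.trans h.1, (Nat.floor_eq_iff (c.cast_nonneg.trans h.1)).2 h⟩,
    fun h => (Nat.floor_eq_iff h.1).1 h.2⟩

lemma gridIndex_lt_iff (hR : 0 < R) (hN : 0 < N) {z : ℝ} (hz : -R ≤ z) :
    gridIndex R N z < N ↔ z < R := by
  have hz' : 0 ≤ z + R := neg_le_iff_add_nonneg.1 hz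
  rw [gridIndex, Nat.floor_lt (by positivity), ← not_le, ← gridPoint_le_iff hR hN, not_le,
    gridPoint_self hN]

lemma gridIco_subset (hR : 0 < R) {c : ℕ} (hc : c < N) : gridIco R N c ⊆ Ico (-R) R := by
  have hmono := (strictMono_gridPoint hR (c.zero_le.trans_lt hc)).monotone
  refine Ico_subset_Ico ?_ ?_
  · exact gridPoint_zero R N ▸ hmono c.zero_le
  · exact (hmono (Nat.succ_le_of_lt hc)).trans_eq (gridPoint_self (c.zero_le.trans_lt hc) R)

lemma pairwise_disjoint_gridIco (hR : 0 < R) (hN : 0 < N) :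
    Pairwise (Function.onFun Disjoint (gridIco R N)) := fun _ _ hcc' =>
  disjoint_left.2 fun _ hz hz' =>
    hcc' (((mem_gridIco_iff hR hN).1 hz).2.symm.trans ((mem_gridIco_iff hR hN).1 hz').2)

lemma gridIndex_mul_div {M : ℕ} (hM : 0 < M) (R : ℝ) (N : ℕ) (z : ℝ) :
    gridIndex R (N * M) z / M = gridIndex R N z := by
  have hM' : (M : ℝ) ≠ 0 := Nat.cast_ne_zero.2 hM.ne'
  rw [gridIndex, gridIndex, ← Nat.floor_div_natCast]
  congr 1
  push_cast
  field_simp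

end Grid

/-! ### The standard Gaussian density on the line -/

/-- The density of the standard Gaussian on the line. -/
def gauss (x : ℝ) : ℝ := (√(2 * Real.pi))⁻¹ * Real.exp (-x ^ 2 / 2)

lemma gauss_pos (x : ℝ) : 0 < gauss x := by unfold gauss; positivity

@[fun_prop]
lemma continuous_gauss : Continuous gauss := by unfold gauss; fun_prop

lemma gauss_le_one (x : ℝ) : gauss x ≤ 1 := by
  have hpi : 1 ≤ √(2 * Real.pi) := Real.one_le_sqrt.2 (by linarith [Real.pi_gt_three])
  have hexp : Real.exp (-x ^ 2 / 2) ≤ 1 := Real.exp_le_one_iff.2 (by nlinarith [sq_nonneg x])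
  exact mul_le_one₀ (inv_le_one_of_one_le₀ hpi) (Real.exp_pos _).le hexp

lemma log_gauss (x : ℝ) : Real.log (gauss x) = -(x ^ 2 / 2) - Real.log (√(2 * Real.pi)) := by
  have hpi : √(2 * Real.pi) ≠ 0 := by positivity
  rw [gauss, Real.log_mul (inv_ne_zero hpi) (Real.exp_pos _).ne', Real.log_inv, Real.log_exp]
  ring

lemma gauss_eq_gaussianPDFReal : gauss = ProbabilityTheory.gaussianPDFReal 0 1 := by
  ext x; simp [gauss, ProbabilityTheory.gaussianPDFReal]

lemma gauss_le_exp_mul_gauss {R u v : ℝ} (hu : |u| ≤ R) (hv : |v| ≤ R) :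
    gauss u ≤ Real.exp (R * |u - v|) * gauss v := by
  have hsq : (v - u) * (v + u) ≤ |u - v| * (2 * R) :=
    calc (v - u) * (v + u) ≤ |v - u| * |v + u| := (le_abs_self _).trans_eq (abs_mul _ _)
      _ ≤ |u - v| * (2 * R) := by
        rw [abs_sub_comm]
        gcongr
        linarith [abs_add_le v u]
  unfold gauss
  rw [mul_left_comm, ← Real.exp_add]
  gcongr
  linarith

lemma gauss_le_of_abs_le {R u : ℝ} (hu : |u| ≤ R) : gauss R ≤ gauss u := by
  have hsq : u ^ 2 ≤ R ^ 2 := sq_le_sq' (abs_le.1 hu).1 (abs_le.1 hu).2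
  unfold gauss
  gcongr

section GaussInterval

variable {R a b : ℝ}

lemma gauss_mul_sub_le_integral (hab : a ≤ b) (ha : -R ≤ a) (hb : b ≤ R) :
    gauss R * (b - a) ≤ ∫ x in a..b, gauss x := by
  have hmono : ∫ _ in a..b, gauss R ≤ ∫ x in a..b, gauss x :=
    intervalIntegral.integral_mono_on hab (by simp) (continuous_gauss.intervalIntegrable _ _)
      fun u hu => gauss_le_of_abs_le (abs_le.2 ⟨ha.trans hu.1, hu.2.trans hb⟩)
  rwa [intervalIntegral.integral_const, smul_eq_mul, mul_comm] at hmono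

lemma integral_gauss_le_mul_gauss {z : ℝ} (ha : -R ≤ a) (hb : b ≤ R) (hz : z ∈ Icc a b) :
    ∫ x in a..b, gauss x ≤ (b - a) * (Real.exp (R * (b - a)) * gauss z) := by
  have hab : a ≤ b := hz.1.trans hz.2
  have hR : 0 ≤ R := by linarith
  have hmono : ∫ x in a..b, gauss x ≤ ∫ _ in a..b, Real.exp (R * (b - a)) * gauss z := by
    refine intervalIntegral.integral_mono_on hab (continuous_gauss.intervalIntegrable _ _)
      (by simp) fun u hu => ?_
    have hgz := (gauss_pos z).le
    have huz : |u - z| ≤ b - a := abs_le.2 ⟨by linarith [hu.1, hz.2], by linarith [hu.2, hz.1]⟩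
    grw [gauss_le_exp_mul_gauss (abs_le.2 ⟨ha.trans hu.1, hu.2.trans hb⟩)
      (abs_le.2 ⟨ha.trans hz.1, hz.2.trans hb⟩), huz]
  rwa [intervalIntegral.integral_const, smul_eq_mul] at hmono

lemma exp_neg_mul_integral_gauss_le {z δ : ℝ} (ha : -R ≤ a) (hb : b ≤ R) (hz : z ∈ Icc a b)
    (hδ : R * ∫ x in a..b, gauss x ≤ gauss R * δ) :
    Real.exp (-δ) * ∫ x in a..b, gauss x ≤ (b - a) * gauss z := by
  have hab : a ≤ b := hz.1.trans hz.2
  have hR : 0 ≤ R := by linarith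
  have hwidth : R * (b - a) ≤ δ := by
    refine le_of_mul_le_mul_left ?_ (gauss_pos R)
    calc gauss R * (R * (b - a)) = R * (gauss R * (b - a)) := mul_left_comm _ _ _
      _ ≤ gauss R * δ := by grw [gauss_mul_sub_le_integral hab ha hb, hδ]
  have hgz := (gauss_pos z).le
  have hab' := sub_nonneg.2 hab
  rw [Real.exp_neg, inv_mul_le_iff₀ (Real.exp_pos δ)]
  calc ∫ x in a..b, gauss x ≤ (b - a) * (Real.exp (R * (b - a)) * gauss z) :=
        integral_gauss_le_mul_gauss ha hb hz
    _ ≤ (b - a) * (Real.exp δ * gauss z) := by grw [hwidth]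
    _ = Real.exp δ * ((b - a) * gauss z) := mul_left_comm _ _ _

end GaussInterval

/-- The Gaussian mass of `[-R, R]`. -/
def gaussMass (R : ℝ) : ℝ := ∫ x in (-R)..R, gauss x

lemma gaussMass_pos {R : ℝ} (hR : 0 < R) : 0 < gaussMass R :=
  intervalIntegral.intervalIntegral_pos_of_pos (continuous_gauss.intervalIntegrable _ _)
    gauss_pos (by linarith)

lemma gaussMass_le_one {R : ℝ} (hR : 0 ≤ R) : gaussMass R ≤ 1 := by
  rw [gaussMass, intervalIntegral.integral_of_le (by linarith), gauss_eq_gaussianPDFReal,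
    ← ProbabilityTheory.integral_gaussianPDFReal_eq_one 0 one_ne_zero]
  exact setIntegral_le_integral (ProbabilityTheory.integrable_gaussianPDFReal 0 1)
    (ae_of_all _ fun x => ProbabilityTheory.gaussianPDFReal_nonneg 0 1 x)

/-! ### Realizing weights on the line -/

lemma exists_partition_of_integral_eq_sum {g : ℝ → ℝ} (hg : Continuous g) (hpos : ∀ x, 0 < g x)
    {a b : ℝ} (hab : a ≤ b) {n : ℕ} {q : ℕ → ℝ} (hq : ∀ j < n, 0 < q j)
    (hsum : ∑ j ∈ Finset.range n, q j = ∫ x in a..b, g x) :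
    ∃ v : ℕ → ℝ, v 0 = a ∧ v n = b ∧ (∀ j ≤ n, v j ∈ Icc a b) ∧ (∀ j < n, v j < v (j + 1)) ∧
      ∀ j < n, ∫ x in (v j)..(v (j + 1)), g x = q j := by
  have hint : ∀ s t, IntervalIntegrable g volume s t := hg.intervalIntegrable
  set G : ℝ → ℝ := fun u => ∫ x in a..u, g x
  have hGsub : ∀ s t, G t - G s = ∫ x in s..t, g x := fun s t =>
    intervalIntegral.integral_interval_sub_left (hint _ _) (hint _ _)
  have hG : StrictMono G := fun s t hst => by
    rw [← sub_pos, hGsub]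
    exact intervalIntegral.intervalIntegral_pos_of_pos (hint s t) hpos hst
  have hGcont : Continuous G := intervalIntegral.continuous_primitive hint a
  have hGa : G a = 0 := intervalIntegral.integral_same
  have hvalue : ∀ j ≤ n, ∃ u ∈ Icc a b, G u = ∑ i ∈ Finset.range j, q i := fun j hj => by
    have hmem : ∑ i ∈ Finset.range j, q i ∈ Icc (G a) (G b) := by
      rw [hGa, show G b = _ from hsum.symm]
      exact ⟨Finset.sum_nonneg fun i hi => (hq i ((Finset.mem_range.1 hi).trans_le hj)).le,
        Finset.sum_le_sum_of_subset_of_nonneg (Finset.range_mono hj)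
          fun i hi _ => (hq i (Finset.mem_range.1 hi)).le⟩
    exact intermediate_value_Icc hab hGcont.continuousOn hmem
  choose! v hmem hv using hvalue
  refine ⟨v, hG.injective ?_, hG.injective ?_, hmem, fun j hj => hG.lt_iff_lt.1 ?_, fun j hj => ?_⟩
  · rw [hv 0 n.zero_le, hGa, Finset.sum_range_zero]
  · rw [hv n le_rfl, hsum]
  · rw [hv j hj.le, hv (j + 1) hj, Finset.sum_range_succ]
    exact lt_add_of_pos_right _ (hq j hj)
  · rw [← hGsub, hv j hj.le, hv (j + 1) hj, Finset.sum_range_succ, add_sub_cancel_left]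

lemma sum_range_mul_div {R : Type*} [NonAssocSemiring R] (f : ℕ → R) (M N : ℕ) :
    ∑ i ∈ Finset.range (N * M), f (i / M) = M * ∑ k ∈ Finset.range N, f k := by
  induction N with
  | zero => simp
  | succ N ih =>
    have hdiv : ∀ r ∈ Finset.range M, f ((N * M + r) / M) = f N := fun r hr => by
      rw [Nat.div_eq_of_lt_le] <;> nlinarith [Finset.mem_range.1 hr]
    rw [Nat.succ_mul, Finset.sum_range_add, ih, Finset.sum_range_succ, mul_add,
      Finset.sum_congr rfl hdiv]
    simp

/- The map interpolates between the uniform grid and the points that cut the Gaussian mass of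
`[-R, R]` into the parts `q j`. -/
lemma exists_lineReachable_of_masses {R : ℝ} (hR : 0 < R) {n : ℕ} (hn : 0 < n) {q : ℕ → ℝ}
    (hq : ∀ j < n, 0 < q j) (hsum : ∑ j ∈ Finset.range n, q j = gaussMass R) {δ : ℝ}
    (hδ : ∀ j < n, R * q j ≤ gauss R * δ) :
    ∃ h l, LineReachable h l ∧ (∀ z, R ≤ z → h z = z ∧ l z = 0) ∧
      (∀ z < -R, h z = z ∧ l z = 0) ∧
      ∀ j < n, ∀ z ∈ gridIco R n j,
        Real.exp (-δ) * q j * (n / (2 * R)) ≤ gauss (h z) * Real.exp (l z) := by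
  obtain ⟨v, hv₀, hvn, hvR, hvlt, hmass⟩ := exists_partition_of_integral_eq_sum continuous_gauss
    gauss_pos (neg_le_self hR.le) hq hsum
  set y := gridPoint R n
  have hy : StrictMono y := strictMono_gridPoint hR hn
  have hy₀ : y 0 = -R := gridPoint_zero R _
  have hyn : y n = R := gridPoint_self hn R
  obtain ⟨h, l, hr, hI⟩ := exists_isInterpolation hy hvlt (hyn.trans hvn.symm) (Nat.zero_le _)
    one_pos
  refine ⟨h, l, hr, fun z hz => hI.of_ge z (hyn.trans_le hz), fun z hz => ?_, fun j hj z hz => ?_⟩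
  · simpa [hv₀, hy₀] using hI.of_lt z (hy₀.symm ▸ hz)
  · have hj' : j ∈ Ico 0 n := ⟨j.zero_le, hj⟩
    have hslope : 0 < (v (j + 1) - v j) / (y (j + 1) - y j) :=
      div_pos (sub_pos.2 (hvlt j hj)) (sub_pos.2 (hy j.lt_succ_self))
    have hkey := exp_neg_mul_integral_gauss_le (hvR j hj.le).1 (hvR (j + 1) hj).2
      (hI.apply_mem_Icc hj' (hvlt j hj).le hz) (by rw [hmass j hj]; exact hδ j hj)
    rw [hmass j hj] at hkey
    rw [(hI.of_mem j hj' z hz).2, Real.exp_log hslope, gridPoint_succ_sub]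
    calc Real.exp (-δ) * q j * (n / (2 * R))
        ≤ (v (j + 1) - v j) * gauss (h z) * (n / (2 * R)) := by gcongr
      _ = gauss (h z) * ((v (j + 1) - v j) / (2 * R / n)) := by field_simp

/- Each cell is subdivided further, so finely that `gauss` varies at most by the factor `e^δ`
between consecutive quantiles. -/
lemma exists_lineReachable_of_weights {R : ℝ} (hR : 0 < R) {N : ℕ} (hN : 0 < N) {w : ℕ → ℝ}
    (hw : ∀ k < N, 0 < w k) (hsum : ∑ k ∈ Finset.range N, w k = 1) {δ : ℝ} (hδ : 0 < δ) :
    ∃ h l, LineReachable h l ∧ (∀ z, R ≤ z → h z = z ∧ l z = 0) ∧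
      (∀ z < -R, h z = z ∧ l z = 0) ∧
      ∀ k < N, ∀ z ∈ gridIco R N k,
        Real.exp (-δ) * gaussMass R * (w k * N / (2 * R)) ≤ gauss (h z) * Real.exp (l z) := by
  have hgR := gauss_pos R
  obtain ⟨M, hM⟩ := exists_nat_gt (R / (gauss R * δ))
  have hM' : (0 : ℝ) < M := lt_of_le_of_lt (by positivity) hM
  have hM₀ : 0 < M := Nat.cast_pos.1 hM'
  have hNM : 0 < N * M := Nat.mul_pos hN hM₀
  have hdiv : ∀ i < N * M, i / M < N := fun i hi => Nat.div_lt_of_lt_mul (by rwa [mul_comm])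
  set m := gaussMass R
  have hm : 0 < m := gaussMass_pos hR
  have hw₁ : ∀ k < N, m * w k ≤ 1 := fun k hk =>
    mul_le_one₀ (gaussMass_le_one hR.le) (hw k hk).le <|
      hsum ▸ Finset.single_le_sum (fun i hi => (hw i (Finset.mem_range.1 hi)).le)
        (Finset.mem_range.2 hk)
  have hfine : ∀ j < N * M, R * (m * (w (j / M) / M)) ≤ gauss R * δ := fun j hj =>
    calc R * (m * (w (j / M) / M)) = R / M * (m * w (j / M)) := by ring
      _ ≤ R / M := mul_le_of_le_one_right (by positivity) (hw₁ _ (hdiv j hj))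
      _ ≤ gauss R * δ := by
        rw [div_le_iff₀ hM']; exact ((div_lt_iff₀' (by positivity)).1 hM).le
  obtain ⟨h, l, hr, hright, hleft, hcell⟩ := exists_lineReachable_of_masses hR hNM
    (q := fun j => m * (w (j / M) / M)) (fun j hj => by have := hw _ (hdiv j hj); positivity)
    (by rw [← Finset.mul_sum, ← Finset.sum_div, sum_range_mul_div w, hsum, mul_one,
      div_self hM'.ne', mul_one]) hfine
  refine ⟨h, l, hr, hright, hleft, fun k hk z hz => ?_⟩
  obtain ⟨hzR, hzk⟩ := (mem_gridIco_iff hR hN).1 hz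
  have hj : gridIndex R (N * M) z < N * M :=
    (gridIndex_lt_iff hR hNM hzR).2 ((gridIndex_lt_iff hR hN hzR).1 (hzk.trans_lt hk))
  have hcell_z := hcell _ hj z ((mem_gridIco_iff hR hNM).2 ⟨hzR, rfl⟩)
  rw [gridIndex_mul_div hM₀ R N z, hzk] at hcell_z
  calc Real.exp (-δ) * m * (w k * N / (2 * R))
      = Real.exp (-δ) * (m * (w k / M)) * ((N * M : ℕ) / (2 * R)) := by push_cast; field_simp
    _ ≤ gauss (h z) * Real.exp (l z) := hcell_z

/-! ### Triangular maps -/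

section CellIndex

variable {K X : Type*} {s : K → Set X} {k : K} {x : X}

open Classical in
/-- The index of the member of the family `s` that contains `x`, if there is one; it is meant for
families of pairwise disjoint sets. -/
def cellIndex (s : K → Set X) (x : X) : Option K :=
  if h : ∃ k, x ∈ s k then some h.choose else none

lemma cellIndex_eq_some (hs : Pairwise (Function.onFun Disjoint s)) (hx : x ∈ s k) :
    cellIndex s x = some k := by
  have hex : ∃ k, x ∈ s k := ⟨k, hx⟩
  rw [cellIndex, dif_pos hex, Option.some_inj]
  exact hs.eq (not_disjoint_iff.2 ⟨x, hex.choose_spec, hx⟩)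

lemma cellIndex_eq_none (hx : ∀ k, x ∉ s k) : cellIndex s x = none :=
  dif_neg (not_exists.2 hx)

lemma cellIndex_congr {y : X} (h : ∀ k, x ∈ s k ↔ y ∈ s k) : cellIndex s x = cellIndex s y := by
  have hmem : (fun k => x ∈ s k) = fun k => y ∈ s k := funext fun k => propext (h k)
  unfold cellIndex
  congr!

end CellIndex

/-- Replace the `i`-th coordinate of `x` by `u x`. -/
def updateCoord (i : Fin d) (u : E d → ℝ) (x : E d) : E d := x + (u x - x i) • basisVec i

lemma updateCoord_self (i : Fin d) (u : E d → ℝ) (x : E d) : updateCoord i u x i = u x := by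
  simp [updateCoord, basisVec_self]

lemma updateCoord_of_ne {i j : Fin d} (h : j ≠ i) (u : E d → ℝ) (x : E d) :
    updateCoord i u x j = x j := by
  simp [updateCoord, basisVec_of_ne h]

section Coordinate

variable {K : Type*} {i : Fin d} {J : Finset (Fin d)} {α β : K → J → ℝ} {h l : K → ℝ → ℝ}

lemma exists_limitReachable_eq_on_cylinder (hi : i ∉ J)
    (hdisj : Pairwise (Function.onFun Disjoint fun k => cylinder (α k) (β k)))
    (hl : ∀ k, LineReachable (h k) (l k)) (S : Finset K) :
    ∃ Ψ ℓ, LimitReachable Ψ ℓ ∧ ∀ x,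
      (∀ k ∈ S, x ∈ cylinder (α k) (β k) →
        Ψ x = x + (h k (x i) - x i) • basisVec i ∧ ℓ x = l k (x i)) ∧
      ((∀ k ∈ S, x ∉ cylinder (α k) (β k)) → Ψ x = x ∧ ℓ x = 0) := by
  classical
  induction S using Finset.induction_on with
  | empty => exact ⟨id, 0, .id, by simp⟩
  | insert k₀ S hk₀ ih =>
    obtain ⟨Ψ, ℓ, hr, hΨ⟩ := ih
    refine ⟨_, _, ((hl k₀).limitReachable_localize hi (α k₀) (β k₀)).comp hr,
      fun x => ⟨fun k hk hx => ?_, fun hx => ?_⟩⟩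
    · rcases Finset.mem_insert.1 hk with rfl | hkS
      · have hS := (hΨ x).2 fun k' hk' hx' =>
          hk₀ (hdisj.eq (not_disjoint_iff.2 ⟨x, hx, hx'⟩) ▸ hk')
        simp [hS.1, hS.2, localize, localizeLogJac, hx]
      · have hS := (hΨ x).1 k hkS hx
        have hx₀ : x ∉ cylinder (α k₀) (β k₀) := fun hx' =>
          hk₀ (hdisj.eq (not_disjoint_iff.2 ⟨x, hx, hx'⟩) ▸ hkS)
        simp [hS.1, hS.2, localize, localizeLogJac, add_smul_basisVec_mem_cylinder_iff hi, hx₀]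
    · have hS := (hΨ x).2 fun k hk => hx k (Finset.mem_insert_of_mem hk)
      simp [hS.1, hS.2, localize, localizeLogJac, hx k₀ (Finset.mem_insert_self _ _)]

lemma limitReachable_updateCoord [Finite K] (hi : i ∉ J)
    (hdisj : Pairwise (Function.onFun Disjoint fun k => cylinder (α k) (β k)))
    (hl : ∀ k, LineReachable (h k) (l k)) :
    LimitReachable
      (updateCoord i fun x =>
        (cellIndex (fun k => cylinder (α k) (β k)) x).elim (x i) (h · (x i)))
      (fun x => (cellIndex (fun k => cylinder (α k) (β k)) x).elim 0 (l · (x i))) := by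
  have := Fintype.ofFinite K
  obtain ⟨Ψ, ℓ, hr, hΨ⟩ := exists_limitReachable_eq_on_cylinder hi hdisj hl Finset.univ
  convert hr using 1 <;> ext1 x <;> by_cases hx : ∃ k, x ∈ cylinder (α k) (β k)
  · obtain ⟨k, hk⟩ := hx
    rw [((hΨ x).1 k (Finset.mem_univ k) hk).1, updateCoord, cellIndex_eq_some hdisj hk,
      Option.elim_some]
  · rw [((hΨ x).2 fun k _ => not_exists.1 hx k).1, updateCoord,
      cellIndex_eq_none (not_exists.1 hx), Option.elim_none, sub_self, zero_smul, add_zero]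
  · obtain ⟨k, hk⟩ := hx
    rw [((hΨ x).1 k (Finset.mem_univ k) hk).2, cellIndex_eq_some hdisj hk, Option.elim_some]
  · rw [((hΨ x).2 fun k _ => not_exists.1 hx k).2, cellIndex_eq_none (not_exists.1 hx),
      Option.elim_none]

end Coordinate

/- The coordinates are updated from the last to the first, so that the update of each coordinate
still sees the original values of the coordinates before it. -/
lemma limitReachable_triangular {u v : Fin d → E d → ℝ}
    (hu : ∀ i x y, (∀ j ≤ i, x j = y j) → u i x = u i y)
    (hv : ∀ i x y, (∀ j ≤ i, x j = y j) → v i x = v i y)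
    (hr : ∀ i, LimitReachable (updateCoord i (u i)) (v i)) :
    LimitReachable (fun x => WithLp.toLp 2 fun i => u i x) (fun x => ∑ i, v i x) := by
  suffices H : ∀ n ≤ d, LimitReachable
      (fun x => WithLp.toLp 2 fun j : Fin d => if d ≤ j + n then u j x else x j)
      (fun x => ∑ j : Fin d, if d ≤ j + n then v j x else 0) by
    simpa using H d le_rfl
  intro n
  induction n with
  | zero =>
    intro _
    convert LimitReachable.id (d := d) using 1
    · ext x j; simp [j.2.not_ge]
    · ext x; simp [fun j : Fin d => j.2.not_ge]
  | succ n ih =>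
    intro hn
    set i : Fin d := ⟨d - (n + 1), by omega⟩ with hi
    have hval : i.val + (n + 1) = d := by simp [hi]; omega
    have hsame (x : E d) : ∀ j ≤ i,
        WithLp.toLp 2 (fun j : Fin d => if d ≤ j + n then u j x else x j) j = x j :=
      fun j (hj : j.val ≤ i.val) => if_neg (by omega)
    have hstep : ∀ j : Fin d, d ≤ j + (n + 1) ↔ j = i ∨ d ≤ j + n := fun j => by
      rw [Fin.ext_iff]; omega
    have hnot : ¬ d ≤ i + n := by omega
    convert (hr i).comp (ih (by omega)) using 1
    · ext x j
      rcases eq_or_ne j i with rfl | hji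
      · simp only [Function.comp, updateCoord_self, hu _ _ _ (hsame x), hstep, true_or, if_true]
      · simp only [Function.comp, updateCoord_of_ne hji, hstep, hji, false_or]
    · ext x
      rw [hv _ _ _ (hsame x), ← Finset.sum_erase_add _ _ (Finset.mem_univ i),
        ← Finset.sum_erase_add _ _ (Finset.mem_univ i)]
      simp only [hstep, true_or, if_true, hnot, if_false, add_zero]
      congr 1
      exact Finset.sum_congr rfl fun j hj => by simp [Finset.ne_of_mem_erase hj]

/-! ### Grids in `ℝ^d` -/

/-- The box of the points whose `j`-th coordinate lies in `[α j, β j)` for all `j`. -/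
def cuboid (α β : Fin d → ℝ) : Set (E d) := {x | ∀ j, x j ∈ Ico (α j) (β j)}

lemma cuboid_eq_preimage (α β : Fin d → ℝ) :
    cuboid α β =
      (MeasurableEquiv.toLp 2 (Fin d → ℝ)).symm ⁻¹' univ.pi fun j => Ico (α j) (β j) := by
  ext; simp [cuboid]

lemma measurableSet_cuboid (α β : Fin d → ℝ) : MeasurableSet (cuboid α β) := by
  rw [cuboid_eq_preimage]
  exact (MeasurableSet.univ_pi fun _ => measurableSet_Ico).preimage (MeasurableEquiv.measurable _)

lemma volume_cuboid (α β : Fin d → ℝ) :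
    volume (cuboid α β) = ∏ j, ENNReal.ofReal (β j - α j) := by
  rw [cuboid_eq_preimage, ← Real.volume_pi_Ico]
  exact (PiLp.volume_preserving_ofLp (Fin d)).measure_preimage
    (MeasurableSet.univ_pi fun _ => measurableSet_Ico).nullMeasurableSet

lemma volume_cuboid_ne_top (α β : Fin d → ℝ) : volume (cuboid α β) ≠ ∞ := by
  rw [volume_cuboid]
  exact ENNReal.prod_ne_top fun _ _ => ENNReal.ofReal_ne_top

/-- The half-open box `[-R, R)^d`. -/
def box (d : ℕ) (R : ℝ) : Set (E d) := cuboid (fun _ => -R) (fun _ => R)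

lemma measurableSet_box (R : ℝ) : MeasurableSet (box d R) := measurableSet_cuboid _ _

lemma volume_box_ne_top (R : ℝ) : volume (box d R) ≠ ∞ := volume_cuboid_ne_top _ _

/-- The cell with multi-index `k` of the grid of `N ^ d` equal cells of `[-R, R)^d`. -/
def gridCell (R : ℝ) (N : ℕ) (k : Fin d → Fin N) : Set (E d) :=
  cuboid (fun j => gridPoint R N (k j)) (fun j => gridPoint R N (k j + 1))

/-- The cylinder over a cell of the grid in the coordinates in `J`. -/
def gridCylinder (R : ℝ) (N : ℕ) {J : Finset (Fin d)} (k : J → Fin N) : Set (E d) :=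
  cylinder (fun j => gridPoint R N (k j)) (fun j => gridPoint R N (k j + 1))

section Grid

variable {R : ℝ} {N : ℕ}

lemma mem_gridCell {k : Fin d → Fin N} {x : E d} :
    x ∈ gridCell R N k ↔ ∀ j, x j ∈ gridIco R N (k j) := Iff.rfl

lemma mem_gridCylinder {J : Finset (Fin d)} {k : J → Fin N} {x : E d} :
    x ∈ gridCylinder R N k ↔ ∀ j : J, x j ∈ gridIco R N (k j) := Iff.rfl

lemma measurableSet_gridCell (k : Fin d → Fin N) : MeasurableSet (gridCell R N k) :=
  measurableSet_cuboid _ _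

lemma exists_mem_gridIco (hR : 0 < R) (hN : 0 < N) {z : ℝ} (hz : z ∈ Ico (-R) R) :
    ∃ c : Fin N, z ∈ gridIco R N c :=
  ⟨⟨gridIndex R N z, (gridIndex_lt_iff hR hN hz.1).2 hz.2⟩, (mem_gridIco_iff hR hN).2 ⟨hz.1, rfl⟩⟩

lemma iUnion_gridCell (hR : 0 < R) (hN : 0 < N) :
    ⋃ k : Fin d → Fin N, gridCell R N k = box d R := by
  refine Subset.antisymm (iUnion_subset fun k x hx j => gridIco_subset hR (k j).2 (hx j)) ?_
  intro x hx
  choose k hk using fun j => exists_mem_gridIco hR hN (hx j)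
  exact mem_iUnion.2 ⟨k, hk⟩

lemma index_eq_of_mem_gridIco (hR : 0 < R) (hN : 0 < N) {c c' : Fin N} {z : ℝ}
    (hz : z ∈ gridIco R N c) (hz' : z ∈ gridIco R N c') : c = c' :=
  Fin.ext ((pairwise_disjoint_gridIco hR hN).eq (not_disjoint_iff.2 ⟨z, hz, hz'⟩))

lemma pairwise_disjoint_gridCell (hR : 0 < R) (hN : 0 < N) :
    Pairwise (Function.onFun Disjoint (gridCell (d := d) R N)) := fun _ _ hkk' =>
  disjoint_left.2 fun _ hx hx' =>
    hkk' (funext fun j => index_eq_of_mem_gridIco hR hN (hx j) (hx' j))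

lemma pairwise_disjoint_gridCylinder (hR : 0 < R) (hN : 0 < N) {J : Finset (Fin d)} :
    Pairwise (Function.onFun Disjoint (gridCylinder R N (J := J))) := fun _ _ hkk' =>
  disjoint_left.2 fun _ hx hx' =>
    hkk' (funext fun j => index_eq_of_mem_gridIco hR hN (hx j) (hx' j))

/-- The indices of the first `n` coordinates. -/
def firstCoords (d n : ℕ) : Finset (Fin d) := {j | j.val < n}

/-- The cylinder over the first `n` coordinates of the cell with multi-index `k`. -/
def prefixCell (R : ℝ) (N : ℕ) (k : Fin d → Fin N) (n : ℕ) : Set (E d) :=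
  gridCylinder R N fun j : firstCoords d n => k j

lemma mem_prefixCell {k : Fin d → Fin N} {n : ℕ} {x : E d} :
    x ∈ prefixCell R N k n ↔ ∀ j : Fin d, j.val < n → x j ∈ gridIco R N (k j) := by
  simp [prefixCell, mem_gridCylinder, firstCoords]

lemma prefixCell_zero (k : Fin d → Fin N) : prefixCell R N k 0 = univ := by
  ext; simp [mem_prefixCell]

lemma prefixCell_dim (k : Fin d → Fin N) : prefixCell R N k d = gridCell R N k := by
  ext; simp [mem_prefixCell, mem_gridCell]

lemma prefixCell_succ (k : Fin d → Fin N) (i : Fin d) :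
    prefixCell R N k (i + 1) = prefixCell R N k i ∩ {x | x i ∈ gridIco R N (k i)} := by
  ext x
  simp only [mem_prefixCell, mem_inter_iff, mem_ofPred_eq, Nat.lt_succ_iff_lt_or_eq,
    or_imp, forall_and, ← Fin.ext_iff, forall_eq]

lemma prefixCell_antitone (k : Fin d → Fin N) : Antitone (prefixCell R N k) := fun _ _ hmn _ hx =>
  mem_prefixCell.2 fun j hj => mem_prefixCell.1 hx j (hj.trans_le hmn)

end Grid

/-! ### Realizing the cell masses of a measure on a grid -/

lemma mul_prod_range_div_of_eq_zero {M : Type*} [CommGroupWithZero M] {f : ℕ → M}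
    (hf : ∀ n, f n = 0 → f (n + 1) = 0) (n : ℕ) :
    f 0 * ∏ i ∈ Finset.range n, f (i + 1) / f i = f n := by
  induction n with
  | zero => simp
  | succ n ih =>
    rw [Finset.prod_range_succ, ← mul_assoc, ih]
    exact mul_div_cancel_of_imp' (hf n)

lemma measureReal_gridCell_eq_prod (μ : Measure (E d)) [IsFiniteMeasure μ] {R : ℝ} {N : ℕ}
    (k : Fin d → Fin N) :
    μ.real (gridCell R N k) = μ.real univ *
      ∏ i : Fin d, μ.real (prefixCell R N k (i + 1)) / μ.real (prefixCell R N k i) := by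
  rw [← Finset.prod_range fun i =>
    μ.real (prefixCell R N k (i + 1)) / μ.real (prefixCell R N k i),
    ← prefixCell_dim, ← prefixCell_zero (R := R) k]
  refine (mul_prod_range_div_of_eq_zero (f := fun n => μ.real (prefixCell R N k n))
    (fun n hn => ?_) d).symm
  exact le_antisymm (hn ▸ measureReal_mono (prefixCell_antitone k n.le_succ)) measureReal_nonneg

lemma sum_measureReal_inter_div_le_one {X ι : Type*} [MeasurableSpace X] (μ : Measure X)
    [IsFiniteMeasure μ] (S : Set X) {t : ι → Set X} (ht : ∀ c, MeasurableSet (t c))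
    (hdisj : Pairwise (Function.onFun Disjoint t)) (I : Finset ι) :
    ∑ c ∈ I, μ.real (S ∩ t c) / μ.real S ≤ 1 := by
  rw [← Finset.sum_div]
  refine div_le_one_of_le₀ ?_ measureReal_nonneg
  simp_rw [inter_comm S, ← measureReal_restrict_apply (ht _)]
  rw [← measureReal_biUnion_finset (fun c _ c' _ hcc' => hdisj hcc') fun c _ => ht c]
  exact (measureReal_mono (subset_univ _)).trans_eq (by simp)

/- Mix `q` with the uniform weights, in the proportions `1 - η` and `η`. -/
lemma exists_weights {N : ℕ} (hN : 0 < N) {q : ℕ → ℝ} (hq : ∀ c, 0 ≤ q c)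
    (hq_sum : ∑ c ∈ Finset.range N, q c ≤ 1) {η : ℝ} (hη₀ : 0 < η) (hη₁ : η < 1) :
    ∃ w : ℕ → ℝ, (∀ c < N, 0 < w c) ∧ ∑ c ∈ Finset.range N, w c = 1 ∧
      (∀ c, (1 - η) * q c ≤ w c) ∧ ∀ c, η ≤ w c * N := by
  have hN' : (0 : ℝ) < N := Nat.cast_pos.2 hN
  set s := ∑ c ∈ Finset.range N, q c with hs
  have hη : η ≤ 1 - (1 - η) * s := by nlinarith
  have hpos : 0 < (1 - (1 - η) * s) / N := div_pos (hη₀.trans_le hη) hN'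
  have hq_mul : ∀ c, 0 ≤ (1 - η) * q c := fun c => mul_nonneg (sub_nonneg.2 hη₁.le) (hq c)
  refine ⟨fun c => (1 - η) * q c + (1 - (1 - η) * s) / N,
    fun c _ => add_pos_of_nonneg_of_pos (hq_mul c) hpos, ?_,
    fun c => le_add_of_nonneg_right hpos.le, fun c => ?_⟩
  · rw [Finset.sum_add_distrib, ← Finset.mul_sum, ← hs, Finset.sum_const, Finset.card_range,
      nsmul_eq_mul, mul_div_cancel₀ _ hN'.ne', add_sub_cancel]
  · rw [add_mul, div_mul_cancel₀ _ hN'.ne']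
    exact hη.trans (le_add_of_nonneg_left (mul_nonneg (hq_mul c) hN'.le))

lemma exists_lineReachable_of_subweights {R : ℝ} (hR : 0 < R) {N : ℕ} (hN : 0 < N) {q : ℕ → ℝ}
    (hq : ∀ c, 0 ≤ q c) (hq_sum : ∑ c ∈ Finset.range N, q c ≤ 1) {δ η : ℝ} (hδ : 0 < δ)
    (hη₀ : 0 < η) (hη₁ : η < 1) :
    ∃ h l, LineReachable h l ∧
      (∀ c < N, ∀ z ∈ gridIco R N c,
        Real.exp (-δ) * gaussMass R * (1 - η) * (N / (2 * R)) * q c ≤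
          gauss (h z) * Real.exp (l z)) ∧
      ∀ z, min 1 (Real.exp (-δ) * gaussMass R * η / (2 * R)) * gauss z ≤
        gauss (h z) * Real.exp (l z) := by
  obtain ⟨w, hw_pos, hw_sum, hqw, hηw⟩ := exists_weights hN hq hq_sum hη₀ hη₁
  obtain ⟨h, l, hr, hright, hleft, hcell⟩ :=
    exists_lineReachable_of_weights hR hN hw_pos hw_sum hδ
  have hm : 0 ≤ gaussMass R := (gaussMass_pos hR).le
  set κ := min 1 (Real.exp (-δ) * gaussMass R * η / (2 * R))
  have hfix : ∀ z, h z = z ∧ l z = 0 → κ * gauss z ≤ gauss (h z) * Real.exp (l z) := by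
    rintro z ⟨hz, hlz⟩
    rw [hz, hlz, Real.exp_zero, mul_one]
    exact mul_le_of_le_one_left (gauss_pos z).le (min_le_left _ _)
  refine ⟨h, l, hr, fun c hc z hz => ?_, fun z => ?_⟩
  · calc Real.exp (-δ) * gaussMass R * (1 - η) * (N / (2 * R)) * q c
        = Real.exp (-δ) * gaussMass R * ((1 - η) * q c * N / (2 * R)) := by ring
      _ ≤ Real.exp (-δ) * gaussMass R * (w c * N / (2 * R)) := by gcongr; exact hqw c
      _ ≤ gauss (h z) * Real.exp (l z) := hcell c hc z hz
  · rcases le_or_gt R z with hz_ge | hz_lt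
    · exact hfix z (hright z hz_ge)
    rcases lt_or_ge z (-R) with hz_lt' | hz_ge
    · exact hfix z (hleft z hz_lt')
    obtain ⟨c, hc⟩ := exists_mem_gridIco hR hN ⟨hz_ge, hz_lt⟩
    calc κ * gauss z ≤ κ * 1 := by gcongr; exact gauss_le_one z
      _ ≤ Real.exp (-δ) * gaussMass R * η / (2 * R) := (mul_one κ).trans_le (min_le_right _ _)
      _ = Real.exp (-δ) * gaussMass R * (η / (2 * R)) := by ring
      _ ≤ Real.exp (-δ) * gaussMass R * (w c * N / (2 * R)) := by gcongr; exact hηw c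
      _ ≤ gauss (h z) * Real.exp (l z) := hcell c c.2 z hc

lemma exists_limitReachable_of_lines {R : ℝ} (hR : 0 < R) {N : ℕ} (hN : 0 < N)
    {h l : ∀ i : Fin d, (firstCoords d i → Fin N) → ℝ → ℝ}
    (hl : ∀ i k, LineReachable (h i k) (l i k)) :
    ∃ u v : Fin d → E d → ℝ,
      LimitReachable (fun x => WithLp.toLp 2 fun i => u i x) (fun x => ∑ i, v i x) ∧
      ∀ i x, (∀ k, x ∈ gridCylinder R N k → u i x = h i k (x i) ∧ v i x = l i k (x i)) ∧
        ((∀ k : firstCoords d i → Fin N, x ∉ gridCylinder R N k) → u i x = x i ∧ v i x = 0) := by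
  set cell : ∀ i : Fin d, E d → Option (firstCoords d i → Fin N) := fun i =>
    cellIndex (gridCylinder R N)
  have hdisj := fun i : Fin d => pairwise_disjoint_gridCylinder hR hN (J := firstCoords d i)
  have hcell : ∀ i (x y : E d), (∀ j ≤ i, x j = y j) → cell i x = cell i y := fun i x y hxy =>
    cellIndex_congr fun k => forall_congr' fun j => by
      have hj : j.1 < i := by simpa [firstCoords] using j.2
      rw [hxy j hj.le]
  refine ⟨fun i x => (cell i x).elim (x i) (h i · (x i)),
    fun i x => (cell i x).elim 0 (l i · (x i)), limitReachable_triangular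
      (fun i x y hxy => by simp only [hcell i x y hxy, hxy i le_rfl])
      (fun i x y hxy => by simp only [hcell i x y hxy, hxy i le_rfl])
      fun i => limitReachable_updateCoord (by simp [firstCoords]) (hdisj i) (hl i),
    fun i x => ⟨fun k hk => ?_, fun hx => ?_⟩⟩
  · simp [cell, cellIndex_eq_some (hdisj i) hk]
  · simp [cell, cellIndex_eq_none hx]

/- The `i`-th coordinate is moved according to the conditional masses of `μ` given the cells of the
preceding coordinates; their product telescopes to the mass of the cell. -/
lemma exists_limitReachable_grid (μ : Measure (E d)) [IsFiniteMeasure μ] {R : ℝ} (hR : 0 < R)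
    {N : ℕ} (hN : 0 < N) {δ η : ℝ} (hδ : 0 < δ) (hη₀ : 0 < η) (hη₁ : η < 1) :
    ∃ Ψ ℓ, LimitReachable Ψ ℓ ∧
      (∀ k : Fin d → Fin N, ∀ x ∈ gridCell R N k,
        (Real.exp (-δ) * gaussMass R * (1 - η) * (N / (2 * R))) ^ d * μ.real (gridCell R N k) ≤
          μ.real univ * ((∏ i, gauss (Ψ x i)) * Real.exp (ℓ x))) ∧
      ∀ x, min 1 (Real.exp (-δ) * gaussMass R * η / (2 * R)) ^ d * ∏ i, gauss (x i) ≤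
        (∏ i, gauss (Ψ x i)) * Real.exp (ℓ x) := by
  have hm : 0 ≤ gaussMass R := (gaussMass_pos hR).le
  choose h l hr hmass hbelow using fun (i : Fin d) (k : firstCoords d i → Fin N) =>
    exists_lineReachable_of_subweights hR hN
      (q := fun c => μ.real (gridCylinder R N k ∩ {x | x i ∈ gridIco R N c}) /
        μ.real (gridCylinder R N k))
      (fun c => by positivity)
      (sum_measureReal_inter_div_le_one μ _
        (fun c => measurableSet_Ico.preimage (f := fun x : E d => x i) (by fun_prop))
        (fun c c' hcc' => (pairwise_disjoint_gridIco hR hN hcc').preimage fun x : E d => x i) _)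
      hδ hη₀ hη₁
  obtain ⟨u, v, hΨ, huv⟩ := exists_limitReachable_of_lines hR hN hr
  refine ⟨_, _, hΨ, fun k x hx => ?_, fun x => ?_⟩
  · rw [measureReal_gridCell_eq_prod, mul_left_comm, Real.exp_sum, ← Finset.prod_mul_distrib,
      ← Fin.prod_const, ← Finset.prod_mul_distrib]
    refine mul_le_mul_of_nonneg_left (Finset.prod_le_prod
      (fun i _ => by have := sub_nonneg.2 hη₁.le; positivity) fun i _ => ?_) measureReal_nonneg
    obtain ⟨hu, hv⟩ := (huv i x).1 (fun j => k j) fun j => hx j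
    simp only [hu, hv, prefixCell_succ]
    exact hmass i (fun j => k j) (k i) (k i).2 (x i) (hx i)
  · rw [Real.exp_sum, ← Finset.prod_mul_distrib, ← Fin.prod_const, ← Finset.prod_mul_distrib]
    set κ := min 1 (Real.exp (-δ) * gaussMass R * η / (2 * R))
    have hκ : 0 ≤ κ := le_min zero_le_one (by positivity)
    refine Finset.prod_le_prod (fun i _ => mul_nonneg hκ (gauss_pos _).le) fun i _ => ?_
    by_cases hex : ∃ k : firstCoords d i → Fin N, x ∈ gridCylinder R N k
    · obtain ⟨k, hk⟩ := hex
      simpa only [(huv i x).1 k hk] using hbelow i k (x i)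
    · simpa only [(huv i x).2 (not_exists.1 hex), Real.exp_zero, mul_one] using
        mul_le_of_le_one_left (gauss_pos (x i)).le (min_le_left 1 _)

/-! ### Averages over the members of a finite partition -/

section PartitionAvg

open InformationTheory

variable {X K : Type*} [MeasurableSpace X] [Fintype K] {μ : Measure X} {s : K → Set X} {f : X → ℝ}

/-- The step function equal on each `s k` to the average of `f` over `s k`, when the sets `s k` are
pairwise disjoint. -/
def partitionAvg (μ : Measure X) (s : K → Set X) (f : X → ℝ) (x : X) : ℝ :=
  ∑ k, (s k).indicator (fun _ => ⨍ y in s k, f y ∂μ) x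

lemma partitionAvg_of_mem (hdisj : Pairwise (Function.onFun Disjoint s)) {k : K} {x : X}
    (hx : x ∈ s k) : partitionAvg μ s f x = ⨍ y in s k, f y ∂μ := by
  rw [partitionAvg, Finset.sum_eq_single k
    (fun k' _ hk' => indicator_of_notMem (disjoint_right.1 (hdisj hk') hx) _) (by simp),
    indicator_of_mem hx]

lemma partitionAvg_nonneg (hf : ∀ x, 0 ≤ f x) (x : X) : 0 ≤ partitionAvg μ s f x :=
  Finset.sum_nonneg fun _ _ => indicator_nonneg
    (fun _ _ => by rw [setAverage_eq]; exact mul_nonneg (by positivity) (integral_nonneg hf)) _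

lemma integrableOn_mul_comp_partitionAvg (hs : ∀ k, MeasurableSet (s k))
    (hdisj : Pairwise (Function.onFun Disjoint s)) {F : X → ℝ} (hF : IntegrableOn F (⋃ k, s k) μ)
    (g : ℝ → ℝ) : IntegrableOn (fun x => F x * g (partitionAvg μ s f x)) (⋃ k, s k) μ := by
  refine integrableOn_finite_iUnion.2 fun k => IntegrableOn.congr_fun
    ((hF.mono_set (subset_iUnion s k)).mul_const (g (⨍ y in s k, f y ∂μ))) (fun x hx => ?_) (hs k)
  rw [partitionAvg_of_mem hdisj hx]

lemma integrableOn_comp_partitionAvg (hs : ∀ k, MeasurableSet (s k))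
    (hdisj : Pairwise (Function.onFun Disjoint s)) (hμ : μ (⋃ k, s k) ≠ ∞) (g : ℝ → ℝ) :
    IntegrableOn (fun x => g (partitionAvg μ s f x)) (⋃ k, s k) μ := by
  simpa using integrableOn_mul_comp_partitionAvg (f := f) hs hdisj
    (integrableOn_const (C := (1 : ℝ)) hμ) g

lemma setIntegral_partitionAvg_mul (hs : ∀ k, MeasurableSet (s k))
    (hdisj : Pairwise (Function.onFun Disjoint s)) (hμ : μ (⋃ k, s k) ≠ ∞)
    (hf : IntegrableOn f (⋃ k, s k) μ) (g : ℝ → ℝ) :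
    ∫ x in ⋃ k, s k, partitionAvg μ s f x * g (partitionAvg μ s f x) ∂μ =
      ∫ x in ⋃ k, s k, f x * g (partitionAvg μ s f x) ∂μ := by
  rw [integral_iUnion_fintype hs hdisj fun k => (integrableOn_comp_partitionAvg hs hdisj hμ
      fun t => t * g t).mono_set (subset_iUnion s k),
    integral_iUnion_fintype hs hdisj fun k =>
      (integrableOn_mul_comp_partitionAvg hs hdisj hf g).mono_set (subset_iUnion s k)]
  refine Finset.sum_congr rfl fun k _ => ?_
  have hμk : μ (s k) ≠ ∞ := measure_ne_top_of_subset (subset_iUnion s k) hμ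
  calc ∫ x in s k, partitionAvg μ s f x * g (partitionAvg μ s f x) ∂μ
      = ∫ _ in s k, (⨍ y in s k, f y ∂μ) * g (⨍ y in s k, f y ∂μ) ∂μ :=
        setIntegral_congr_fun (hs k) fun x hx => by simp only [partitionAvg_of_mem hdisj hx]
    _ = (∫ x in s k, f x ∂μ) * g (⨍ y in s k, f y ∂μ) := by
        rw [setIntegral_const, ← smul_mul_assoc, measure_smul_setAverage f hμk]
    _ = ∫ x in s k, f x * g (partitionAvg μ s f x) ∂μ := by
        rw [← integral_mul_const]
        exact setIntegral_congr_fun (hs k) fun x hx => by simp only [partitionAvg_of_mem hdisj hx]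

lemma ae_eq_zero_of_partitionAvg_eq_zero (hs : ∀ k, MeasurableSet (s k))
    (hdisj : Pairwise (Function.onFun Disjoint s)) (hμ : μ (⋃ k, s k) ≠ ∞) (hf₀ : ∀ x, 0 ≤ f x)
    (hf : IntegrableOn f (⋃ k, s k) μ) :
    ∀ᵐ x ∂μ, x ∈ ⋃ k, s k → partitionAvg μ s f x = 0 → f x = 0 := by
  have hcell : ∀ k, ∀ᵐ x ∂μ, x ∈ s k → (⨍ y in s k, f y ∂μ) = 0 → f x = 0 := fun k => by
    by_cases hk : (⨍ y in s k, f y ∂μ) = 0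
    · have hint : ∫ x in s k, f x ∂μ = 0 := by
        rw [← measure_smul_setAverage f (measure_ne_top_of_subset (subset_iUnion s k) hμ), hk,
          smul_zero]
      rw [setIntegral_eq_zero_iff_of_nonneg_ae (ae_of_all _ hf₀)
        (hf.mono_set (subset_iUnion s k))] at hint
      filter_upwards [(ae_restrict_iff' (hs k)).1 hint] with x hx hxk _ using hx hxk
    · exact ae_of_all _ fun x _ h => absurd h hk
  filter_upwards [ae_all_iff.2 hcell] with x hx hxs hx₀
  obtain ⟨k, hk⟩ := mem_iUnion.1 hxs
  exact hx k hk (partitionAvg_of_mem hdisj hk ▸ hx₀)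

lemma setIntegral_klFun {B : Set X} (hB : μ B ≠ ∞) (hf : IntegrableOn f B μ)
    (hlog : IntegrableOn (fun x => f x * Real.log (f x)) B μ) :
    ∫ x in B, klFun (f x) ∂μ =
      (∫ x in B, f x * Real.log (f x) ∂μ) + μ.real B - ∫ x in B, f x ∂μ := by
  have hone : IntegrableOn (fun _ : X => (1 : ℝ)) B μ := integrableOn_const hB
  have hB' : μ.real B = ∫ _ in B, (1 : ℝ) ∂μ := by simp
  rw [hB', ← integral_add hlog hone]
  exact integral_sub (hlog.add hone) hf

lemma exists_integral_le_add_of_ae_tendsto {F : ℕ → X → ℝ} (hF : ∀ n, Integrable (F n) μ)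
    (hF₀ : ∀ n x, 0 ≤ F n x) (hf : Integrable f μ)
    (hlim : ∀ᵐ x ∂μ, Tendsto (F · x) atTop (𝓝 (f x))) {ε : ℝ} (hε : 0 < ε) :
    ∃ n, ∫ x, f x ∂μ ≤ (∫ x, F n x ∂μ) + ε := by
  by_contra! hlt
  have hf₀ : 0 ≤ᵐ[μ] f := by
    filter_upwards [hlim] with x hx using ge_of_tendsto' hx fun n => hF₀ n x
  have hfatou : ∫⁻ x, ENNReal.ofReal (f x) ∂μ ≤
      liminf (fun n => ∫⁻ x, ENNReal.ofReal (F n x) ∂μ) atTop := by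
    refine (lintegral_mono_ae ?_).trans
      (lintegral_liminf_le' fun n => (hF n).1.aemeasurable.ennreal_ofReal)
    filter_upwards [hlim] with x hx
    exact ((ENNReal.continuous_ofReal.tendsto _).comp hx).liminf_eq.ge
  have hle : ENNReal.ofReal (∫ x, f x ∂μ) ≤ ENNReal.ofReal ((∫ x, f x ∂μ) - ε) := by
    rw [ofReal_integral_eq_lintegral_ofReal hf hf₀]
    refine hfatou.trans (liminf_le_of_le (by isBoundedDefault) fun b hb => ?_)
    obtain ⟨n, hn⟩ := hb.exists
    refine hn.trans ?_
    rw [← ofReal_integral_eq_lintegral_ofReal (hF n) (ae_of_all _ (hF₀ n))]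
    exact ENNReal.ofReal_le_ofReal (lt_sub_iff_add_lt.2 (hlt n)).le
  have hpos : 0 ≤ (∫ x, f x ∂μ) - ε :=
    (integral_nonneg (hF₀ 0)).trans (lt_sub_iff_add_lt.2 (hlt 0)).le
  linarith [(ENNReal.ofReal_le_ofReal_iff hpos).1 hle]

/- Fatou's lemma for `klFun ≥ 0`, together with the fact that averaging is self-adjoint and
preserves integrals. -/
lemma exists_setIntegral_mul_log_le {K : ℕ → Type*} [∀ n, Fintype (K n)] {s : ∀ n, K n → Set X}
    (hs : ∀ n k, MeasurableSet (s n k)) (hdisj : ∀ n, Pairwise (Function.onFun Disjoint (s n)))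
    {B : Set X} (hB : ∀ n, ⋃ k, s n k = B) (hμ : μ B ≠ ∞) (hf₀ : ∀ x, 0 ≤ f x)
    (hf : IntegrableOn f B μ) (hlog : IntegrableOn (fun x => f x * Real.log (f x)) B μ)
    (hlim : ∀ᵐ x ∂μ.restrict B, Tendsto (fun n => partitionAvg μ (s n) f x) atTop (𝓝 (f x)))
    {ε : ℝ} (hε : 0 < ε) :
    ∃ n, ∫ x in B, f x * Real.log (f x) ∂μ ≤
      (∫ x in B, f x * Real.log (partitionAvg μ (s n) f x) ∂μ) + ε := by
  have hcomp : ∀ n (g : ℝ → ℝ), IntegrableOn (fun x => g (partitionAvg μ (s n) f x)) B μ :=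
    fun n g => hB n ▸ integrableOn_comp_partitionAvg (hs n) (hdisj n) ((hB n).symm ▸ hμ) g
  have hself : ∀ n (g : ℝ → ℝ),
      ∫ x in B, partitionAvg μ (s n) f x * g (partitionAvg μ (s n) f x) ∂μ =
        ∫ x in B, f x * g (partitionAvg μ (s n) f x) ∂μ := fun n g => by
    have := setIntegral_partitionAvg_mul (hs n) (hdisj n) ((hB n).symm ▸ hμ) ((hB n).symm ▸ hf) g
    rwa [hB n] at this
  have hmean : ∀ n, ∫ x in B, partitionAvg μ (s n) f x ∂μ = ∫ x in B, f x ∂μ := fun n => by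
    simpa using hself n fun _ => 1
  obtain ⟨n, hn⟩ := exists_integral_le_add_of_ae_tendsto
    (fun n => hcomp n klFun) (fun n x => klFun_nonneg (partitionAvg_nonneg hf₀ x))
    ((hlog.add (integrableOn_const hμ)).sub hf)
    (hlim.mono fun x hx => (continuous_klFun.tendsto _).comp hx) hε
  refine ⟨n, ?_⟩
  have hn' : ∫ x in B, klFun (f x) ∂μ ≤
    (∫ x in B, klFun (partitionAvg μ (s n) f x) ∂μ) + ε := hn
  rw [setIntegral_klFun hμ hf hlog, setIntegral_klFun hμ (hcomp n fun t => t)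
    (hcomp n fun t => t * Real.log t), hself n, hmean n] at hn'
  linarith

end PartitionAvg

/-! ### Averages over the cells of a grid -/

lemma setAverage_cuboid (f : E d → ℝ) (α β : Fin d → ℝ) :
    ⨍ x in cuboid α β, f x = ⨍ y in Icc α β, f (WithLp.toLp 2 y) := by
  have hae : (univ.pi fun j => Ico (α j) (β j)) =ᵐ[volume] Icc α β := by
    rw [volume_pi]; exact Measure.univ_pi_Ico_ae_eq_Icc
  have hmp := PiLp.volume_preserving_ofLp (Fin d)
  rw [← setAverage_congr hae, setAverage_eq, setAverage_eq, measureReal_def, measureReal_def,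
    cuboid_eq_preimage]
  congr 1
  · congr 2
    exact hmp.measure_preimage
      (MeasurableSet.univ_pi fun _ => measurableSet_Ico).nullMeasurableSet
  · exact hmp.setIntegral_preimage_emb (MeasurableEquiv.toLp 2 (Fin d → ℝ)).symm.measurableEmbedding
      (fun y => f (WithLp.toLp 2 y)) _

lemma closedBall_eq_Icc_of_forall {ι : Type*} [Fintype ι] {a b c : ι → ℝ} {r : ℝ} (hr : 0 ≤ r)
    (ha : ∀ i, c i - r = a i) (hb : ∀ i, c i + r = b i) : Metric.closedBall c r = Icc a b := by
  simp only [closedBall_pi _ hr, Real.closedBall_eq_Icc, ha, hb, pi_univ_Icc]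

/-- The sup-norm center of a grid cell. -/
def gridCenter (R : ℝ) (N : ℕ) (k : Fin d → Fin N) (j : Fin d) : ℝ :=
  gridPoint R N (k j) + R / N

lemma closedBall_gridCenter {R : ℝ} (hR : 0 ≤ R) (N : ℕ) (k : Fin d → Fin N) :
    Metric.closedBall (gridCenter R N k) (R / N) =
      Icc (fun j => gridPoint R N (k j)) (fun j => gridPoint R N (k j + 1)) := by
  refine closedBall_eq_Icc_of_forall (by positivity) (fun j => ?_) fun j => ?_
  · rw [gridCenter, add_sub_cancel_right]
  · have := gridPoint_succ_sub R N (k j)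
    rw [gridCenter]
    linear_combination -this

lemma ae_tendsto_partitionAvg_gridCell {f : E d → ℝ} (hf : Integrable f) {R : ℝ} (hR : 0 < R) :
    ∀ᵐ x, x ∈ box d R →
      Tendsto (fun n => partitionAvg volume (gridCell R (n + 1)) f x) atTop (𝓝 (f x)) := by
  have hf' : Integrable fun y : Fin d → ℝ => f (WithLp.toLp 2 y) :=
    (PiLp.volume_preserving_toLp (Fin d)).integrable_comp_of_integrable hf
  have hlebesgue := (PiLp.volume_preserving_ofLp (Fin d)).quasiMeasurePreserving.ae <|
    IsUnifLocDoublingMeasure.ae_tendsto_average (μ := (volume : Measure (Fin d → ℝ)))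
      hf'.locallyIntegrable 1
  filter_upwards [hlebesgue] with x hx hxB
  have hmem : ∀ n, ∃ k : Fin d → Fin (n + 1), x ∈ gridCell R (n + 1) k := fun n =>
    mem_iUnion.1 ((iUnion_gridCell hR n.succ_pos).symm ▸ hxB)
  choose k hk using hmem
  have hradius : Tendsto (fun n : ℕ => R / ((n + 1 : ℕ) : ℝ)) atTop (𝓝[>] 0) :=
    tendsto_nhdsWithin_iff.2
      ⟨(tendsto_const_nhds.div_atTop tendsto_natCast_atTop_atTop).comp (tendsto_add_atTop_nat 1),
        Eventually.of_forall fun n => by rw [mem_Ioi]; positivity⟩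
  refine (hx (fun n => gridCenter R (n + 1) (k n)) _ hradius
    (Eventually.of_forall fun n => ?_)).congr fun n => ?_
  · rw [one_mul, closedBall_gridCenter hR.le]
    exact ⟨fun j => (hk n j).1, fun j => (hk n j).2.le⟩
  · rw [partitionAvg_of_mem (pairwise_disjoint_gridCell hR n.succ_pos) (hk n),
      closedBall_gridCenter hR.le]
    exact (setAverage_cuboid f _ _).symm

lemma exists_setIntegral_box_mul_log_le {f : E d → ℝ} (hf : Integrable f) (hf₀ : ∀ x, 0 ≤ f x)
    (hlog : Integrable fun x => f x * Real.log (f x)) {R : ℝ} (hR : 0 < R) {ε : ℝ} (hε : 0 < ε) :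
    ∃ N, 0 < N ∧ ∫ x in box d R, f x * Real.log (f x) ≤
      (∫ x in box d R, f x * Real.log (partitionAvg volume (gridCell R N) f x)) + ε := by
  obtain ⟨n, hn⟩ := exists_setIntegral_mul_log_le
    (fun n => measurableSet_gridCell (R := R) (N := n + 1))
    (fun n => pairwise_disjoint_gridCell hR n.succ_pos) (fun n => iUnion_gridCell hR n.succ_pos)
    (volume_box_ne_top R) hf₀ hf.integrableOn hlog.integrableOn
    ((ae_restrict_iff' (measurableSet_box R)).2 (ae_tendsto_partitionAvg_gridCell hf hR)) hε
  exact ⟨n + 1, n.succ_pos, hn⟩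

lemma setAverage_gridCell (f : E d → ℝ) {R : ℝ} (hR : 0 < R) (N : ℕ) (k : Fin d → Fin N) :
    ⨍ x in gridCell R N k, f x = (N / (2 * R)) ^ d * ∫ x in gridCell R N k, f x := by
  have hvol : volume.real (gridCell R N k) = (2 * R / N) ^ d := by
    rw [measureReal_def, gridCell, volume_cuboid]
    simp only [gridPoint_succ_sub, Finset.prod_const, Finset.card_univ, Fintype.card_fin,
      ENNReal.toReal_pow]
    rw [ENNReal.toReal_ofReal (by positivity)]
  rw [setAverage_eq, hvol, ← inv_pow, inv_div, smul_eq_mul]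

/-! ### The divergence from a pullback of the standard Gaussian -/

/-- The density of the standard Gaussian measure on `ℝ^d`. -/
def gaussDensity (x : E d) : ℝ := ∏ i, gauss (x i)

/-- The logarithm of the density of the standard Gaussian measure on `ℝ^d`. -/
def logGaussDensity (x : E d) : ℝ := -(‖x‖ ^ 2 / 2) - d * Real.log (√(2 * Real.pi))

lemma gaussDensity_pos (x : E d) : 0 < gaussDensity x :=
  Finset.prod_pos fun i _ => gauss_pos (x i)

lemma log_gaussDensity (x : E d) : Real.log (gaussDensity x) = logGaussDensity x := by
  rw [gaussDensity, Real.log_prod fun i _ => (gauss_pos (x i)).ne']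
  simp only [log_gauss, Finset.sum_sub_distrib, Finset.sum_neg_distrib, ← Finset.sum_div,
    Finset.sum_const, Finset.card_univ, Fintype.card_fin, nsmul_eq_mul, logGaussDensity,
    EuclideanSpace.real_norm_sq_eq]

lemma log_gaussDensity_mul_exp (x : E d) (t : ℝ) :
    Real.log (gaussDensity x * Real.exp t) = logGaussDensity x + t := by
  rw [Real.log_mul (gaussDensity_pos x).ne' (Real.exp_pos t).ne', log_gaussDensity, Real.log_exp]

lemma continuous_logGaussDensity : Continuous (logGaussDensity : E d → ℝ) := by
  unfold logGaussDensity; fun_prop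

lemma log_sqrt_two_mul_pi_nonneg : 0 ≤ Real.log (√(2 * Real.pi)) :=
  Real.log_nonneg (Real.one_le_sqrt.2 (by linarith [Real.pi_gt_three]))

lemma abs_logGaussDensity (x : E d) :
    |logGaussDensity x| = ‖x‖ ^ 2 / 2 + d * Real.log (√(2 * Real.pi)) := by
  have := mul_nonneg d.cast_nonneg log_sqrt_two_mul_pi_nonneg
  rw [logGaussDensity, ← neg_add', abs_neg, abs_of_nonneg (by positivity)]

lemma tendsto_gaussMass : Tendsto gaussMass atTop (𝓝 1) := by
  have hgauss : Integrable gauss := by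
    rw [gauss_eq_gaussianPDFReal]; exact ProbabilityTheory.integrable_gaussianPDFReal 0 1
  have hlim := intervalIntegral_tendsto_integral hgauss tendsto_neg_atTop_atBot tendsto_id
  rwa [gauss_eq_gaussianPDFReal, ProbabilityTheory.integral_gaussianPDFReal_eq_one 0 one_ne_zero,
    ← gauss_eq_gaussianPDFReal] at hlim

/-- The integrand `ρ log ρ - ρ log r` of the divergence of `ρ` from the pullback
`r = (gaussDensity ∘ Ψ) e^ℓ` of the standard Gaussian density under a change of variables `Ψ` with
logarithmic Jacobian `ℓ`. -/
def divIntegrand (ρ : E d → ℝ) (Ψ : E d → E d) (ℓ : E d → ℝ) (x : E d) : ℝ :=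
  ρ x * Real.log (ρ x) - ρ x * (logGaussDensity (Ψ x) + ℓ x)

section DivIntegrand

variable {ρ : E d → ℝ} {Ψ : E d → E d} {ℓ : E d → ℝ}

lemma norm_divIntegrand_le {C : ℝ} {x : E d} (hρ : 0 ≤ ρ x) (hΨ : ‖Ψ x‖ ≤ C * (1 + ‖x‖))
    (hℓ : |ℓ x| ≤ C) :
    ‖divIntegrand ρ Ψ ℓ x‖ ≤ |ρ x * Real.log (ρ x)| +
      ((C ^ 2 + d * Real.log (√(2 * Real.pi)) + C) * ρ x + C ^ 2 * (ρ x * ‖x‖ ^ 2)) := by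
  have hsq : ‖Ψ x‖ ^ 2 / 2 ≤ C ^ 2 + C ^ 2 * ‖x‖ ^ 2 := by
    have : ‖Ψ x‖ ^ 2 ≤ (C * (1 + ‖x‖)) ^ 2 := by gcongr
    nlinarith [sq_nonneg (C * (1 - ‖x‖))]
  have hlog : |logGaussDensity (Ψ x) + ℓ x| ≤
      C ^ 2 + d * Real.log (√(2 * Real.pi)) + C + C ^ 2 * ‖x‖ ^ 2 := by
    refine (abs_add_le _ _).trans ?_
    rw [abs_logGaussDensity]
    linarith
  calc ‖divIntegrand ρ Ψ ℓ x‖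
      ≤ |ρ x * Real.log (ρ x)| + ρ x * |logGaussDensity (Ψ x) + ℓ x| := by
        rw [Real.norm_eq_abs, ← abs_of_nonneg hρ, ← abs_mul, abs_of_nonneg hρ]
        exact abs_sub (ρ x * Real.log (ρ x)) (ρ x * (logGaussDensity (Ψ x) + ℓ x))
    _ ≤ _ := by
        grw [hlog]
        exact (by ring : _ = _).le

lemma LimitReachable.integrable_and_exists_reachable (h : LimitReachable Ψ ℓ) (hρ₀ : ∀ x, 0 ≤ ρ x)
    (hρ : Integrable ρ) (hlog : Integrable fun x => ρ x * Real.log (ρ x))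
    (hmoment : Integrable fun x => ρ x * ‖x‖ ^ 2) {ε : ℝ} (hε : 0 < ε) :
    Integrable (divIntegrand ρ Ψ ℓ) ∧ ∃ Ψ' ℓ', Reachable Ψ' ℓ' ∧
      Integrable (divIntegrand ρ Ψ' ℓ') ∧
      ∫ x, divIntegrand ρ Ψ' ℓ' x ≤ (∫ x, divIntegrand ρ Ψ ℓ x) + ε := by
  obtain ⟨Ψn, ℓn, C, -, hreach, heq, hgrowth, hbound⟩ := h
  have hmeas : ∀ n, AEStronglyMeasurable (divIntegrand ρ (Ψn n) (ℓn n)) volume := fun n =>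
    hlog.1.sub (hρ.1.mul
      ((continuous_logGaussDensity.comp (hreach n).continuous).measurable.add
        (hreach n).hasLogJacobian.measurable_log).aestronglyMeasurable)
  have hdom : Integrable fun x => |ρ x * Real.log (ρ x)| +
      ((C ^ 2 + d * Real.log (√(2 * Real.pi)) + C) * ρ x + C ^ 2 * (ρ x * ‖x‖ ^ 2)) :=
    hlog.abs.add ((hρ.const_mul _).add (hmoment.const_mul _))
  have hle := fun n x => norm_divIntegrand_le (hρ₀ x) (hgrowth n x) (hbound n x)
  have hlim : ∀ x, Tendsto (fun n => divIntegrand ρ (Ψn n) (ℓn n) x) atTop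
      (𝓝 (divIntegrand ρ Ψ ℓ x)) := fun x => by
    refine tendsto_const_nhds.congr' ?_
    filter_upwards [heq x] with n hn
    rw [divIntegrand, divIntegrand, hn.1, hn.2]
  have hint : ∀ n, Integrable (divIntegrand ρ (Ψn n) (ℓn n)) := fun n =>
    hdom.mono' (hmeas n) (ae_of_all _ (hle n))
  refine ⟨hdom.mono' (aestronglyMeasurable_of_tendsto_ae atTop hmeas (ae_of_all _ hlim))
    (ae_of_all _ fun x => le_of_tendsto (hlim x).norm (Eventually.of_forall fun n => hle n x)), ?_⟩
  have hconv := tendsto_integral_of_dominated_convergence _ hmeas hdom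
    (fun n => ae_of_all _ (hle n)) (ae_of_all _ hlim)
  obtain ⟨n, hn⟩ := (hconv.eventually_le_const (lt_add_of_pos_right _ hε)).exists
  exact ⟨Ψn n, ℓn n, hreach n, hint n, hn⟩

end DivIntegrand

lemma box_mono {R R' : ℝ} (h : R ≤ R') : box d R ⊆ box d R' := fun _ hx j =>
  ⟨(neg_le_neg h).trans (hx j).1, (hx j).2.trans_le h⟩

lemma le_norm_of_notMem_box {R : ℝ} {x : E d} (hx : x ∉ box d R) : R ≤ ‖x‖ := by
  simp only [box, cuboid, mem_ofPred_eq, not_forall, mem_Ico, not_and_or, not_le, not_lt] at hx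
  obtain ⟨j, hj | hj⟩ := hx
  · exact ((lt_neg_of_lt_neg hj).le.trans (neg_le_abs _)).trans (PiLp.norm_apply_le x j)
  · exact (hj.trans (le_abs_self _)).trans (PiLp.norm_apply_le x j)

lemma tendsto_setIntegral_box_compl {f : E d → ℝ} (hf : Integrable f) :
    Tendsto (fun n : ℕ => ∫ x in (box d n)ᶜ, f x) atTop (𝓝 0) := by
  have hlim := tendsto_setIntegral_of_antitone (μ := (volume : Measure (E d))) (f := f)
    (s := fun n : ℕ => (box d n)ᶜ) (fun n => (measurableSet_box n).compl)
    (fun m n hmn => compl_subset_compl.2 (box_mono (Nat.cast_le.2 hmn))) ⟨0, hf.integrableOn⟩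
  have hempty : ⋂ n : ℕ, (box d n)ᶜ = ∅ := by
    refine eq_empty_of_forall_notMem fun x hx => ?_
    obtain ⟨n, hn⟩ := exists_nat_gt ‖x‖
    exact (le_norm_of_notMem_box (mem_iInter.1 hx n)).not_gt hn
  rwa [hempty, setIntegral_empty] at hlim

lemma measureReal_withDensity_ofReal {α : Type*} [MeasurableSpace α] {μ : Measure α} {f : α → ℝ}
    (hf : Integrable f μ) (hf₀ : ∀ x, 0 ≤ f x) {s : Set α} (hs : MeasurableSet s) :
    (μ.withDensity fun x => ENNReal.ofReal (f x)).real s = ∫ x in s, f x ∂μ := by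
  rw [measureReal_def, withDensity_apply _ hs,
    ← ofReal_integral_eq_lintegral_ofReal hf.integrableOn (ae_of_all _ hf₀),
    ENNReal.toReal_ofReal (integral_nonneg hf₀)]

lemma exp_neg_le_min_one {δ η m R : ℝ} (hδ : 0 < δ) (hη₀ : 0 < η) (hη₁ : η < 1) (hR : 0 < R)
    (hm : Real.exp (-δ) ≤ m) :
    Real.exp (-(2 * δ - Real.log η + 2 * R)) ≤ min 1 (Real.exp (-δ) * m * η / (2 * R)) := by
  refine le_min (Real.exp_le_one_iff.2 (by linarith [Real.log_neg hη₀ hη₁])) ?_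
  have hexp : Real.exp (-(2 * R)) ≤ (2 * R)⁻¹ := by
    rw [Real.exp_neg]
    exact inv_anti₀ (by positivity) (by linarith [Real.add_one_le_exp (2 * R)])
  calc Real.exp (-(2 * δ - Real.log η + 2 * R))
      = Real.exp (-δ) * Real.exp (-δ) * Real.exp (Real.log η) * Real.exp (-(2 * R)) := by
        simp only [← Real.exp_add]; ring_nf
    _ ≤ Real.exp (-δ) * m * η * (2 * R)⁻¹ := by
        rw [Real.exp_log hη₀]
        have := (Real.exp_pos (-δ)).le.trans hm
        gcongr

lemma neg_logGaussDensity_add_le {c t : ℝ} {x y : E d}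
    (h : Real.exp (-c) ^ d * gaussDensity x ≤ gaussDensity y * Real.exp t) :
    -(logGaussDensity y + t) ≤ ‖x‖ ^ 2 / 2 + d * Real.log (√(2 * Real.pi)) + d * c := by
  have hpow := pow_pos (Real.exp_pos (-c)) d
  have hlog := Real.log_le_log (mul_pos hpow (gaussDensity_pos x)) h
  rw [log_gaussDensity_mul_exp, Real.log_mul hpow.ne' (gaussDensity_pos x).ne', Real.log_pow,
    Real.log_exp, log_gaussDensity, logGaussDensity] at hlog
  linarith

/- The constant `C` depends neither on the size of the box nor on the mesh: outside the box, the
factor `1 / (2 R)` lost by the grid is absorbed by `exp ‖x‖`. -/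
lemma exists_limitReachable_gridCell {δ : ℝ} (hδ : 0 < δ) :
    ∃ C, ∀ ρ : E d → ℝ, IsProbDensity ρ → ∀ R, 0 < R → Real.exp (-δ) ≤ gaussMass R →
      ∀ N, 0 < N → ∃ Ψ ℓ, LimitReachable Ψ ℓ ∧
        (∀ k : Fin d → Fin N, ∀ x ∈ gridCell R N k,
          Real.exp (-(3 * d * δ)) * (⨍ y in gridCell R N k, ρ y) ≤
            gaussDensity (Ψ x) * Real.exp (ℓ x)) ∧
        ∀ x, R ≤ ‖x‖ → -(logGaussDensity (Ψ x) + ℓ x) ≤ C * (1 + ‖x‖ ^ 2) := by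
  set η := 1 - Real.exp (-δ) with hη
  have hη₀ : 0 < η := sub_pos.2 (Real.exp_lt_one_iff.2 (neg_lt_zero.2 hδ))
  have hη₁ : η < 1 := sub_lt_self 1 (Real.exp_pos _)
  refine ⟨d * Real.log (√(2 * Real.pi)) + d * (2 * δ - Real.log η) + d + 1,
    fun ρ hρ R hR hm N hN => ?_⟩
  have : IsFiniteMeasure (densityMeasure ρ) := isFiniteMeasure_withDensity_ofReal hρ.integrable.2
  obtain ⟨Ψ, ℓ, hΨ, hcell, htail⟩ :=
    exists_limitReachable_grid (densityMeasure ρ) hR hN hδ hη₀ hη₁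
  refine ⟨Ψ, ℓ, hΨ, fun k x hx => ?_, fun x hx => ?_⟩
  · have hmass : 0 ≤ ∫ x in gridCell R N k, ρ x := integral_nonneg hρ.nonneg
    have hreal := fun {s} => measureReal_withDensity_ofReal (s := s) hρ.integrable hρ.nonneg
    have hx' := hcell k x hx
    rw [densityMeasure, hreal (measurableSet_gridCell k), hreal .univ, setIntegral_univ,
      hρ.integral_eq_one, one_mul, hη, sub_sub_cancel] at hx'
    calc Real.exp (-(3 * d * δ)) * (⨍ y in gridCell R N k, ρ y)
        = (Real.exp (-δ) * Real.exp (-δ) * Real.exp (-δ) * (N / (2 * R))) ^ d *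
            ∫ x in gridCell R N k, ρ x := by
          rw [setAverage_gridCell ρ hR, ← mul_assoc, mul_pow _ ((N : ℝ) / (2 * R)),
            ← Real.exp_add, ← Real.exp_add, ← Real.exp_nat_mul]
          ring_nf
      _ ≤ (Real.exp (-δ) * gaussMass R * Real.exp (-δ) * (N / (2 * R))) ^ d *
            ∫ x in gridCell R N k, ρ x := by gcongr
      _ ≤ gaussDensity (Ψ x) * Real.exp (ℓ x) := hx'
  · have hle := neg_logGaussDensity_add_le (c := 2 * δ - Real.log η + 2 * R)
      ((mul_le_mul_of_nonneg_right (pow_le_pow_left₀ (Real.exp_pos _).le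
        (exp_neg_le_min_one hδ hη₀ hη₁ hR hm) d) (gaussDensity_pos x).le).trans (htail x))
    have hnorm : (d : ℝ) * (2 * R) ≤ d * (1 + ‖x‖ ^ 2) := by
      gcongr; nlinarith [sq_nonneg (1 - ‖x‖)]
    have hconst : 0 ≤ d * Real.log (√(2 * Real.pi)) + d * (2 * δ - Real.log η) :=
      add_nonneg (mul_nonneg d.cast_nonneg log_sqrt_two_mul_pi_nonneg)
        (mul_nonneg d.cast_nonneg (by linarith [Real.log_neg hη₀ hη₁]))
    nlinarith [mul_nonneg hconst (sq_nonneg ‖x‖), sq_nonneg ‖x‖]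

lemma divIntegrand_le_of_gridCell {ρ : E d → ℝ} (hρ : ∀ x, 0 ≤ ρ x) {R : ℝ} (hR : 0 < R) {N : ℕ}
    (hN : 0 < N) {Ψ : E d → E d} {ℓ : E d → ℝ} {c : ℝ}
    (hcell : ∀ k : Fin d → Fin N, ∀ x ∈ gridCell R N k,
      Real.exp (-c) * (⨍ y in gridCell R N k, ρ y) ≤ gaussDensity (Ψ x) * Real.exp (ℓ x))
    {x : E d} (hx : x ∈ box d R)
    (hzero : partitionAvg volume (gridCell R N) ρ x = 0 → ρ x = 0) :
    divIntegrand ρ Ψ ℓ x ≤ ρ x * Real.log (ρ x) -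
      ρ x * Real.log (partitionAvg volume (gridCell R N) ρ x) + c * ρ x := by
  rcases (partitionAvg_nonneg (μ := volume) (s := gridCell R N) hρ x).eq_or_lt with havg | havg
  · simp [divIntegrand, hzero havg.symm]
  obtain ⟨k, hk⟩ := mem_iUnion.1 ((iUnion_gridCell hR hN).symm ▸ hx)
  have hlogle := Real.log_le_log (mul_pos (Real.exp_pos _) havg)
    (partitionAvg_of_mem (pairwise_disjoint_gridCell hR hN) hk ▸ hcell k x hk)
  rw [log_gaussDensity_mul_exp, Real.log_mul (Real.exp_pos _).ne' havg.ne', Real.log_exp]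
    at hlogle
  rw [divIntegrand]
  linarith [mul_le_mul_of_nonneg_left hlogle (hρ x)]

lemma setIntegral_divIntegrand_le {ρ : E d → ℝ} (hρ : IsProbDensity ρ)
    (hlog : Integrable fun x => ρ x * Real.log (ρ x)) {R : ℝ} (hR : 0 < R) {N : ℕ} (hN : 0 < N)
    {Ψ : E d → E d} {ℓ : E d → ℝ} (hdiv : Integrable (divIntegrand ρ Ψ ℓ)) {c : ℝ} (hc : 0 ≤ c)
    (hcell : ∀ k : Fin d → Fin N, ∀ x ∈ gridCell R N k,
      Real.exp (-c) * (⨍ y in gridCell R N k, ρ y) ≤ gaussDensity (Ψ x) * Real.exp (ℓ x)) :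
    ∫ x in box d R, divIntegrand ρ Ψ ℓ x ≤ (∫ x in box d R, ρ x * Real.log (ρ x)) -
      (∫ x in box d R, ρ x * Real.log (partitionAvg volume (gridCell R N) ρ x)) + c := by
  have hunion := iUnion_gridCell (d := d) hR hN
  have hdisj := pairwise_disjoint_gridCell (d := d) hR hN
  have hstep : IntegrableOn (fun x => ρ x * Real.log (partitionAvg volume (gridCell R N) ρ x))
      (box d R) := hunion ▸ integrableOn_mul_comp_partitionAvg measurableSet_gridCell hdisj
        hρ.integrable.integrableOn Real.log
  have hzero := ae_eq_zero_of_partitionAvg_eq_zero measurableSet_gridCell hdisj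
    (hunion ▸ volume_box_ne_top R) hρ.nonneg hρ.integrable.integrableOn
  have hpoint : ∀ᵐ x, x ∈ box d R → divIntegrand ρ Ψ ℓ x ≤ ρ x * Real.log (ρ x) -
      ρ x * Real.log (partitionAvg volume (gridCell R N) ρ x) + c * ρ x := by
    filter_upwards [hzero] with x hx hxB
    exact divIntegrand_le_of_gridCell hρ.nonneg hR hN hcell hxB (hx (hunion.symm ▸ hxB))
  have hmass : c * ∫ x in box d R, ρ x ≤ c := mul_le_of_le_one_right hc <|
    (setIntegral_le_integral hρ.integrable (ae_of_all _ hρ.nonneg)).trans_eq hρ.integral_eq_one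
  calc ∫ x in box d R, divIntegrand ρ Ψ ℓ x
      ≤ ∫ x in box d R, (ρ x * Real.log (ρ x) -
          ρ x * Real.log (partitionAvg volume (gridCell R N) ρ x) + c * ρ x) :=
        setIntegral_mono_on_ae hdiv.integrableOn ((hlog.integrableOn.sub hstep).add
          (hρ.integrable.integrableOn.const_mul c)) (measurableSet_box R) hpoint
    _ = (∫ x in box d R, ρ x * Real.log (ρ x)) -
          (∫ x in box d R, ρ x * Real.log (partitionAvg volume (gridCell R N) ρ x)) +
          c * ∫ x in box d R, ρ x := by
        rw [← integral_sub hlog.integrableOn hstep, ← integral_const_mul]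
        exact integral_add (hlog.integrableOn.sub hstep)
          (hρ.integrable.integrableOn.const_mul c)
    _ ≤ _ := by grw [hmass]

theorem exists_reachable_integral_divIntegrand_le {ρ : E d → ℝ} (hρ : IsProbDensity ρ)
    (hlog : Integrable fun x => ρ x * Real.log (ρ x))
    (hmoment : Integrable fun x => ρ x * ‖x‖ ^ 2) {ε : ℝ} (hε : 0 < ε) :
    ∃ Ψ ℓ, Reachable Ψ ℓ ∧ Integrable (divIntegrand ρ Ψ ℓ) ∧
      ∫ x, divIntegrand ρ Ψ ℓ x ≤ ε := by
  obtain ⟨δ, hδ, hdδ⟩ : ∃ δ : ℝ, 0 < δ ∧ 3 * d * δ ≤ ε / 4 := by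
    refine ⟨ε / (12 * (d + 1)), by positivity, ?_⟩
    rw [mul_div_assoc', div_le_div_iff₀ (by positivity) (by positivity)]
    linarith
  obtain ⟨C, hC⟩ := exists_limitReachable_gridCell (d := d) hδ
  have hdom : Integrable fun x => |ρ x * Real.log (ρ x)| + (C * ρ x + C * (ρ x * ‖x‖ ^ 2)) :=
    hlog.abs.add ((hρ.integrable.const_mul C).add (hmoment.const_mul C))
  have hε' : 0 < ε / 4 := by positivity
  obtain ⟨R, hR_tail, hR_mass, hR⟩ :=
    (((tendsto_setIntegral_box_compl hdom).eventually_le_const hε').and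
      (((tendsto_gaussMass.comp tendsto_natCast_atTop_atTop).eventually_const_le
        (Real.exp_lt_one_iff.2 (neg_lt_zero.2 hδ))).and (eventually_gt_atTop 0))).exists
  have hR' : (0 : ℝ) < R := Nat.cast_pos.2 hR
  obtain ⟨N, hN, hentropy⟩ :=
    exists_setIntegral_box_mul_log_le hρ.integrable hρ.nonneg hlog hR' hε'
  obtain ⟨Ψ, ℓ, hΨ, hcell, htail⟩ := hC ρ hρ R hR' hR_mass N hN
  obtain ⟨hdiv, Ψ', ℓ', hreach, hdiv', hle⟩ :=
    hΨ.integrable_and_exists_reachable hρ.nonneg hρ.integrable hlog hmoment hε'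
  refine ⟨Ψ', ℓ', hreach, hdiv', hle.trans ?_⟩
  have hinside := setIntegral_divIntegrand_le hρ hlog hR' hN hdiv (by positivity) hcell
  have houtside : ∫ x in (box d R)ᶜ, divIntegrand ρ Ψ ℓ x ≤ ε / 4 := by
    refine (setIntegral_mono_on hdiv.integrableOn hdom.integrableOn (measurableSet_box _).compl
      fun x hx => ?_).trans hR_tail
    have hx' := mul_le_mul_of_nonneg_left (htail x (le_norm_of_notMem_box hx)) (hρ.nonneg x)
    rw [divIntegrand]
    linarith [le_abs_self (ρ x * Real.log (ρ x))]
  rw [← integral_add_compl (measurableSet_box R) hdiv]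
  linarith

/-! ### Densities under changes of variables -/

section PullbackDensity

variable {α : Type*} {Ψ : α → α} {ℓ f g : α → ℝ}

/-- The density `e^ℓ (f ∘ Ψ)` of the measure that a change of variables `Ψ` with logarithmic
Jacobian `ℓ` carries to the one of density `f`; equivalently the image density of `f` under
`Ψ⁻¹`. -/
def pullbackDensity (Ψ : α → α) (ℓ f : α → ℝ) (x : α) : ℝ := Real.exp (ℓ x) * f (Ψ x)

lemma pullbackDensity_comp (Ψ₁ Ψ₂ : α → α) (ℓ₁ ℓ₂ f : α → ℝ) :
    pullbackDensity (Ψ₂ ∘ Ψ₁) (fun x => ℓ₁ x + ℓ₂ (Ψ₁ x)) f =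
      pullbackDensity Ψ₁ ℓ₁ (pullbackDensity Ψ₂ ℓ₂ f) := by
  ext1 x
  simp only [pullbackDensity, Function.comp, Real.exp_add, mul_assoc]

lemma abs_pullbackDensity_le {C D : ℝ} {x : α} (hℓ : |ℓ x| ≤ D) (hf : |f (Ψ x)| ≤ C) :
    |pullbackDensity Ψ ℓ f x| ≤ Real.exp D * C := by
  rw [pullbackDensity, abs_mul, Real.abs_exp]
  gcongr
  exact (le_abs_self _).trans hℓ

variable [MeasurableSpace α] {μ : Measure α}

lemma ae_eq_of_withDensity_ofReal_eq (hf : AEMeasurable f μ) (hg : AEMeasurable g μ)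
    (hf₀ : ∀ x, 0 ≤ f x) (hg₀ : ∀ x, 0 ≤ g x)
    [IsFiniteMeasure (μ.withDensity fun x => ENNReal.ofReal (f x))]
    (h : μ.withDensity (fun x => ENNReal.ofReal (f x)) =
      μ.withDensity fun x => ENNReal.ofReal (g x)) : f =ᵐ[μ] g := by
  have hfin := measure_ne_top (μ.withDensity fun x => ENNReal.ofReal (f x)) univ
  rw [withDensity_apply _ MeasurableSet.univ, Measure.restrict_univ] at hfin
  filter_upwards [(withDensity_eq_iff hf.ennreal_ofReal hg.ennreal_ofReal hfin).1 h] with x hx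
  exact (ENNReal.ofReal_eq_ofReal_iff (hf₀ x) (hg₀ x)).1 hx

namespace HasLogJacobian

lemma integrable_pullbackDensity (h : HasLogJacobian μ Ψ ℓ) (hf : Integrable f μ) :
    Integrable (pullbackDensity Ψ ℓ f) μ :=
  h.integrable_comp hf

lemma measurable_pullbackDensity (h : HasLogJacobian μ Ψ ℓ) (hf : Measurable f) :
    Measurable (pullbackDensity Ψ ℓ f) :=
  h.measurable_log.exp.mul (hf.comp h.measurableEmbedding.measurable)

lemma pullbackDensity_congr_ae (h : HasLogJacobian μ Ψ ℓ) (hfg : f =ᵐ[μ] g) :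
    pullbackDensity Ψ ℓ f =ᵐ[μ] pullbackDensity Ψ ℓ g := by
  filter_upwards [h.ae_comp_iff.2 hfg] with x hx
  rw [pullbackDensity, pullbackDensity, hx]

lemma map_withDensity_pullbackDensity (h : HasLogJacobian μ Ψ ℓ) (f : α → ℝ) :
    (μ.withDensity fun x => ENNReal.ofReal (pullbackDensity Ψ ℓ f x)).map Ψ =
      μ.withDensity fun x => ENNReal.ofReal (f x) := by
  have hΨ := h.measurableEmbedding.measurable
  ext s hs
  rw [Measure.map_apply hΨ hs, withDensity_apply _ (hΨ hs), withDensity_apply _ hs,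
    ← lintegral_indicator (hΨ hs), ← lintegral_indicator hs, ← h.lintegral_comp (s.indicator _)]
  refine lintegral_congr fun x => ?_
  by_cases hx : Ψ x ∈ s <;>
    simp [indicator, hx, pullbackDensity, ENNReal.ofReal_mul (Real.exp_pos _).le]

lemma pullbackDensity_ae_eq_of_map_eq (h : HasLogJacobian μ Ψ ℓ) (hf : Measurable f)
    (hg : Measurable g) (hf₀ : ∀ x, 0 ≤ f x) (hg₀ : ∀ x, 0 ≤ g x)
    [IsFiniteMeasure (μ.withDensity fun x => ENNReal.ofReal (g x))]
    (hmap : (μ.withDensity fun x => ENNReal.ofReal (g x)).map Ψ =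
      μ.withDensity fun x => ENNReal.ofReal (f x)) :
    pullbackDensity Ψ ℓ f =ᵐ[μ] g := by
  rw [← h.map_withDensity_pullbackDensity f] at hmap
  have heq := congrArg (Measure.comap Ψ) hmap
  rw [h.measurableEmbedding.comap_map, h.measurableEmbedding.comap_map] at heq
  exact (ae_eq_of_withDensity_ofReal_eq hg.aemeasurable
    (h.measurable_pullbackDensity hf).aemeasurable hg₀
    (fun x => mul_nonneg (Real.exp_pos _).le (hf₀ _)) heq).symm

end HasLogJacobian

end PullbackDensity

/-! ### Gaussian measures -/

lemma integrable_exp_neg_mul_sq_norm {V : Type*} [NormedAddCommGroup V] [InnerProductSpace ℝ V]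
    [FiniteDimensional ℝ V] [MeasurableSpace V] [BorelSpace V] {b : ℝ} (hb : 0 < b) :
    Integrable fun x : V => Real.exp (-b * ‖x‖ ^ 2) := by
  refine (GaussianFourier.integrable_cexp_neg_mul_sq_norm_add (V := V) (b := (b : ℂ))
    (by simpa using hb) 0 0).norm.congr (ae_of_all _ fun x => ?_)
  simp only [Complex.norm_exp]
  simp [← Complex.ofReal_pow]

lemma mul_exp_neg_div_le {c : ℝ} (hc : 0 < c) (s : ℝ) :
    s * Real.exp (-s / c) ≤ 2 * c * Real.exp (-s / (2 * c)) := by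
  have hlin : s / (2 * c) ≤ Real.exp (s / (2 * c)) := by
    linarith [Real.add_one_le_exp (s / (2 * c))]
  calc s * Real.exp (-s / c)
      = 2 * c * Real.exp (-s / c) * (s / (2 * c)) := by field_simp
    _ ≤ 2 * c * Real.exp (-s / c) * Real.exp (s / (2 * c)) := by gcongr
    _ = 2 * c * Real.exp (-s / (2 * c)) := by
        rw [mul_assoc, ← Real.exp_add]
        congr 2
        field_simp
        ring

lemma integrable_mul_sq_norm_of_tail {V : Type*} [NormedAddCommGroup V] [InnerProductSpace ℝ V]
    [FiniteDimensional ℝ V] [MeasurableSpace V] [BorelSpace V] {ρ : V → ℝ} (h₀ : ∀ x, 0 ≤ ρ x)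
    (hρ : Integrable ρ) {M σ K : ℝ} (hσ : 0 < σ)
    (htail : ∀ x, M ≤ ‖x‖ → ρ x ≤ K * Real.exp (-‖x‖ ^ 2 / (2 * σ ^ 2))) :
    Integrable fun x => ρ x * ‖x‖ ^ 2 := by
  have hσ2 : 0 < 2 * σ ^ 2 := by positivity
  have hdom : Integrable fun x : V =>
      M ^ 2 * ρ x + |K| * (2 * (2 * σ ^ 2) * Real.exp (-(2 * (2 * σ ^ 2))⁻¹ * ‖x‖ ^ 2)) :=
    (hρ.const_mul _).add
      (((integrable_exp_neg_mul_sq_norm (by positivity)).const_mul _).const_mul _)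
  refine hdom.mono' (hρ.1.mul (by fun_prop)) (ae_of_all _ fun x => ?_)
  rw [Real.norm_of_nonneg (mul_nonneg (h₀ x) (sq_nonneg _))]
  have hinside : 0 ≤ M ^ 2 * ρ x := mul_nonneg (sq_nonneg _) (h₀ x)
  rcases le_or_gt M ‖x‖ with hx | hx
  · refine le_add_of_nonneg_of_le hinside ?_
    calc ρ x * ‖x‖ ^ 2
        ≤ |K| * Real.exp (-‖x‖ ^ 2 / (2 * σ ^ 2)) * ‖x‖ ^ 2 := by
          gcongr
          exact (htail x hx).trans (mul_le_mul_of_nonneg_right (le_abs_self K) (Real.exp_pos _).le)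
      _ = |K| * (‖x‖ ^ 2 * Real.exp (-‖x‖ ^ 2 / (2 * σ ^ 2))) := by ring
      _ ≤ |K| * (2 * (2 * σ ^ 2) * Real.exp (-‖x‖ ^ 2 / (2 * (2 * σ ^ 2)))) := by
          exact mul_le_mul_of_nonneg_left (mul_exp_neg_div_le hσ2 _) (abs_nonneg K)
      _ = _ := by rw [neg_div, neg_mul, ← div_eq_inv_mul]
  · refine le_add_of_le_of_nonneg ?_ (by positivity)
    rw [mul_comm]
    exact mul_le_mul_of_nonneg_right (by gcongr) (h₀ x)

@[fun_prop]
lemma continuous_gaussDensity : Continuous (gaussDensity : E d → ℝ) := by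
  unfold gaussDensity; fun_prop

lemma gaussDensity_le_one (x : E d) : gaussDensity x ≤ 1 :=
  Finset.prod_le_one (fun _ _ => (gauss_pos _).le) fun _ _ => gauss_le_one _

lemma pi_gaussianReal (ι : Type*) [Fintype ι] :
    Measure.pi (fun _ : ι => ProbabilityTheory.gaussianReal 0 1) =
      volume.withDensity fun x : ι → ℝ => ENNReal.ofReal (∏ i, gauss (x i)) := by
  have hgauss : Integrable gauss := by
    rw [gauss_eq_gaussianPDFReal]; exact ProbabilityTheory.integrable_gaussianPDFReal 0 1
  refine Measure.pi_eq fun s hs => ?_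
  rw [withDensity_apply _ (MeasurableSet.univ_pi hs), volume_pi, Measure.restrict_pi_pi,
    ← ofReal_integral_eq_lintegral_ofReal
      (Integrable.fintype_prod (f := fun _ => gauss) fun i => hgauss.restrict)
      (ae_of_all _ fun x => Finset.prod_nonneg fun i _ => (gauss_pos _).le),
    integral_fintype_prod_eq_prod (fun _ => gauss),
    ENNReal.ofReal_prod_of_nonneg fun i _ => integral_nonneg fun x => (gauss_pos x).le]
  refine Finset.prod_congr rfl fun i _ => ?_
  rw [ProbabilityTheory.gaussianReal_apply_eq_integral 0 one_ne_zero, gauss_eq_gaussianPDFReal]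

lemma densityMeasure_gaussDensity :
    densityMeasure (gaussDensity : E d → ℝ) = ProbabilityTheory.stdGaussian (E d) := by
  rw [← ProbabilityTheory.map_pi_eq_stdGaussian, pi_gaussianReal]
  have hmeas : Measurable (WithLp.toLp 2 : (Fin d → ℝ) → E d) := by fun_prop
  ext s hs
  rw [Measure.map_apply hmeas hs, densityMeasure, withDensity_apply _ (hmeas hs),
    withDensity_apply _ hs]
  exact ((PiLp.volume_preserving_toLp (Fin d)).setLIntegral_comp_preimage hs
    (f := fun x => ENNReal.ofReal (gaussDensity x)) (by fun_prop)).symm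

instance : IsProbabilityMeasure (densityMeasure (gaussDensity : E d → ℝ)) := by
  rw [densityMeasure_gaussDensity]; infer_instance

lemma reachable_add_const (m : E d) : Reachable (fun x : E d => x + m) 0 := by
  have hrate : rate (m, (0 : E d), (1 : ℝ)) = 0 := by simp [rate]
  convert reachable_flow (m, (0 : E d), (1 : ℝ)) using 1
  · ext1 x; simp [flow, hrate, expPrimitive, preact]
  · ext1 x; simp [flowLogJac, hrate]

/- The two neurons `(u, 0)` and `(-u, 0)` move the half-spaces `⟪u, x⟫ ≥ 0` and `⟪u, x⟫ ≤ 0`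
separately, each at the rate `log r`. -/
lemma exists_reachable_dilation {u : E d} (hu : ‖u‖ = 1) {r : ℝ} (hr : 0 < r) :
    ∃ ℓ, Reachable (fun x : E d => x + ((r - 1) * inner ℝ u x) • u) ℓ := by
  set c := Real.log r
  set p : Param d := (c • u, u, 0)
  set q : Param d := ((-c) • u, -u, 0)
  have hp : rate p = c := by simp [p, rate, inner_smul_right, hu]
  have hq : rate q = c := by simp [q, rate, inner_smul_right, hu]
  have hprim : expPrimitive c 1 * c = r - 1 := by
    rw [mul_comm, mul_expPrimitive, mul_one, Real.exp_log hr]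
  have hcomp : (fun x : E d => x + ((r - 1) * inner ℝ u x) • u) = flow q 1 ∘ flow p 1 := by
    ext1 x
    have hpx : preact p x = inner ℝ u x := by simp [p, preact]
    have hqx : ∀ y, preact q y = -preact p y := fun y => by simp [p, q, preact]
    rw [Function.comp, ← hprim]
    rcases le_or_gt (preact p x) 0 with hx | hx
    · rw [flow_of_preact_nonpos hx, flow, hqx, hq, max_eq_left (neg_nonneg.2 hx), hpx]
      simp only [q]
      module
    · rw [flow_of_preact_nonpos (p := q)
        (hqx _ ▸ neg_nonpos.2 ((preact_flow_pos_iff p 1 x).2 hx).le), flow, hp,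
        max_eq_left hx.le, hpx]
      simp only [p]
      module
  exact ⟨_, hcomp ▸ (reachable_flow q).comp (reachable_flow p)⟩

lemma exists_reachable_add_sum {ι : Type*} {u : ι → E d} (hu : Orthonormal ℝ u) {r : ι → ℝ}
    (hr : ∀ k, 0 < r k) (s : Finset ι) :
    ∃ ℓ, Reachable (fun x : E d => x + ∑ k ∈ s, ((r k - 1) * inner ℝ (u k) x) • u k) ℓ := by
  classical
  induction s using Finset.induction_on with
  | empty => exact ⟨0, by simpa using! Reachable.id⟩
  | insert k s hk ih =>
    obtain ⟨ℓ, hℓ⟩ := ih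
    obtain ⟨ℓ', hℓ'⟩ := exists_reachable_dilation (hu.1 k) (hr k)
    have hcomp : (fun x : E d => x + ∑ j ∈ insert k s, ((r j - 1) * inner ℝ (u j) x) • u j) =
        (fun x : E d => x + ((r k - 1) * inner ℝ (u k) x) • u k) ∘
          fun x : E d => x + ∑ j ∈ s, ((r j - 1) * inner ℝ (u j) x) • u j := by
      ext1 x
      have horth : inner ℝ (u k) (∑ j ∈ s, ((r j - 1) * inner ℝ (u j) x) • u j) = (0 : ℝ) := by
        rw [inner_sum]
        refine Finset.sum_eq_zero fun j hj => ?_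
        rw [inner_smul_right, hu.2 (ne_of_mem_of_not_mem hj hk).symm, mul_zero]
      simp only [Function.comp, Finset.sum_insert hk, inner_add_right, horth, add_zero]
      abel
    exact ⟨_, hcomp ▸ hℓ'.comp hℓ⟩

lemma exists_reachable_of_orthonormalBasis {ι : Type*} [Fintype ι]
    (u : OrthonormalBasis ι ℝ (E d)) {r : ι → ℝ} (hr : ∀ k, 0 < r k) :
    ∃ ℓ, Reachable (fun x : E d => ∑ k, (r k * inner ℝ (u k) x) • u k) ℓ := by
  have hsum : (fun x : E d => ∑ k, (r k * inner ℝ (u k) x) • u k) =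
      fun x => x + ∑ k, ((r k - 1) * inner ℝ (u k) x) • u k := by
    ext1 x
    conv_rhs => rw [← u.sum_repr' x]
    rw [← Finset.sum_add_distrib]
    refine Finset.sum_congr rfl fun k _ => ?_
    rw [u.sum_repr' x]
    module
  exact hsum ▸ exists_reachable_add_sum u.orthonormal hr Finset.univ

lemma exists_reachable_toEuclideanCLM {Q : Matrix (Fin d) (Fin d) ℝ} (hQ : Q.PosDef) :
    ∃ ℓ, Reachable (Matrix.toEuclideanCLM (𝕜 := ℝ) Q) ℓ := by
  set u := hQ.1.eigenvectorBasis
  have hdiag : (Matrix.toEuclideanCLM (𝕜 := ℝ) Q : E d → E d) =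
      fun x => ∑ k, (hQ.1.eigenvalues k * inner ℝ (u k) x) • u k := by
    ext1 x
    conv_lhs => rw [← u.sum_repr' x, map_sum]
    refine Finset.sum_congr rfl fun k _ => ?_
    have heigen : Matrix.toEuclideanCLM (𝕜 := ℝ) Q (u k) = hQ.1.eigenvalues k • u k := by
      ext j
      exact congrFun (hQ.1.mulVec_eigenvectorBasis k) j
    rw [map_smul, heigen, smul_smul, mul_comm]
  exact hdiag ▸ exists_reachable_of_orthonormalBasis u hQ.eigenvalues_pos

open scoped MatrixOrder in
lemma posDef_sqrt {S : Matrix (Fin d) (Fin d) ℝ} (hS : S.PosDef) :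
    (CFC.sqrt S).PosDef := by
  rw [(Matrix.nonneg_iff_posSemidef.1 (CFC.sqrt_nonneg S)).posDef_iff_isUnit]
  refine isUnit_of_mul_isUnit_left (y := CFC.sqrt S) ?_
  rw [CFC.sqrt_mul_sqrt_self S hS.posSemidef.nonneg]
  exact hS.isUnit

lemma exists_reachable_map_gaussDensity (m : E d) {S : Matrix (Fin d) (Fin d) ℝ}
    (hS : S.PosDef) :
    ∃ A ℓ, Reachable A ℓ ∧
      (densityMeasure gaussDensity).map A = ProbabilityTheory.multivariateGaussian m S := by
  obtain ⟨ℓ, hℓ⟩ := exists_reachable_toEuclideanCLM (posDef_sqrt hS)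
  refine ⟨_, _, (reachable_add_const m).comp hℓ, ?_⟩
  rw [densityMeasure_gaussDensity, ProbabilityTheory.multivariateGaussian]
  simp only [Function.comp_def, add_comm]

lemma densityMeasure_lebesgueDensity {μ : Measure (E d)} [SigmaFinite μ] (hμ : μ ≪ volume) :
    densityMeasure (lebesgueDensity μ) = μ := by
  conv_rhs => rw [← Measure.withDensity_rnDeriv_eq μ volume hμ]
  refine withDensity_congr_ae ?_
  filter_upwards [Measure.rnDeriv_lt_top μ volume] with x hx
  exact ENNReal.ofReal_toReal hx.ne

lemma measurable_lebesgueDensity (μ : Measure (E d)) : Measurable (lebesgueDensity μ) :=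
  (Measure.measurable_rnDeriv μ volume).ennreal_toReal

section ImageOfGaussian

variable {A : E d → E d} {ℓ : E d → ℝ} {μ : Measure (E d)}

lemma Reachable.absolutelyContinuous_of_map_eq (hA : Reachable A ℓ) {g : E d → ℝ}
    (hμ : (densityMeasure g).map A = μ) : μ ≪ volume := by
  rw [← hμ]
  exact ((withDensity_absolutelyContinuous _ _).map
    hA.hasLogJacobian.measurableEmbedding.measurable).trans
      hA.hasLogJacobian.quasiMeasurePreserving.absolutelyContinuous

variable [SigmaFinite μ]

lemma Reachable.pullbackDensity_lebesgueDensity (hA : Reachable A ℓ)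
    (hμ : (densityMeasure gaussDensity).map A = μ) :
    pullbackDensity A ℓ (lebesgueDensity μ) =ᵐ[volume] gaussDensity := by
  have : IsFiniteMeasure (volume.withDensity fun x : E d => ENNReal.ofReal (gaussDensity x)) :=
    inferInstanceAs (IsFiniteMeasure (densityMeasure gaussDensity))
  refine hA.hasLogJacobian.pullbackDensity_ae_eq_of_map_eq (measurable_lebesgueDensity μ)
    continuous_gaussDensity.measurable (fun _ => ENNReal.toReal_nonneg)
    (fun x => (gaussDensity_pos x).le) (hμ.trans ?_)
  exact (densityMeasure_lebesgueDensity (hA.absolutelyContinuous_of_map_eq hμ)).symm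

lemma Reachable.exists_ae_abs_lebesgueDensity_le (hA : Reachable A ℓ)
    (hμ : (densityMeasure gaussDensity).map A = μ) :
    ∃ C, ∀ᵐ x, |lebesgueDensity μ x| ≤ C := by
  obtain ⟨C, hC⟩ := hA.exists_abs_log_le
  refine ⟨Real.exp C, hA.hasLogJacobian.ae_comp_iff.1 ?_⟩
  filter_upwards [hA.pullbackDensity_lebesgueDensity hμ] with y hy
  have hexp : lebesgueDensity μ (A y) = Real.exp (-ℓ y) * gaussDensity y := by
    rw [← hy, pullbackDensity, ← mul_assoc, ← Real.exp_add, neg_add_cancel, Real.exp_zero, one_mul]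
  rw [hexp, abs_of_pos (mul_pos (Real.exp_pos _) (gaussDensity_pos y))]
  exact (mul_le_of_le_one_right (Real.exp_pos _).le (gaussDensity_le_one y)).trans
    (Real.exp_le_exp.2 (neg_le.1 (neg_le_of_abs_le (hC y))))

end ImageOfGaussian

/-! ### Gluing along a uniform grid -/

section Glue

variable {F : Type*} {τ : ℝ} {g : ℕ → ℝ → F}

/-- The function of time that follows `g k`, with its clock reset, on `[k * τ, (k + 1) * τ)`. -/
def glue (τ : ℝ) (g : ℕ → ℝ → F) (t : ℝ) : F := g ⌊t / τ⌋₊ (t - ⌊t / τ⌋₊ * τ)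

lemma grid_mono (hτ : 0 < τ) {k l : ℕ} (h : k ≤ l) : (k : ℝ) * τ ≤ l * τ := by
  gcongr

lemma grid_succ_sub (τ : ℝ) (k : ℕ) : ((k + 1 : ℕ) : ℝ) * τ - k * τ = τ := by
  push_cast; ring

lemma floor_div_eq (hτ : 0 < τ) {k : ℕ} {t : ℝ} (ht : t ∈ Ico (k * τ) ((k + 1 : ℕ) * τ)) :
    ⌊t / τ⌋₊ = k := by
  rw [Nat.floor_eq_iff (div_nonneg ((by positivity : (0 : ℝ) ≤ k * τ).trans ht.1) hτ.le),
    le_div_iff₀ hτ, div_lt_iff₀ hτ]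
  exact ⟨ht.1, by simpa using ht.2⟩

lemma exists_mem_grid {n : ℕ} (hn : 0 < n) {t : ℝ} (ht : t ∈ Icc 0 (n * τ)) :
    ∃ k < n, t ∈ Icc (k * τ) ((k + 1 : ℕ) * τ) := by
  induction n, hn using Nat.le_induction with
  | base => exact ⟨0, one_pos, by simpa using ht⟩
  | succ n _ ih =>
    rcases le_total t (n * τ) with hle | hle
    · obtain ⟨k, hk, hkt⟩ := ih ⟨ht.1, hle⟩
      exact ⟨k, hk.trans n.lt_succ_self, hkt⟩
    · exact ⟨n, n.lt_succ_self, hle, ht.2⟩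

lemma glue_zero (τ : ℝ) (g : ℕ → ℝ → F) : glue τ g 0 = g 0 0 := by
  simp [glue]

lemma glue_of_mem_Icc (hτ : 0 < τ) (hg : ∀ k, g k τ = g (k + 1) 0) {k : ℕ} {t : ℝ}
    (ht : t ∈ Icc (k * τ) ((k + 1 : ℕ) * τ)) : glue τ g t = g k (t - k * τ) := by
  rcases ht.2.eq_or_lt with rfl | hlt
  · have hfloor : ⌊((k + 1 : ℕ) : ℝ) * τ / τ⌋₊ = k + 1 := by
      rw [mul_div_cancel_right₀ _ hτ.ne', Nat.floor_natCast]
    rw [glue, hfloor, sub_self, grid_succ_sub, hg]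
  · rw [glue, floor_div_eq hτ ⟨ht.1, hlt⟩]

lemma continuousOn_glue [TopologicalSpace F] (hτ : 0 < τ) (hg : ∀ k, g k τ = g (k + 1) 0)
    (hc : ∀ k, Continuous (g k)) (k : ℕ) :
    ContinuousOn (glue τ g) (Icc (k * τ) ((k + 1 : ℕ) * τ)) :=
  ((hc k).comp (continuous_sub_right _)).continuousOn.congr fun _ => glue_of_mem_Icc hτ hg

lemma continuousOn_grid [TopologicalSpace F] (hτ : 0 < τ) {n : ℕ} (hn : 0 < n) {f : ℝ → F}
    (hf : ∀ k < n, ContinuousOn f (Icc (k * τ) ((k + 1 : ℕ) * τ))) :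
    ContinuousOn f (Icc 0 (n * τ)) := by
  induction n, hn using Nat.le_induction with
  | base => simpa using hf 0 one_pos
  | succ n _ ih =>
    have hunion := (ih fun k hk => hf k (hk.trans n.lt_succ_self)).union_of_isClosed
      (hf n n.lt_succ_self) isClosed_Icc isClosed_Icc
    rwa [Icc_union_Icc_eq_Icc (by positivity) (grid_mono hτ n.le_succ)] at hunion

variable [NormedAddCommGroup F]

lemma intervalIntegrable_grid {n : ℕ} {v : ℝ → F}
    (hv : ∀ k < n, IntervalIntegrable v volume (k * τ) ((k + 1 : ℕ) * τ)) :
    IntervalIntegrable v volume 0 (n * τ) := by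
  simpa using IntervalIntegrable.trans_iterate (a := fun k : ℕ => (k : ℝ) * τ) hv

variable [NormedSpace ℝ F]

lemma integral_grid_add (hτ : 0 < τ) {k : ℕ} {v : ℝ → F}
    (hv : ∀ j ≤ k, IntervalIntegrable v volume (j * τ) ((j + 1 : ℕ) * τ)) {t : ℝ}
    (ht : t ∈ Icc (k * τ) ((k + 1 : ℕ) * τ)) :
    (∫ s in (0 : ℝ)..k * τ, v s) + ∫ s in (k * τ)..t, v s = ∫ s in (0 : ℝ)..t, v s := by
  refine intervalIntegral.integral_add_adjacent_intervals
    (intervalIntegrable_grid fun j hj => hv j hj.le) ((hv k le_rfl).mono_set ?_)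
  rw [uIcc_of_le ht.1, uIcc_of_le (grid_mono hτ k.le_succ)]
  exact Icc_subset_Icc_right ht.2

lemma integral_eq_on_grid_iff (hτ : 0 < τ) {n : ℕ} (hn : 0 < n) {f v : ℝ → F}
    (hv : ∀ k < n, IntervalIntegrable v volume (k * τ) ((k + 1 : ℕ) * τ)) :
    (∀ t ∈ Icc 0 (n * τ), f t = f 0 + ∫ s in (0 : ℝ)..t, v s) ↔
      ∀ k < n, ∀ t ∈ Icc (k * τ) ((k + 1 : ℕ) * τ),
        f t = f (k * τ) + ∫ s in (k * τ)..t, v s := by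
  constructor
  · intro h k hk t ht
    have hk₀ : (0 : ℝ) ≤ k * τ := by positivity
    rw [h t ⟨hk₀.trans ht.1, ht.2.trans (grid_mono hτ hk)⟩, h (k * τ) ⟨hk₀, grid_mono hτ hk.le⟩,
      add_assoc, integral_grid_add hτ (fun j hj => hv j (hj.trans_lt hk)) ht]
  · intro h
    have hgrid : ∀ k ≤ n, f (k * τ) = f 0 + ∫ s in (0 : ℝ)..k * τ, v s := by
      intro k
      induction k with
      | zero => simp
      | succ k ih =>
        intro hk
        have hmem := right_mem_Icc.2 (grid_mono hτ k.le_succ)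
        rw [h k hk _ hmem, ih (Nat.le_of_succ_le hk), add_assoc,
          integral_grid_add hτ (fun j hj => hv j (hj.trans_lt hk)) hmem]
    intro t ht
    obtain ⟨k, hk, hkt⟩ := exists_mem_grid hn ht
    rw [h k hk t hkt, hgrid k hk.le, add_assoc,
      integral_grid_add hτ (fun j hj => hv j (hj.trans_lt hk)) hkt]

end Glue

/-! ### Piecewise constant controls -/

/-- The control that equals `p k` on `[k * τ, (k + 1) * τ)`. -/
def control (p : ℕ → Param d) (τ : ℝ) : ℝ → Param d := glue τ fun k _ => p k

section Control

variable (p : ℕ → Param d) {τ : ℝ}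

lemma control_eq (hτ : 0 < τ) {k : ℕ} {s : ℝ} (hs : s ∈ Ico (k * τ) ((k + 1 : ℕ) * τ)) :
    control p τ s = p k := by
  rw [control, glue, floor_div_eq hτ hs]

lemma isPiecewiseConstant_control (hτ : 0 < τ) (n : ℕ) :
    IsPiecewiseConstant (n * τ) (control p τ) := by
  refine ⟨n, fun k => (k : ℕ) * τ, fun k => p k, fun i j hij => ?_, by simp, by simp,
    fun k s hs => control_eq p hτ (by simpa using! hs)⟩
  exact mul_lt_mul_of_pos_right (Nat.cast_lt.2 hij) hτ

variable {F : Type*} [NormedAddCommGroup F]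

lemma intervalIntegrable_control (hτ : 0 < τ) {v : ℝ → Param d → F} {k : ℕ}
    (hv : ContinuousOn (fun s => v s (p k)) (Icc (k * τ) ((k + 1 : ℕ) * τ))) :
    IntervalIntegrable (fun s => v s (control p τ s)) volume (k * τ) ((k + 1 : ℕ) * τ) := by
  refine (hv.intervalIntegrable_of_Icc (grid_mono hτ k.le_succ)).congr_uIoo fun s hs => ?_
  rw [uIoo_of_le (grid_mono hτ k.le_succ)] at hs
  simp only [control_eq p hτ (Ioo_subset_Ico_self hs)]

lemma integral_control [NormedSpace ℝ F] (hτ : 0 < τ) (v : ℝ → Param d → F) {k : ℕ} {t : ℝ}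
    (ht : t ∈ Icc (k * τ) ((k + 1 : ℕ) * τ)) :
    ∫ s in (k * τ)..t, v s (control p τ s) = ∫ s in (k * τ)..t, v s (p k) := by
  refine intervalIntegral.integral_congr_Ioo_of_le ht.1 fun s hs => ?_
  simp only [control_eq p hτ (Ioo_subset_Ico_self ⟨hs.1, hs.2.trans_le ht.2⟩)]

variable [NormedSpace ℝ F]

lemma integral_eq_control_iff (hτ : 0 < τ) {n : ℕ} (hn : 0 < n) {f : ℝ → F}
    {v : ℝ → Param d → F}
    (hv : ∀ k < n, ContinuousOn (fun s => v s (p k)) (Icc (k * τ) ((k + 1 : ℕ) * τ))) :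
    (∀ t ∈ Icc 0 (n * τ), f t = f 0 + ∫ s in (0 : ℝ)..t, v s (control p τ s)) ↔
      ∀ k < n, ∀ t ∈ Icc (k * τ) ((k + 1 : ℕ) * τ),
        f t = f (k * τ) + ∫ s in (k * τ)..t, v s (p k) := by
  rw [integral_eq_on_grid_iff hτ hn fun k hk => intervalIntegrable_control p hτ (hv k hk)]
  refine forall₄_congr fun k _ t ht => ?_
  rw [integral_control p hτ v ht]

end Control

/-! ### The flow of a piecewise constant control -/

section StageCurve

variable (p : Param d)

lemma exists_lipschitzWith_velocity : ∃ K, LipschitzWith K fun x => velocity x p := by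
  refine ⟨‖p.2.1‖₊ * ‖p.1‖₊, LipschitzWith.of_dist_le_mul fun x y => ?_⟩
  have hpreact : preact p x - preact p y = inner ℝ p.2.1 (x - y) := by
    simp only [preact, inner_sub_right]; ring
  rw [dist_eq_norm, dist_eq_norm, velocity_eq, velocity_eq, ← sub_smul, norm_smul]
  calc ‖max (preact p x) 0 - max (preact p y) 0‖ * ‖p.1‖
      ≤ ‖p.2.1‖ * ‖x - y‖ * ‖p.1‖ := by
        gcongr
        refine (abs_max_sub_max_le_abs _ _ _).trans ?_
        rw [hpreact]
        exact abs_real_inner_le_norm _ _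
    _ = _ := by push_cast; ring

lemma hasDerivAt_flow_sub (a t : ℝ) (x : E d) :
    HasDerivAt (fun s => flow p (s - a) x) (velocity (flow p (t - a) x) p) t := by
  simpa [Function.comp_def] using!
    (hasDerivAt_flow p (t - a) x).scomp t ((hasDerivAt_id t).sub_const a)

lemma flow_eq_integral_velocity (x : E d) (a t : ℝ) :
    flow p (t - a) x = x + ∫ s in a..t, velocity (flow p (s - a) x) p := by
  rw [intervalIntegral.integral_eq_sub_of_hasDerivAt fun s _ => hasDerivAt_flow_sub p a s x]
  · simp
  · exact ((continuous_velocity p).comp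
      ((continuous_flow_time p x).comp (continuous_sub_right a))).intervalIntegrable _ _

lemma hasDerivWithinAt_of_eq_integral {F : Type*} [NormedAddCommGroup F] [NormedSpace ℝ F]
    [CompleteSpace F] {γ v : ℝ → F} {a b : ℝ} (hv : ContinuousOn v (Icc a b))
    (h : ∀ t ∈ Icc a b, γ t = γ a + ∫ s in a..t, v s) {t : ℝ} (ht : t ∈ Ico a b) :
    HasDerivWithinAt γ (v t) (Ici t) t := by
  have hint : IntervalIntegrable v volume a t :=
    (hv.mono (Icc_subset_Icc_right ht.2.le)).intervalIntegrable_of_Icc ht.1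
  have hmem : Icc a b ∈ 𝓝[Ioi t] t := mem_of_superset (Ioo_mem_nhdsGT ht.2)
    (Ioo_subset_Icc_self.trans (Icc_subset_Icc_left ht.1))
  have hderiv := (intervalIntegral.integral_hasDerivWithinAt_right hint (s := Ici t)
    ⟨Icc a b, hmem, hv.aestronglyMeasurable measurableSet_Icc⟩
    ((hv t ⟨ht.1, ht.2.le⟩).mono_of_mem_nhdsWithin hmem)).const_add (γ a)
  refine hderiv.congr_of_eventuallyEq ?_ (h t ⟨ht.1, ht.2.le⟩)
  filter_upwards [Icc_mem_nhdsGE ht.2] with s hs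
  exact h s ⟨ht.1.trans hs.1, hs.2⟩

lemma eq_flow_of_eq_integral {γ : ℝ → E d} {a b : ℝ} (hγ : ContinuousOn γ (Icc a b))
    (h : ∀ t ∈ Icc a b, γ t = γ a + ∫ s in a..t, velocity (γ s) p) :
    ∀ t ∈ Icc a b, γ t = flow p (t - a) (γ a) := by
  obtain ⟨K, hK⟩ := exists_lipschitzWith_velocity p
  exact ODE_solution_unique (v := fun _ x => velocity x p) (fun _ => hK) hγ
    (fun t ht =>
      hasDerivWithinAt_of_eq_integral ((continuous_velocity p).comp_continuousOn hγ) h ht)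
    ((continuous_flow_time p (γ a)).comp (continuous_sub_right a)).continuousOn
    (fun t _ => (hasDerivAt_flow_sub p a t (γ a)).hasDerivWithinAt) (by simp)

end StageCurve

section IsFlow

variable {p : ℕ → Param d} {τ : ℝ} {n : ℕ}

lemma IsFlow.eq_stageMap (hτ : 0 < τ) (hn : 0 < n) {Φ : ℝ → E d → E d}
    (h : IsFlow (n * τ) (control p τ) Φ) : Φ (n * τ) = stageMap p τ n := by
  ext1 x
  have hinit : Φ 0 x = x := by simpa using h.eq_integral x 0 ⟨le_rfl, by positivity⟩
  have hcont : ∀ k < n, ContinuousOn (fun t => Φ t x) (Icc (k * τ) ((k + 1 : ℕ) * τ)) :=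
    fun k hk => (h.continuousOn x).mono (Icc_subset_Icc (by positivity) (grid_mono hτ hk))
  have hstage := (integral_eq_control_iff p hτ hn (f := fun t => Φ t x)
    (v := fun s q => velocity (Φ s x) q)
    fun k hk => (continuous_velocity (p k)).comp_continuousOn (hcont k hk)).1
    (fun t ht => by simpa only [hinit] using h.eq_integral x t ht)
  have hgrid : ∀ k ≤ n, Φ (k * τ) x = stageMap p τ k x := by
    intro k
    induction k with
    | zero => intro _; simpa [stageMap] using hinit
    | succ k ih =>
      intro hk
      have hflow := eq_flow_of_eq_integral (p k) (hcont k hk) (hstage k hk) _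
        (right_mem_Icc.2 (grid_mono hτ k.le_succ))
      rw [hflow, grid_succ_sub, ih (Nat.le_of_succ_le hk)]
      rfl
  exact hgrid n le_rfl

/-- The flow of `control p τ`, obtained by following the stages one after the other. -/
def stageCurve (p : ℕ → Param d) (τ t : ℝ) (x : E d) : E d :=
  glue τ (fun k s => flow (p k) s (stageMap p τ k x)) t

lemma isFlow_stageCurve (p : ℕ → Param d) (hτ : 0 < τ) (hn : 0 < n) :
    IsFlow (n * τ) (control p τ) (stageCurve p τ) := by
  have hglue : ∀ x k, flow (p k) τ (stageMap p τ k x) =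
      flow (p (k + 1)) 0 (stageMap p τ (k + 1) x) := fun x k => by rw [flow_zero]; rfl
  have hcont : ∀ x, ∀ k < n, ContinuousOn (fun t => stageCurve p τ t x)
      (Icc (k * τ) ((k + 1 : ℕ) * τ)) := fun x k _ =>
    continuousOn_glue hτ (hglue x) (fun k => continuous_flow_time (p k) _) k
  have hinit : ∀ x, stageCurve p τ 0 x = x := fun x => by simp [stageCurve, glue_zero, stageMap]
  refine ⟨fun x => continuousOn_grid hτ hn (hcont x), fun x => ?_⟩
  have hstage := (integral_eq_control_iff p hτ hn (f := fun t => stageCurve p τ t x)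
    (v := fun s q => velocity (stageCurve p τ s x) q)
    fun k hk => (continuous_velocity (p k)).comp_continuousOn (hcont x k hk)).2
  simp only [hinit] at hstage
  refine hstage fun k _ t ht => ?_
  have heq : ∀ s ∈ Icc (k * τ) ((k + 1 : ℕ) * τ),
      stageCurve p τ s x = flow (p k) (s - k * τ) (stageMap p τ k x) :=
    fun s hs => glue_of_mem_Icc hτ (hglue x) hs
  rw [heq t ht, heq _ (left_mem_Icc.2 (grid_mono hτ k.le_succ)), sub_self, flow_zero,
    flow_eq_integral_velocity]
  congr 1
  refine intervalIntegral.integral_congr fun s hs => ?_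
  rw [uIcc_of_le ht.1] at hs
  simp only [heq s ⟨hs.1, hs.2.trans ht.2⟩]

end IsFlow

/-! ### Transport of densities by one stage -/

section Push

variable (p : Param d) {f g : E d → ℝ}

/-- The density of the image of `f dx` under `flow p t`. -/
def push (t : ℝ) (f : E d → ℝ) : E d → ℝ :=
  pullbackDensity (flow p (-t)) (flowLogJac p (-t)) f

@[simp]
lemma push_zero (f : E d → ℝ) : push p 0 f = f := by
  ext1 x
  simp [push, pullbackDensity]

lemma push_add (s t : ℝ) (f : E d → ℝ) : push p (s + t) f = push p s (push p t f) := by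
  ext1 x
  simp only [push, pullbackDensity, neg_add_rev, flow_add, flowLogJac_add, Real.exp_add, mul_assoc]

lemma integrable_push (t : ℝ) (hf : Integrable f) : Integrable (push p t f) :=
  (hasLogJacobian_flow p (-t)).integrable_pullbackDensity hf

lemma push_congr_ae (t : ℝ) (h : f =ᵐ[volume] g) : push p t f =ᵐ[volume] push p t g :=
  (hasLogJacobian_flow p (-t)).pullbackDensity_congr_ae h

lemma integral_mul_push (t : ℝ) (φ f : E d → ℝ) :
    ∫ x, φ x * push p t f x = ∫ y, φ (flow p t y) * f y := by
  rw [← (hasLogJacobian_flow p (-t)).integral_comp fun y => φ (flow p t y) * f y]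
  refine integral_congr_ae (ae_of_all _ fun x => ?_)
  simp only [push, pullbackDensity, flow_flow_neg, smul_eq_mul]
  ring

lemma integral_norm_push_sub (t : ℝ) (f g : E d → ℝ) :
    ∫ x, ‖push p t f x - push p t g x‖ = ∫ x, ‖f x - g x‖ := by
  rw [← (hasLogJacobian_flow p (-t)).integral_comp fun y => ‖f y - g y‖]
  refine integral_congr_ae (ae_of_all _ fun x => ?_)
  simp only [push, pullbackDensity, ← mul_sub, norm_mul, Real.norm_eq_abs, Real.abs_exp,
    smul_eq_mul]

lemma abs_push_le {t C : ℝ} {x : E d} (h : |f (flow p (-t) x)| ≤ C) :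
    |push p t f x| ≤ Real.exp (|rate p| * |t|) * C :=
  abs_pullbackDensity_le (by simpa only [abs_neg] using abs_flowLogJac_le p (-t) x) h

lemma ae_abs_push_le (t : ℝ) {C : ℝ} (h : ∀ᵐ x, |f x| ≤ C) :
    ∀ᵐ x, |push p t f x| ≤ Real.exp (|rate p| * |t|) * C :=
  ((hasLogJacobian_flow p (-t)).ae_comp_iff.2 h).mono fun _ => abs_push_le p

lemma exists_norm_flow_le (t₀ r : ℝ) :
    ∃ B, ∀ t ∈ Icc (t₀ - 1) (t₀ + 1), ∀ x : E d, ‖flow p t x‖ ≤ r → ‖x‖ ≤ B := by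
  have hK : IsCompact ((fun z : ℝ × E d => flow p (-z.1) z.2) ''
      (Icc (t₀ - 1) (t₀ + 1) ×ˢ Metric.closedBall 0 r)) :=
    (isCompact_Icc.prod (isCompact_closedBall _ _)).image
      ((continuous_flow_uncurry p).comp (by fun_prop : Continuous fun z : ℝ × E d => (-z.1, z.2)))
  obtain ⟨B, hB⟩ := hK.isBounded.subset_closedBall 0
  refine ⟨B, fun t ht x hx => ?_⟩
  simpa using hB ⟨(t, flow p t x), ⟨ht, by simpa using hx⟩, flow_neg_flow p t x⟩

end Push

section LieDeriv

variable (p : Param d) {ψ : E d → ℝ} (hψ : ContDiff ℝ 1 ψ)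

/-- The derivative of `ψ` along the perceptron field. -/
def lieDeriv (ψ : E d → ℝ) (x : E d) : ℝ := fderiv ℝ ψ x (velocity x p)

include hψ in
lemma continuous_lieDeriv : Continuous (lieDeriv p ψ) :=
  (hψ.continuous_fderiv one_ne_zero).clm_apply (continuous_velocity p)

include hψ in
lemma exists_abs_lieDeriv_le (hψc : HasCompactSupport ψ) : ∃ C, ∀ x, |lieDeriv p ψ x| ≤ C := by
  have hsupp : HasCompactSupport (lieDeriv p ψ) := (hψc.fderiv (𝕜 := ℝ)).mono fun x hx hzero =>
    hx (by simp [lieDeriv, hzero])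
  exact hsupp.exists_bound_of_continuous (continuous_lieDeriv p hψ)

include hψ in
lemma hasDerivAt_comp_flow (t : ℝ) (x : E d) :
    HasDerivAt (fun s => ψ (flow p s x)) (lieDeriv p ψ (flow p t x)) t :=
  ((hψ.differentiable one_ne_zero _).hasFDerivAt).comp_hasDerivAt t (hasDerivAt_flow p t x)

end LieDeriv

/-! ### Integrals of bounded functions against `L¹` functions -/

section L1

variable {α : Type*} [MeasurableSpace α] {μ : Measure α} {g : α → ℝ} {C : ℝ}

lemma integrable_mul_L1 (hm : AEStronglyMeasurable g μ) (hb : ∀ x, |g x| ≤ C) (R : α →₁[μ] ℝ) :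
    Integrable (fun x => g x * R x) μ :=
  (L1.integrable_coeFn R).bdd_mul hm (ae_of_all _ hb)

lemma abs_integral_mul_L1_le (hb : ∀ x, |g x| ≤ C) (R : α →₁[μ] ℝ) :
    |∫ x, g x * R x ∂μ| ≤ C * ‖R‖ := by
  rw [← Real.norm_eq_abs, L1.norm_eq_integral_norm, ← integral_const_mul]
  refine norm_integral_le_of_norm_le ((L1.integrable_coeFn R).norm.const_mul C)
    (ae_of_all _ fun x => ?_)
  rw [norm_mul]
  exact mul_le_mul_of_nonneg_right (hb x) (norm_nonneg _)

lemma integral_mul_L1_sub (hm : AEStronglyMeasurable g μ) (hb : ∀ x, |g x| ≤ C)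
    (R S : α →₁[μ] ℝ) :
    ∫ x, g x * (R - S) x ∂μ = (∫ x, g x * R x ∂μ) - ∫ x, g x * S x ∂μ := by
  rw [← integral_sub (integrable_mul_L1 hm hb R) (integrable_mul_L1 hm hb S)]
  refine integral_congr_ae ?_
  filter_upwards [Lp.coeFn_sub R S] with x hx
  rw [hx, Pi.sub_apply, mul_sub]

lemma tendsto_integral_mul_L1 {ι : Type*} {l : Filter ι} [l.IsCountablyGenerated]
    {g : ι → α → ℝ} {g₀ : α → ℝ} (hm : ∀ i, AEStronglyMeasurable (g i) μ)
    (hb : ∀ᶠ i in l, ∀ x, |g i x| ≤ C) (hlim : ∀ x, Tendsto (fun i => g i x) l (𝓝 (g₀ x)))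
    {R : ι → (α →₁[μ] ℝ)} {R₀ : α →₁[μ] ℝ} (hR : Tendsto R l (𝓝 R₀)) :
    Tendsto (fun i => ∫ x, g i x * R i x ∂μ) l (𝓝 (∫ x, g₀ x * R₀ x ∂μ)) := by
  have hfixed : Tendsto (fun i => ∫ x, g i x * R₀ x ∂μ) l (𝓝 (∫ x, g₀ x * R₀ x ∂μ)) := by
    refine tendsto_integral_filter_of_dominated_convergence (fun x => C * ‖R₀ x‖)
      (Eventually.of_forall fun i => (hm i).mul (L1.integrable_coeFn R₀).1) ?_
      ((L1.integrable_coeFn R₀).norm.const_mul C) (ae_of_all _ fun x => (hlim x).mul_const _)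
    filter_upwards [hb] with i hi
    refine ae_of_all _ fun x => ?_
    rw [norm_mul]
    exact mul_le_mul_of_nonneg_right (hi x) (norm_nonneg _)
  have hdiff : Tendsto (fun i => ∫ x, g i x * (R i - R₀) x ∂μ) l (𝓝 0) := by
    have hnorm : Tendsto (fun i => C * ‖R i - R₀‖) l (𝓝 0) := by
      simpa using (tendsto_iff_norm_sub_tendsto_zero.1 hR).const_mul C
    exact squeeze_zero_norm' (hb.mono fun i hi => abs_integral_mul_L1_le hi _) hnorm
  refine (zero_add (∫ x, g₀ x * R₀ x ∂μ) ▸ hdiff.add hfixed).congr' ?_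
  filter_upwards [hb] with i hi
  rw [integral_mul_L1_sub (hm i) hi, sub_add_cancel]

lemma continuousOn_integral_mul_L1 {X : Type*} [TopologicalSpace X] [FirstCountableTopology X]
    {s : Set X} {g : X → α → ℝ} (hm : ∀ t, AEStronglyMeasurable (g t) μ)
    (hb : ∀ t x, |g t x| ≤ C) (hg : ∀ x, Continuous fun t => g t x) {R : X → (α →₁[μ] ℝ)}
    (hR : ContinuousOn R s) : ContinuousOn (fun t => ∫ x, g t x * R t x ∂μ) s := fun t ht =>
  tendsto_integral_mul_L1 hm (Eventually.of_forall hb)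
    (fun x => ((hg x).tendsto t).mono_left nhdsWithin_le_nhds) (hR t ht)

end L1

/-! ### Smoothing the rectifier -/

section SoftFlow

variable {δ : ℝ}

/-- A smooth approximation of `u ↦ max u 0`. -/
def softRelu (δ u : ℝ) : ℝ := (u + √(u ^ 2 + δ ^ 2)) / 2

/-- The derivative of `softRelu δ`. -/
def softStep (δ u : ℝ) : ℝ := (1 + u / √(u ^ 2 + δ ^ 2)) / 2

lemma hasDerivAt_softRelu (hδ : δ ≠ 0) (u : ℝ) : HasDerivAt (softRelu δ) (softStep δ u) u := by
  have hpos : 0 < u ^ 2 + δ ^ 2 := by positivity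
  have hsq : HasDerivAt (fun u : ℝ => u ^ 2 + δ ^ 2) (2 * u) u := by
    simpa using! (hasDerivAt_pow 2 u).add_const (δ ^ 2)
  refine (((hasDerivAt_id u).add (hsq.sqrt hpos.ne')).div_const 2).congr_deriv ?_
  rw [softStep, mul_div_mul_left _ _ two_ne_zero]

lemma contDiff_softRelu (hδ : δ ≠ 0) : ContDiff ℝ 1 (softRelu δ) := by
  unfold softRelu
  refine (contDiff_id.add (ContDiff.sqrt (by fun_prop) fun u => ?_)).div_const 2
  positivity

lemma abs_le_sqrt_sq_add_sq (δ u : ℝ) : |u| ≤ √(u ^ 2 + δ ^ 2) :=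
  Real.abs_le_sqrt (le_add_of_nonneg_right (sq_nonneg δ))

lemma sqrt_sq_add_sq_le (δ u : ℝ) : √(u ^ 2 + δ ^ 2) ≤ |u| + |δ| := by
  rw [Real.sqrt_le_left (by positivity), add_sq, sq_abs, sq_abs]
  linarith [mul_nonneg (abs_nonneg u) (abs_nonneg δ)]

lemma abs_softStep_le (δ u : ℝ) : |softStep δ u| ≤ 1 := by
  have hratio : |u / √(u ^ 2 + δ ^ 2)| ≤ 1 := by
    rw [abs_div, abs_of_nonneg (Real.sqrt_nonneg _)]
    exact div_le_one_of_le₀ (abs_le_sqrt_sq_add_sq δ u) (Real.sqrt_nonneg _)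
  rw [abs_le] at hratio
  rw [softStep, abs_le]
  constructor <;> linarith [hratio.1, hratio.2]

lemma abs_softRelu_sub_le (δ u : ℝ) : |softRelu δ u - max u 0| ≤ |δ| := by
  have hmax : max u 0 = (u + |u|) / 2 := by
    rcases le_total u 0 with h | h
    · rw [max_eq_right h, abs_of_nonpos h, add_neg_cancel, zero_div]
    · rw [max_eq_left h, abs_of_nonneg h, add_self_div_two]
  rw [hmax, softRelu, abs_le]
  constructor <;> linarith [abs_nonneg δ, abs_le_sqrt_sq_add_sq δ u, sqrt_sq_add_sq_le δ u]

lemma tendsto_softStep {u : ℝ} (hu : 0 < u) : Tendsto (fun δ => softStep δ u) (𝓝 0) (𝓝 1) := by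
  have hne : ∀ δ : ℝ, √(u ^ 2 + δ ^ 2) ≠ 0 := fun δ => by positivity
  have hcont : Continuous fun δ => softStep δ u := by
    unfold softStep
    exact (continuous_const.add (continuous_const.div (by fun_prop) hne)).div_const 2
  have hzero : softStep 0 u = 1 := by
    simp [softStep, Real.sqrt_sq hu.le, hu.ne']
  exact hzero ▸ hcont.tendsto 0

variable (p : Param d) (t : ℝ)

/-- A smooth approximation of `flow p t`, with `softRelu δ` in place of the rectifier. -/
def softFlow (δ : ℝ) (x : E d) : E d :=
  x + (expPrimitive (rate p) t * softRelu δ (preact p x)) • p.1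

lemma norm_softFlow_sub_flow_le (δ : ℝ) (x : E d) :
    ‖softFlow p t δ x - flow p t x‖ ≤ |expPrimitive (rate p) t| * |δ| * ‖p.1‖ := by
  have hdiff : softFlow p t δ x - flow p t x =
      (expPrimitive (rate p) t * (softRelu δ (preact p x) - max (preact p x) 0)) • p.1 := by
    rw [softFlow, flow]; module
  rw [hdiff, norm_smul, norm_mul, Real.norm_eq_abs, Real.norm_eq_abs]
  exact mul_le_mul_of_nonneg_right (mul_le_mul_of_nonneg_left (abs_softRelu_sub_le _ _)
    (abs_nonneg _)) (norm_nonneg _)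

lemma tendsto_softFlow (x : E d) :
    Tendsto (fun δ => softFlow p t δ x) (𝓝 0) (𝓝 (flow p t x)) := by
  rw [tendsto_iff_norm_sub_tendsto_zero]
  refine squeeze_zero (fun _ => norm_nonneg _) (fun δ => norm_softFlow_sub_flow_le p t δ x) ?_
  have hcont : Continuous fun δ : ℝ => |expPrimitive (rate p) t| * |δ| * ‖p.1‖ := by fun_prop
  simpa using hcont.tendsto 0

lemma contDiff_softFlow (hδ : δ ≠ 0) : ContDiff ℝ 1 (softFlow p t δ) :=
  contDiff_id.add ((contDiff_const.mul ((contDiff_softRelu hδ).comp (contDiff_preact p))).smul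
    contDiff_const)

lemma exists_norm_le_of_softFlow_mem {K : Set (E d)} (hK : IsCompact K) :
    ∃ B, ∀ δ x, |δ| ≤ 1 → softFlow p t δ x ∈ K → ‖x‖ ≤ B := by
  obtain ⟨r, hr⟩ := hK.isBounded.subset_closedBall 0
  obtain ⟨B, hB⟩ := exists_norm_flow_le p t (r + |expPrimitive (rate p) t| * 1 * ‖p.1‖)
  refine ⟨B, fun δ x hδ hx => hB t ⟨by linarith, by linarith⟩ x ?_⟩
  have hsoft : ‖softFlow p t δ x‖ ≤ r := by simpa using hr hx
  calc ‖flow p t x‖ ≤ ‖softFlow p t δ x‖ + ‖softFlow p t δ x - flow p t x‖ :=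
        norm_le_insert _ _
    _ ≤ r + |expPrimitive (rate p) t| * 1 * ‖p.1‖ := by
        gcongr
        refine (norm_softFlow_sub_flow_le p t δ x).trans ?_
        gcongr

variable {ψ : E d → ℝ}

lemma lieDeriv_comp_softFlow (hδ : δ ≠ 0) (hψ : ContDiff ℝ 1 ψ) (x : E d) :
    lieDeriv p (ψ ∘ softFlow p t δ) x = max (preact p x) 0 *
      (1 + expPrimitive (rate p) t * rate p * softStep δ (preact p x)) *
        fderiv ℝ ψ (softFlow p t δ x) p.1 := by
  have hcoeff : HasFDerivAt (fun x => expPrimitive (rate p) t * softRelu δ (preact p x))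
      (expPrimitive (rate p) t • softStep δ (preact p x) • innerSL ℝ p.2.1) x :=
    ((hasDerivAt_softRelu hδ _).comp_hasFDerivAt x (hasFDerivAt_preact p x)).const_mul _
  have hcomp := (hψ.differentiable one_ne_zero (softFlow p t δ x)).hasFDerivAt.comp x
    ((hasFDerivAt_id x).add (hcoeff.smul_const p.1))
  have hrate : inner ℝ p.2.1 p.1 = rate p := rfl
  rw [lieDeriv, hcomp.fderiv, velocity_eq]
  simp only [ContinuousLinearMap.comp_apply, map_smul, map_add, add_apply,
    ContinuousLinearMap.smulRight_apply, smul_apply, innerSL_apply_apply,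
    smul_eq_mul, ContinuousLinearMap.id_apply, hrate]
  ring

lemma exists_abs_lieDeriv_comp_softFlow_le (hψ : ContDiff ℝ 1 ψ) (hψc : HasCompactSupport ψ) :
    ∃ C, ∀ δ, δ ≠ 0 → |δ| ≤ 1 → ∀ x, |lieDeriv p (ψ ∘ softFlow p t δ) x| ≤ C := by
  obtain ⟨D, hD⟩ := (hψc.fderiv (𝕜 := ℝ)).exists_bound_of_continuous
    (hψ.continuous_fderiv one_ne_zero)
  obtain ⟨B, hB⟩ := exists_norm_le_of_softFlow_mem p t hψc.isCompact
  obtain ⟨U, hU⟩ := (isCompact_closedBall (0 : E d) B).exists_bound_of_continuousOn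
    ((continuous_preact p).max continuous_const).continuousOn
  have hD0 : 0 ≤ D := (norm_nonneg _).trans (hD 0)
  refine ⟨|U| * (1 + |expPrimitive (rate p) t| * |rate p| * 1) * (D * ‖p.1‖),
    fun δ hδ hδ1 x => ?_⟩
  rw [lieDeriv_comp_softFlow p t hδ hψ, abs_mul, abs_mul]
  by_cases hx : softFlow p t δ x ∈ tsupport ψ
  · have hstep : |1 + expPrimitive (rate p) t * rate p * softStep δ (preact p x)| ≤
        1 + |expPrimitive (rate p) t| * |rate p| * 1 := by
      refine (abs_add_le _ _).trans ?_
      rw [abs_one, abs_mul, abs_mul]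
      gcongr
      exact abs_softStep_le _ _
    have hfderiv : |fderiv ℝ ψ (softFlow p t δ x) p.1| ≤ D * ‖p.1‖ :=
      ContinuousLinearMap.le_of_opNorm_le _ (hD _) _
    have hpreact : |max (preact p x) 0| ≤ |U| :=
      (hU x (by simpa using hB δ x hδ1 hx)).trans (le_abs_self U)
    gcongr
  · have hzero : fderiv ℝ ψ (softFlow p t δ x) = 0 :=
      image_eq_zero_of_notMem_tsupport fun hx' => hx (tsupport_fderiv_subset ℝ hx')
    rw [hzero, zero_apply, abs_zero, mul_zero]
    positivity

/- The step functions converge only where the preactivation is positive; elsewhere the velocity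
vanishes. -/
lemma tendsto_lieDeriv_comp_softFlow (hψ : ContDiff ℝ 1 ψ) (x : E d) :
    Tendsto (fun δ => lieDeriv p (ψ ∘ softFlow p t δ) x) (𝓝[≠] 0)
      (𝓝 (lieDeriv p ψ (flow p t x))) := by
  have hlimit : lieDeriv p ψ (flow p t x) = max (preact p x) 0 *
      (1 + expPrimitive (rate p) t * rate p * 1) * fderiv ℝ ψ (flow p t x) p.1 := by
    rw [lieDeriv, velocity_eq, max_preact_flow, map_smul, smul_eq_mul, mul_one,
      mul_comm (expPrimitive _ _), mul_expPrimitive]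
    ring
  have hfderiv : Tendsto (fun δ => fderiv ℝ ψ (softFlow p t δ x) p.1) (𝓝 0)
      (𝓝 (fderiv ℝ ψ (flow p t x) p.1)) :=
    (((hψ.continuous_fderiv one_ne_zero).clm_apply continuous_const).tendsto _).comp
      (tendsto_softFlow p t x)
  have hfactor : Tendsto (fun δ => max (preact p x) 0 *
      (1 + expPrimitive (rate p) t * rate p * softStep δ (preact p x))) (𝓝 0)
      (𝓝 (max (preact p x) 0 * (1 + expPrimitive (rate p) t * rate p * 1))) := by
    rcases lt_or_ge 0 (preact p x) with hx | hx
    · exact tendsto_const_nhds.mul (tendsto_const_nhds.add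
        (tendsto_const_nhds.mul (tendsto_softStep hx)))
    · simp [max_eq_right hx]
  rw [hlimit]
  refine ((hfactor.mul hfderiv).mono_left nhdsWithin_le_nhds).congr' ?_
  filter_upwards [self_mem_nhdsWithin] with δ hδ using (lieDeriv_comp_softFlow p t hδ hψ x).symm

end SoftFlow

/-! ### Uniqueness for the continuity equation with a constant parameter -/

lemma hasDerivAt_of_eq_integral {F : Type*} [NormedAddCommGroup F] [NormedSpace ℝ F]
    [CompleteSpace F] {γ v : ℝ → F} {a b : ℝ} (hv : ContinuousOn v (Icc a b))
    (h : ∀ t ∈ Icc a b, γ t = γ a + ∫ s in a..t, v s) {t : ℝ} (ht : t ∈ Ioo a b) :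
    HasDerivAt γ (v t) t := by
  have hmem : Icc a b ∈ 𝓝 t := Icc_mem_nhds ht.1 ht.2
  have hint : IntervalIntegrable v volume a t :=
    (hv.mono (Icc_subset_Icc_right ht.2.le)).intervalIntegrable_of_Icc ht.1.le
  have hderiv := (intervalIntegral.integral_hasDerivAt_right hint
    ⟨Icc a b, hmem, hv.aestronglyMeasurable measurableSet_Icc⟩
    (hv.continuousAt hmem)).const_add (γ a)
  exact hderiv.congr_of_eventuallyEq (mem_of_superset hmem h)

/- Equal partial derivatives make `F` constant along the lines `q + t = const`. -/
lemma eq_of_hasDerivAt_partial_eq {F G : ℝ → ℝ → ℝ} {a b : ℝ}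
    (hF : ContinuousOn ↿F (univ ×ˢ Icc a b)) (hG : ContinuousOn ↿G (univ ×ˢ Icc a b))
    (hF₁ : ∀ q, ∀ t ∈ Ioo a b, HasDerivAt (fun q => F q t) (G q t) q)
    (hF₂ : ∀ q, ∀ t ∈ Ioo a b, HasDerivAt (F q) (G q t) t) {t : ℝ} (ht : t ∈ Icc a b) :
    F (a - t) t = F 0 a := by
  rcases ht.1.eq_or_lt with rfl | hat
  · rw [sub_self]
  have hcont : ContinuousOn (fun s => F (a - s) s) (Icc a t) :=
    hF.comp (f := fun s => (a - s, s)) (by fun_prop) fun s hs => ⟨trivial, hs.1, hs.2.trans ht.2⟩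
  have hderiv : ∀ s ∈ Ioo a t, HasDerivAt (fun s => F (a - s) s) 0 s := by
    intro s hs
    have hs' : s ∈ Ioo a b := ⟨hs.1, hs.2.trans_le ht.2⟩
    have hnhds : ∀ᶠ z : ℝ × ℝ in 𝓝 (a - s, s), z.2 ∈ Ioo a b :=
      continuous_snd.continuousAt.eventually (isOpen_Ioo.mem_nhds hs')
    have hGs : ContinuousAt (fun z : ℝ × ℝ => ContinuousLinearMap.toSpanSingleton ℝ (G z.1 z.2))
        (a - s, s) :=
      (ContinuousLinearMap.toSpanSingletonCLE (𝕜 := ℝ)).continuous.continuousAt.comp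
        (hG.continuousAt (prod_mem_nhds univ_mem (Icc_mem_nhds hs'.1 hs'.2)))
    have hdiff := hasStrictFDerivAt_uncurry_coprod (f := F)
      (f₁ := fun q r => ContinuousLinearMap.toSpanSingleton ℝ (G q r))
      (f₂ := fun q r => ContinuousLinearMap.toSpanSingleton ℝ (G q r))
      (hnhds.mono fun z hz => (hF₁ z.1 z.2 hz).hasFDerivAt)
      (hnhds.mono fun z hz => (hF₂ z.1 z.2 hz).hasFDerivAt) hGs hGs
    have hline : HasDerivAt (fun r : ℝ => (a - r, r)) ((-1 : ℝ), (1 : ℝ)) s :=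
      ((hasDerivAt_id s).const_sub a).prodMk (hasDerivAt_id s)
    exact (hdiff.hasFDerivAt.comp_hasDerivAt (f := fun r => (a - r, r)) s hline).congr_deriv
      (by simp [Function.HasUncurry.uncurry])
  obtain ⟨c, -, hc⟩ := exists_hasDerivAt_eq_slope _ _ hat hcont hderiv
  have hzero := (div_eq_zero_iff.1 hc.symm).resolve_right (sub_pos.2 hat).ne'
  rw [sub_self] at hzero
  exact sub_eq_zero.1 hzero

section Uniqueness

variable {p : Param d} {a b t : ℝ} {R : ℝ → (E d →₁[volume] ℝ)} {ψ : E d → ℝ}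

/-- `R` is continuous in `L¹` and solves `∂ₜR + div (velocity · p R) = 0` on `[a, b]` in the weak
sense; this is `IsSolution` for one stage, without the bound and the initial condition. -/
structure IsStageSolution (p : Param d) (a b : ℝ) (R : ℝ → (E d →₁[volume] ℝ)) : Prop where
  continuousOn : ContinuousOn R (Icc a b)
  weak_eq : ∀ φ : E d → ℝ, ContDiff ℝ 1 φ → HasCompactSupport φ → ∀ t ∈ Icc a b,
    ∫ x, φ x * R t x = (∫ x, φ x * R a x) + ∫ s in a..t, ∫ x, lieDeriv p φ x * R s x

lemma hasDerivAt_integral_comp_flow (p : Param d) {f : E d → ℝ} (hf : Integrable f)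
    (hψ : ContDiff ℝ 1 ψ) (hψc : HasCompactSupport ψ) (q : ℝ) :
    HasDerivAt (fun q => ∫ x, ψ (flow p q x) * f x) (∫ x, lieDeriv p ψ (flow p q x) * f x) q := by
  obtain ⟨C₀, hC₀⟩ := hψc.exists_bound_of_continuous hψ.continuous
  obtain ⟨C, hC⟩ := exists_abs_lieDeriv_le p hψ hψc
  have hm : ∀ q, AEStronglyMeasurable (fun x => ψ (flow p q x)) volume := fun q =>
    (hψ.continuous.comp (continuous_flow p q)).aestronglyMeasurable
  refine (hasDerivAt_integral_of_dominated_loc_of_deriv_le (bound := fun x => C * ‖f x‖)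
    (F' := fun q x => lieDeriv p ψ (flow p q x) * f x) univ_mem
    (Eventually.of_forall fun q => (hm q).mul hf.1)
    (hf.bdd_mul (hm q) (ae_of_all _ fun x => hC₀ _))
    (((continuous_lieDeriv p hψ).comp (continuous_flow p q)).aestronglyMeasurable.mul hf.1)
    (ae_of_all _ fun x q _ => ?_) (hf.norm.const_mul C)
    (ae_of_all _ fun x q _ => (hasDerivAt_comp_flow p hψ q x).mul_const _)).2
  rw [norm_mul]
  exact mul_le_mul_of_nonneg_right (hC _) (norm_nonneg _)

namespace IsStageSolution

lemma congr {R' : ℝ → (E d →₁[volume] ℝ)} (h : IsStageSolution p a b R)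
    (hR : EqOn R' R (Icc a b)) : IsStageSolution p a b R' := by
  refine ⟨h.continuousOn.congr hR, fun φ hφ hφc t ht => ?_⟩
  have hint : ∫ s in a..t, ∫ x, lieDeriv p φ x * R' s x =
      ∫ s in a..t, ∫ x, lieDeriv p φ x * R s x := by
    refine intervalIntegral.integral_congr fun s hs => ?_
    rw [uIcc_of_le ht.1] at hs
    simp only [hR ⟨hs.1, hs.2.trans ht.2⟩]
  rw [hint, hR ht, hR (left_mem_Icc.2 (ht.1.trans ht.2))]
  exact h.weak_eq φ hφ hφc t ht

lemma integral_mul_eq_of_tendsto (h : IsStageSolution p a b R) {φ : ℕ → E d → ℝ} {χ : E d → ℝ}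
    {C₀ C : ℝ} (hφ : ∀ n, ContDiff ℝ 1 (φ n)) (hφc : ∀ n, HasCompactSupport (φ n))
    (hC₀ : ∀ n x, |φ n x| ≤ C₀) (hC : ∀ n x, |lieDeriv p (φ n) x| ≤ C)
    (hψ : ∀ x, Tendsto (fun n => φ n x) atTop (𝓝 (ψ x)))
    (hχ : ∀ x, Tendsto (fun n => lieDeriv p (φ n) x) atTop (𝓝 (χ x))) (ht : t ∈ Icc a b) :
    ∫ x, ψ x * R t x = (∫ x, ψ x * R a x) + ∫ s in a..t, ∫ x, χ x * R s x := by
  have hlie : ∀ n, AEStronglyMeasurable (lieDeriv p (φ n)) volume := fun n =>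
    (continuous_lieDeriv p (hφ n)).aestronglyMeasurable
  have hlim : ∀ s, Tendsto (fun n => ∫ x, φ n x * R s x) atTop (𝓝 (∫ x, ψ x * R s x)) := fun s =>
    tendsto_integral_mul_L1 (fun n => (hφ n).continuous.aestronglyMeasurable)
      (Eventually.of_forall hC₀) hψ tendsto_const_nhds
  have hcont : ContinuousOn R (Icc a t) := h.continuousOn.mono (Icc_subset_Icc_right ht.2)
  have hint : Tendsto (fun n => ∫ s in a..t, ∫ x, lieDeriv p (φ n) x * R s x) atTop
      (𝓝 (∫ s in a..t, ∫ x, χ x * R s x)) := by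
    refine intervalIntegral.tendsto_integral_filter_of_dominated_convergence
      (fun s => C * ‖R s‖) (Eventually.of_forall fun n => ?_)
      (Eventually.of_forall fun n => ae_of_all _ fun s _ => abs_integral_mul_L1_le (hC n) _)
      ((hcont.norm.const_mul C).intervalIntegrable_of_Icc ht.1)
      (ae_of_all _ fun s _ => tendsto_integral_mul_L1 hlie (Eventually.of_forall hC) hχ
        tendsto_const_nhds)
    rw [uIoc_of_le ht.1]
    exact ((continuousOn_integral_mul_L1 (fun _ => hlie n) (fun _ => hC n)
      (fun _ => continuous_const) hcont).mono Ioc_subset_Icc_self).aestronglyMeasurable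
      measurableSet_Ioc
  exact tendsto_nhds_unique (hlim t)
    (((hlim a).add hint).congr fun n => (h.weak_eq (φ n) (hφ n) (hφc n) t ht).symm)

/- `ψ ∘ flow p q` is only Lipschitz, hence not itself an admissible test function. -/
lemma integral_comp_flow_mul_eq (h : IsStageSolution p a b R) (hψ : ContDiff ℝ 1 ψ)
    (hψc : HasCompactSupport ψ) (q : ℝ) (ht : t ∈ Icc a b) :
    ∫ x, ψ (flow p q x) * R t x = (∫ x, ψ (flow p q x) * R a x) +
      ∫ s in a..t, ∫ x, lieDeriv p ψ (flow p q x) * R s x := by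
  set δ : ℕ → ℝ := fun n => 1 / ((n : ℝ) + 1)
  have hδ : ∀ n, δ n ≠ 0 := fun n => by positivity
  have hδ_le : ∀ n, |δ n| ≤ 1 := fun n => by
    rw [abs_of_pos Nat.one_div_pos_of_nat]
    exact div_le_one_of_le₀ (by linarith [n.cast_nonneg (α := ℝ)]) (by positivity)
  have hδ_lim : Tendsto δ atTop (𝓝 0) := tendsto_one_div_add_atTop_nhds_zero_nat
  have hδ_lim' : Tendsto δ atTop (𝓝[≠] 0) :=
    tendsto_nhdsWithin_iff.2 ⟨hδ_lim, Eventually.of_forall hδ⟩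
  obtain ⟨C₀, hC₀⟩ := hψc.exists_bound_of_continuous hψ.continuous
  obtain ⟨C, hC⟩ := exists_abs_lieDeriv_comp_softFlow_le p q hψ hψc
  obtain ⟨B, hB⟩ := exists_norm_le_of_softFlow_mem p q hψc.isCompact
  refine h.integral_mul_eq_of_tendsto (φ := fun n => ψ ∘ softFlow p q (δ n))
    (fun n => hψ.comp (contDiff_softFlow p q (hδ n))) (fun n => ?_) (fun n x => hC₀ _)
    (fun n => hC (δ n) (hδ n) (hδ_le n))
    (fun x => (hψ.continuous.tendsto _).comp ((tendsto_softFlow p q x).comp hδ_lim))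
    (fun x => (tendsto_lieDeriv_comp_softFlow p q hψ x).comp hδ_lim') ht
  refine HasCompactSupport.of_support_subset_isCompact (isCompact_closedBall (0 : E d) B)
    fun x hx => ?_
  simpa using hB (δ n) x (hδ_le n) (subset_tsupport _ hx)

/- In `F q t = ∫ ψ (flow p q x) R t x dx`, differentiating in `q` or in `t` gives the same result:
the first by the chain rule, the second by the equation. -/
lemma integral_comp_flow_sub_mul_eq (h : IsStageSolution p a b R) (hψ : ContDiff ℝ 1 ψ)
    (hψc : HasCompactSupport ψ) (ht : t ∈ Icc a b) :
    ∫ x, ψ (flow p (a - t) x) * R t x = ∫ x, ψ x * R a x := by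
  have hcont : ∀ {χ : E d → ℝ}, Continuous χ → (∃ C, ∀ x, |χ x| ≤ C) →
      ContinuousOn ↿(fun q t => ∫ x, χ (flow p q x) * R t x) (univ ×ˢ Icc a b) :=
    fun {χ} hχ ⟨_, hC⟩ => continuousOn_integral_mul_L1
      (g := fun z : ℝ × ℝ => fun x => χ (flow p z.1 x)) (R := fun z => R z.2)
      (fun z => (hχ.comp (continuous_flow p z.1)).aestronglyMeasurable) (fun _ _ => hC _)
      (fun x => hχ.comp ((continuous_flow_time p x).comp continuous_fst))
      (h.continuousOn.comp continuousOn_snd fun _ hz => hz.2)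
  have hlie := hcont (continuous_lieDeriv p hψ) (exists_abs_lieDeriv_le p hψ hψc)
  have hconst := eq_of_hasDerivAt_partial_eq
    (F := fun q t => ∫ x, ψ (flow p q x) * R t x)
    (G := fun q t => ∫ x, lieDeriv p ψ (flow p q x) * R t x)
    (hcont hψ.continuous (hψc.exists_bound_of_continuous hψ.continuous)) hlie
    (fun q s _ => hasDerivAt_integral_comp_flow p (L1.integrable_coeFn _) hψ hψc q)
    (fun q s hs => hasDerivAt_of_eq_integral
      (v := fun s => ∫ x, lieDeriv p ψ (flow p q x) * R s x)
      (hlie.comp (f := fun s => (q, s)) (by fun_prop) fun s hs => ⟨trivial, hs⟩)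
      (fun s hs => h.integral_comp_flow_mul_eq hψ hψc q hs) hs) ht
  simpa only [flow_zero] using hconst

lemma eq_push (h : IsStageSolution p a b R) (ht : t ∈ Icc a b) :
    R t =ᵐ[volume] push p (t - a) (R a) := by
  have hint : Integrable (push p (a - t) (R t)) := integrable_push _ _ (L1.integrable_coeFn _)
  have hsub : push p (a - t) (R t) - ⇑(R a) =ᵐ[volume] 0 := by
    refine ae_eq_zero_of_integral_contDiff_smul_eq_zero
      (hint.sub (L1.integrable_coeFn (R a))).locallyIntegrable fun ψ hψ hψc => ?_
    have hψ₁ : ContDiff ℝ 1 ψ := hψ.of_le (by exact_mod_cast le_top)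
    obtain ⟨C₀, hC₀⟩ := hψc.exists_bound_of_continuous hψ₁.continuous
    have hm : AEStronglyMeasurable ψ volume := hψ₁.continuous.aestronglyMeasurable
    simp only [Pi.sub_apply, smul_eq_mul, mul_sub]
    rw [integral_sub (hint.bdd_mul hm (ae_of_all _ hC₀)) (integrable_mul_L1 hm hC₀ _),
      integral_mul_push, h.integral_comp_flow_sub_mul_eq hψ₁ hψc ht, sub_self]
  have hback : push p (a - t) (R t) =ᵐ[volume] R a := (sub_ae_eq_zero _ _).1 hsub
  have hpush := push_congr_ae p (t - a) hback
  rwa [← push_add, sub_add_sub_cancel, sub_self, push_zero] at hpush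

end IsStageSolution

end Uniqueness

/-! ### Existence for the continuity equation with a constant parameter -/

section Existence

variable (p : Param d) {f g : E d → ℝ}

/-- `push p t f` as an element of `L¹`. -/
def pushL1 (t : ℝ) (hf : Integrable f) : E d →₁[volume] ℝ :=
  (integrable_push p t hf).toL1 (push p t f)

lemma coeFn_pushL1 (t : ℝ) (hf : Integrable f) : pushL1 p t hf =ᵐ[volume] push p t f :=
  Integrable.coeFn_toL1 _

lemma integral_mul_pushL1 (t : ℝ) (hf : Integrable f) (φ : E d → ℝ) :
    ∫ x, φ x * pushL1 p t hf x = ∫ y, φ (flow p t y) * f y := by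
  rw [← integral_mul_push]
  refine integral_congr_ae ?_
  filter_upwards [coeFn_pushL1 p t hf] with x hx
  rw [hx]

lemma dist_pushL1 (s t : ℝ) (hf : Integrable f) (hg : Integrable g) :
    dist (pushL1 p s hf) (pushL1 p t hg) = ∫ x, ‖push p s f x - push p t g x‖ := by
  rw [dist_eq_norm, pushL1, pushL1, ← Integrable.toL1_sub, L1.norm_of_fun_eq_integral_norm]
  rfl

lemma exists_norm_push_le_indicator (hf : Continuous f) (hfc : HasCompactSupport f) (t₀ : ℝ) :
    ∃ B D, ∀ t ∈ Icc (t₀ - 1) (t₀ + 1), ∀ x,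
      ‖push p t f x‖ ≤ (Metric.closedBall (0 : E d) B).indicator (fun _ => D) x := by
  obtain ⟨C, hC⟩ := hfc.exists_bound_of_continuous hf
  obtain ⟨r, hr⟩ := hfc.isCompact.isBounded.subset_closedBall 0
  obtain ⟨B, hB⟩ := exists_norm_flow_le p (-t₀) r
  have hC0 : 0 ≤ C := (norm_nonneg _).trans (hC 0)
  refine ⟨B, Real.exp (|rate p| * (|t₀| + 1)) * C, fun t ht x => ?_⟩
  by_cases hx : ‖flow p (-t) x‖ ≤ r
  · have hmem : x ∈ Metric.closedBall (0 : E d) B := by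
      simpa using hB (-t) ⟨by linarith [ht.2], by linarith [ht.1]⟩ x hx
    have htime : |t| ≤ |t₀| + 1 := by
      rw [abs_le]
      constructor <;> linarith [ht.1, ht.2, le_abs_self t₀, neg_abs_le t₀]
    rw [indicator_of_mem hmem]
    refine (abs_push_le p (hC _)).trans ?_
    gcongr
  · have hzero : f (flow p (-t) x) = 0 := image_eq_zero_of_notMem_tsupport fun h =>
      hx (by simpa using hr h)
    rw [push, pullbackDensity, hzero, mul_zero, norm_zero]
    exact indicator_nonneg (fun _ _ => by positivity) _

lemma continuous_push_time (hf : Continuous f) (x : E d) : Continuous fun t => push p t f x :=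
  ((continuous_flowLogJac_time p x).comp continuous_neg).rexp.mul
    (hf.comp ((continuous_flow_time p x).comp continuous_neg))

lemma continuous_pushL1_of_hasCompactSupport (hf : Integrable f) (hfc : Continuous f)
    (hfs : HasCompactSupport f) : Continuous fun t => pushL1 p t hf := by
  refine continuous_iff_continuousAt.2 fun t₀ => ?_
  rw [ContinuousAt, tendsto_iff_dist_tendsto_zero]
  simp only [dist_pushL1]
  obtain ⟨B, D, hBD⟩ := exists_norm_push_le_indicator p hfc hfs t₀
  have hnhds : Icc (t₀ - 1) (t₀ + 1) ∈ 𝓝 t₀ := Icc_mem_nhds (by linarith) (by linarith)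
  have hbound : Integrable ((Metric.closedBall (0 : E d) B).indicator fun _ => D) :=
    (integrable_indicator_iff measurableSet_closedBall).2
      (integrableOn_const measure_closedBall_lt_top.ne)
  have hlim : ∀ x, Tendsto (fun t => ‖push p t f x - push p t₀ f x‖) (𝓝 t₀) (𝓝 0) := fun x =>
    tendsto_iff_norm_sub_tendsto_zero.1 ((continuous_push_time p hfc x).tendsto t₀)
  rw [← integral_zero (E d) ℝ]
  refine tendsto_integral_filter_of_dominated_convergence _ (Eventually.of_forall fun t =>
    ((integrable_push p t hf).1.sub (integrable_push p t₀ hf).1).norm) ?_ (hbound.add hbound)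
    (ae_of_all _ hlim)
  filter_upwards [hnhds] with t ht
  refine ae_of_all _ fun x => ?_
  rw [norm_norm]
  exact (norm_sub_le _ _).trans (add_le_add (hBD t ht x) (hBD t₀ (mem_of_mem_nhds hnhds) x))

/- Pushing forward is an `L¹` isometry, so continuity passes to the closure. -/
lemma continuous_pushL1 (hf : Integrable f) : Continuous fun t => pushL1 p t hf := by
  refine continuous_iff_continuousAt.2 fun t₀ => Metric.tendsto_nhds.2 fun ε hε => ?_
  obtain ⟨g, hgs, hfg, hgc, hg⟩ := hf.exists_hasCompactSupport_integral_sub_le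
    (by positivity : 0 < ε / 3)
  have happrox : ∀ t, dist (pushL1 p t hf) (pushL1 p t hg) ≤ ε / 3 := fun t => by
    rwa [dist_pushL1, integral_norm_push_sub]
  have hgt₀ := Metric.tendsto_nhds.1
    ((continuous_pushL1_of_hasCompactSupport p hg hgc hgs).tendsto t₀) (ε / 3) (by positivity)
  filter_upwards [hgt₀] with t ht
  have htriangle := dist_triangle4_right (pushL1 p t hf) (pushL1 p t₀ hf) (pushL1 p t hg)
    (pushL1 p t₀ hg)
  linarith [happrox t, happrox t₀]

lemma isStageSolution_pushL1 (a b : ℝ) (hf : Integrable f) :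
    IsStageSolution p a b fun t => pushL1 p (t - a) hf := by
  have hcont : Continuous fun t => pushL1 p (t - a) hf :=
    (continuous_pushL1 p hf).comp (continuous_sub_right a)
  refine ⟨hcont.continuousOn, fun φ hφ hφc t ht => ?_⟩
  obtain ⟨C, hC⟩ := exists_abs_lieDeriv_le p hφ hφc
  have hderiv : ∀ s, HasDerivAt (fun s => ∫ x, φ x * pushL1 p (s - a) hf x)
      (∫ x, lieDeriv p φ x * pushL1 p (s - a) hf x) s := fun s => by
    simp only [integral_mul_pushL1]
    exact (hasDerivAt_integral_comp_flow p hf hφ hφc (s - a)).comp_sub_const s a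
  have hint : ContinuousOn (fun s => ∫ x, lieDeriv p φ x * pushL1 p (s - a) hf x) (Icc a t) :=
    continuousOn_integral_mul_L1 (fun _ => (continuous_lieDeriv p hφ).aestronglyMeasurable)
      (fun _ => hC) (fun _ => continuous_const) hcont.continuousOn
  rw [intervalIntegral.integral_eq_sub_of_hasDerivAt (fun s _ => hderiv s)
    (hint.intervalIntegrable_of_Icc ht.1), add_sub_cancel]

end Existence

/-! ### The continuity equation for piecewise constant controls -/

/-- The density obtained from `f` by following the first `n` stages for time `τ` each. -/
def stageDensity (p : ℕ → Param d) (τ : ℝ) (f : E d → ℝ) (n : ℕ) : E d → ℝ :=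
  pullbackDensity (stageInv p τ n) (stageInvLogJac p τ n) f

section Stages

variable (p : ℕ → Param d) {τ : ℝ} {n : ℕ} {f : E d → ℝ}

lemma stageDensity_zero (τ : ℝ) (f : E d → ℝ) : stageDensity p τ f 0 = f := by
  ext1 x
  simp [stageDensity, pullbackDensity, stageInv, stageInvLogJac]

lemma stageDensity_succ (τ : ℝ) (f : E d → ℝ) (n : ℕ) :
    stageDensity p τ f (n + 1) = push (p n) τ (stageDensity p τ f n) :=
  pullbackDensity_comp _ _ _ _ f

lemma integrable_stageDensity (τ : ℝ) (hf : Integrable f) (n : ℕ) :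
    Integrable (stageDensity p τ f n) :=
  (hasLogJacobian_stageInv p τ n).integrable_pullbackDensity hf

lemma exists_ae_abs_stageDensity_le (τ : ℝ) (hf : ∃ C, ∀ᵐ x, |f x| ≤ C) (n : ℕ) :
    ∃ C, ∀ᵐ x, |stageDensity p τ f n x| ≤ C := by
  induction n with
  | zero => rwa [stageDensity_zero]
  | succ n ih =>
    obtain ⟨C, hC⟩ := ih
    rw [stageDensity_succ]
    exact ⟨_, ae_abs_push_le (p n) τ hC⟩

lemma weak_eq_control_iff (hτ : 0 < τ) (hn : 0 < n) {R : ℝ → (E d →₁[volume] ℝ)}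
    (hR : ∀ k < n, ContinuousOn R (Icc (k * τ) ((k + 1 : ℕ) * τ))) {φ : E d → ℝ}
    (hφ : ContDiff ℝ 1 φ) (hφc : HasCompactSupport φ) :
    (∀ t ∈ Icc 0 (n * τ), ∫ x, φ x * R t x = (∫ x, φ x * R 0 x) +
        ∫ s in (0 : ℝ)..t, ∫ x, fderiv ℝ φ x (velocity x (control p τ s)) * R s x) ↔
      ∀ k < n, ∀ t ∈ Icc (k * τ) ((k + 1 : ℕ) * τ), ∫ x, φ x * R t x =
        (∫ x, φ x * R (k * τ) x) + ∫ s in (k * τ)..t, ∫ x, lieDeriv (p k) φ x * R s x :=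
  integral_eq_control_iff p hτ hn (f := fun t => ∫ x, φ x * R t x)
    (v := fun s q => ∫ x, lieDeriv q φ x * R s x) fun k hk =>
      have ⟨_, hC⟩ := exists_abs_lieDeriv_le (p k) hφ hφc
      continuousOn_integral_mul_L1 (fun _ => (continuous_lieDeriv (p k) hφ).aestronglyMeasurable)
        (fun _ => hC) (fun _ => continuous_const) (hR k hk)

lemma integral_mul_congr_ae {α : Type*} [MeasurableSpace α] {μ : Measure α} {f g : α → ℝ}
    (φ : α → ℝ) (h : f =ᵐ[μ] g) : ∫ x, φ x * f x ∂μ = ∫ x, φ x * g x ∂μ :=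
  integral_congr_ae (h.mono fun _ => congrArg _)

variable {p}

lemma IsSolution.isStageSolution (hτ : 0 < τ) {R : ℝ → (E d →₁[volume] ℝ)}
    (h : IsSolution (n * τ) (control p τ) f R) {k : ℕ} (hk : k < n) :
    IsStageSolution (p k) (k * τ) ((k + 1 : ℕ) * τ) R := by
  have hcont : ∀ k < n, ContinuousOn R (Icc (k * τ) ((k + 1 : ℕ) * τ)) := fun k hk =>
    h.continuousOn.mono (Icc_subset_Icc (by positivity) (grid_mono hτ hk))
  refine ⟨hcont k hk, fun φ hφ hφc => ?_⟩
  refine (weak_eq_control_iff p hτ (k.zero_le.trans_lt hk) hcont hφ hφc).1 ?_ k hk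
  rw [integral_mul_congr_ae φ h.initial]
  exact h.weak_eq φ hφ hφc

lemma IsSolution.eq_stageDensity (hτ : 0 < τ) {R : ℝ → (E d →₁[volume] ℝ)}
    (h : IsSolution (n * τ) (control p τ) f R) : R (n * τ) =ᵐ[volume] stageDensity p τ f n := by
  have hgrid : ∀ k ≤ n, R (k * τ) =ᵐ[volume] stageDensity p τ f k := by
    intro k
    induction k with
    | zero => intro _; simpa [stageDensity_zero] using h.initial
    | succ k ih =>
      intro hk
      have hpush := (h.isStageSolution hτ hk).eq_push (right_mem_Icc.2 (grid_mono hτ k.le_succ))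
      rw [grid_succ_sub] at hpush
      rw [stageDensity_succ]
      exact hpush.trans (push_congr_ae (p k) τ (ih (Nat.le_of_succ_le hk)))
  exact hgrid n le_rfl

variable (p)

/-- The solution of the continuity equation for `control p τ` with initial density `f`, obtained by
following the stages one after the other. -/
def stageSolution (τ : ℝ) (hf : Integrable f) : ℝ → E d →₁[volume] ℝ :=
  glue τ fun k s => pushL1 (p k) s (integrable_stageDensity p τ hf k)

lemma pushL1_stageDensity_succ (τ : ℝ) (hf : Integrable f) (k : ℕ) :
    pushL1 (p k) τ (integrable_stageDensity p τ hf k) =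
      pushL1 (p (k + 1)) 0 (integrable_stageDensity p τ hf (k + 1)) :=
  (Integrable.toL1_eq_toL1_iff _ _ _ _).2 (by rw [push_zero, stageDensity_succ])

lemma stageSolution_of_mem_Icc (hτ : 0 < τ) (hf : Integrable f) {k : ℕ} {t : ℝ}
    (ht : t ∈ Icc (k * τ) ((k + 1 : ℕ) * τ)) :
    stageSolution p τ hf t = pushL1 (p k) (t - k * τ) (integrable_stageDensity p τ hf k) :=
  glue_of_mem_Icc hτ (pushL1_stageDensity_succ p τ hf) ht

lemma stageSolution_zero (τ : ℝ) (hf : Integrable f) : stageSolution p τ hf 0 =ᵐ[volume] f := by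
  rw [stageSolution, glue_zero]
  refine (coeFn_pushL1 _ _ _).trans ?_
  rw [push_zero, stageDensity_zero]

lemma isStageSolution_stageSolution (hτ : 0 < τ) (hf : Integrable f) (k : ℕ) :
    IsStageSolution (p k) (k * τ) ((k + 1 : ℕ) * τ) (stageSolution p τ hf) :=
  (isStageSolution_pushL1 (p k) (k * τ) ((k + 1 : ℕ) * τ) (integrable_stageDensity p τ hf k)).congr
    fun _ => stageSolution_of_mem_Icc p hτ hf

lemma exists_ae_abs_stageSolution_le (hτ : 0 < τ) (hn : 0 < n) (hf : Integrable f)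
    (hb : ∃ C, ∀ᵐ x, |f x| ≤ C) :
    ∃ C, ∀ t ∈ Icc 0 (n * τ), ∀ᵐ x, |stageSolution p τ hf t x| ≤ C := by
  choose C hC using exists_ae_abs_stageDensity_le p τ hb
  have hbound : ∀ k, 0 ≤ Real.exp (|rate (p k)| * τ) * |C k| := fun k => by positivity
  refine ⟨∑ k ∈ Finset.range n, Real.exp (|rate (p k)| * τ) * |C k|, fun t ht => ?_⟩
  obtain ⟨k, hk, hkt⟩ := exists_mem_grid hn ht
  have htime : |t - k * τ| ≤ τ := by
    rw [abs_of_nonneg (sub_nonneg.2 hkt.1)]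
    exact (sub_le_sub_right hkt.2 _).trans_eq (grid_succ_sub τ k)
  rw [stageSolution_of_mem_Icc p hτ hf hkt]
  filter_upwards [coeFn_pushL1 (p k) (t - k * τ) (integrable_stageDensity p τ hf k),
    ae_abs_push_le (p k) (t - k * τ) ((hC k).mono fun _ h => h.trans (le_abs_self _))]
    with x hx hle
  rw [hx]
  calc |push (p k) (t - k * τ) (stageDensity p τ f k) x|
      ≤ Real.exp (|rate (p k)| * |t - k * τ|) * |C k| := hle
    _ ≤ Real.exp (|rate (p k)| * τ) * |C k| := by gcongr
    _ ≤ ∑ k ∈ Finset.range n, Real.exp (|rate (p k)| * τ) * |C k| :=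
      Finset.single_le_sum (f := fun k => Real.exp (|rate (p k)| * τ) * |C k|)
        (fun k _ => hbound k) (Finset.mem_range.2 hk)

lemma isSolution_stageSolution (hτ : 0 < τ) (hn : 0 < n) (hf : Integrable f)
    (hb : ∃ C, ∀ᵐ x, |f x| ≤ C) :
    IsSolution (n * τ) (control p τ) f (stageSolution p τ hf) := by
  have hstage := isStageSolution_stageSolution p hτ hf
  have hcont := fun k (_ : k < n) => (hstage k).continuousOn
  refine ⟨continuousOn_grid hτ hn hcont, exists_ae_abs_stageSolution_le p hτ hn hf hb,
    stageSolution_zero p τ hf, fun φ hφ hφc => ?_⟩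
  rw [← integral_mul_congr_ae φ (stageSolution_zero p τ hf)]
  exact (weak_eq_control_iff p hτ hn hcont hφ hφc).2 fun k _ => (hstage k).weak_eq φ hφ hφc

end Stages

/-! ### The Kullback-Leibler divergence of densities -/

/-- `r` is positive almost everywhere and the Kullback-Leibler divergence `∫ ρ log (ρ / r)` of `ρ`
from `r` is a convergent integral of value at most `ε`. -/
structure IsDivergenceLE {α : Type*} [MeasurableSpace α] (μ : Measure α) (ρ r : α → ℝ) (ε : ℝ) :
    Prop where
  pos : ∀ᵐ x ∂μ, 0 < r x
  integrable : Integrable (fun x => ρ x * Real.log (ρ x / r x)) μ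
  integral_le : ∫ x, ρ x * Real.log (ρ x / r x) ∂μ ≤ ε

section Divergence

variable {α : Type*} [MeasurableSpace α] {μ : Measure α} {ρ r r' : α → ℝ} {ε : ℝ}

lemma IsDivergenceLE.congr_ae (h : IsDivergenceLE μ ρ r ε) (hr : r' =ᵐ[μ] r) :
    IsDivergenceLE μ ρ r' ε := by
  have hlog : (fun x => ρ x * Real.log (ρ x / r' x)) =ᵐ[μ] fun x => ρ x * Real.log (ρ x / r x) :=
    hr.mono fun x hx => by simp only [hx]
  refine ⟨?_, h.integrable.congr hlog.symm, (integral_congr_ae hlog).trans_le h.integral_le⟩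
  filter_upwards [hr, h.pos] with x hx hpos
  rwa [hx]

lemma integrable_withDensity_ofReal_iff (hρ : AEMeasurable ρ μ) (hρ₀ : ∀ x, 0 ≤ ρ x) {g : α → ℝ} :
    Integrable g (μ.withDensity fun x => ENNReal.ofReal (ρ x)) ↔
      Integrable (fun x => ρ x * g x) μ := by
  rw [integrable_withDensity_iff_integrable_smul₀' hρ.ennreal_ofReal
    (ae_of_all _ fun _ => ENNReal.ofReal_lt_top)]
  simp only [ENNReal.toReal_ofReal (hρ₀ _), smul_eq_mul]

lemma integral_withDensity_ofReal (hρ : AEMeasurable ρ μ) (hρ₀ : ∀ x, 0 ≤ ρ x) (g : α → ℝ) :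
    ∫ x, g x ∂μ.withDensity (fun x => ENNReal.ofReal (ρ x)) = ∫ x, ρ x * g x ∂μ := by
  rw [integral_withDensity_eq_integral_toReal_smul₀ hρ.ennreal_ofReal
    (ae_of_all _ fun _ => ENNReal.ofReal_lt_top)]
  simp only [ENNReal.toReal_ofReal (hρ₀ _), smul_eq_mul]

variable [SigmaFinite μ]

lemma llr_withDensity_ofReal (hρ : AEMeasurable ρ μ) (hr : AEMeasurable r μ) (hρ₀ : ∀ x, 0 ≤ ρ x)
    (hpos : ∀ᵐ x ∂μ, 0 < r x) :
    llr (μ.withDensity fun x => ENNReal.ofReal (ρ x)) (μ.withDensity fun x => ENNReal.ofReal (r x))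
      =ᵐ[μ] fun x => Real.log (ρ x / r x) := by
  have hne : ∀ᵐ x ∂μ, ENNReal.ofReal (r x) ≠ 0 := hpos.mono fun x hx => by simpa using hx
  filter_upwards [Measure.rnDeriv_withDensity_right (μ.withDensity fun x => ENNReal.ofReal (ρ x)) μ
      hr.ennreal_ofReal hne (ae_of_all _ fun _ => ENNReal.ofReal_ne_top),
    Measure.rnDeriv_withDensity₀ μ hρ.ennreal_ofReal, hpos] with x hright hleft hx
  rw [llr, hright, hleft, ENNReal.toReal_mul, ENNReal.toReal_inv, ENNReal.toReal_ofReal hx.le,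
    ENNReal.toReal_ofReal (hρ₀ x), div_eq_inv_mul]

lemma IsDivergenceLE.klDiv_le (h : IsDivergenceLE μ ρ r ε) (hρ : AEMeasurable ρ μ)
    (hr : AEMeasurable r μ) (hρ₀ : ∀ x, 0 ≤ ρ x)
    [IsProbabilityMeasure (μ.withDensity fun x => ENNReal.ofReal (ρ x))]
    [IsProbabilityMeasure (μ.withDensity fun x => ENNReal.ofReal (r x))] :
    InformationTheory.klDiv (μ.withDensity fun x => ENNReal.ofReal (ρ x))
      (μ.withDensity fun x => ENNReal.ofReal (r x)) ≤ ENNReal.ofReal ε := by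
  set μρ := μ.withDensity fun x => ENNReal.ofReal (ρ x)
  have hac : μρ ≪ μ := withDensity_absolutelyContinuous _ _
  have hac' : μρ ≪ μ.withDensity fun x => ENNReal.ofReal (r x) :=
    hac.trans (withDensity_absolutelyContinuous' hr.ennreal_ofReal
      (h.pos.mono fun x hx => by simpa using hx))
  have hllr := hac.ae_eq (llr_withDensity_ofReal hρ hr hρ₀ h.pos)
  have hint := ((integrable_withDensity_ofReal_iff hρ hρ₀).2 h.integrable).congr hllr.symm
  rw [InformationTheory.klDiv_of_ac_of_integrable hac' hint, probReal_univ, probReal_univ,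
    add_sub_cancel_right, integral_congr_ae hllr, integral_withDensity_ofReal hρ hρ₀]
  exact ENNReal.ofReal_le_ofReal h.integral_le

end Divergence

lemma IsProbDensity.isProbabilityMeasure {ρ : E d → ℝ} (hρ : IsProbDensity ρ) :
    IsProbabilityMeasure (densityMeasure ρ) := by
  refine ⟨?_⟩
  rw [densityMeasure, withDensity_apply _ MeasurableSet.univ, Measure.restrict_univ,
    ← ofReal_integral_eq_lintegral_ofReal hρ.integrable (ae_of_all _ hρ.nonneg),
    hρ.integral_eq_one, ENNReal.ofReal_one]

/-! ### Approximation by piecewise constant controls -/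

section Approximation

lemma map_densityMeasure_stageMap (p : ℕ → Param d) (τ : ℝ) (n : ℕ) (f : E d → ℝ) :
    (densityMeasure f).map (stageMap p τ n) = densityMeasure (stageDensity p τ f n) := by
  have hinv := hasLogJacobian_stageInv p τ n
  have hid : stageMap p τ n ∘ stageInv p τ n = id := funext (stageMap_stageInv p τ n)
  rw [densityMeasure, ← hinv.map_withDensity_pullbackDensity f, Measure.map_map
    (continuous_stageMap p τ n).measurable hinv.measurableEmbedding.measurable, hid, Measure.map_id]
  rfl

lemma mul_log_div_pullbackDensity_gaussDensity (ρ : E d → ℝ) (Ψ : E d → E d) (ℓ : E d → ℝ)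
    (x : E d) :
    ρ x * Real.log (ρ x / pullbackDensity Ψ ℓ gaussDensity x) = divIntegrand ρ Ψ ℓ x := by
  have hpos : 0 < gaussDensity (Ψ x) * Real.exp (ℓ x) :=
    mul_pos (gaussDensity_pos _) (Real.exp_pos _)
  rcases eq_or_ne (ρ x) 0 with h | h
  · simp [divIntegrand, h]
  · rw [divIntegrand, pullbackDensity, mul_comm (Real.exp _), Real.log_div h hpos.ne',
      log_gaussDensity_mul_exp, mul_sub]

lemma exists_reachable_isDivergenceLE {ρ : E d → ℝ} (hρ : IsProbDensity ρ)
    (hlog : Integrable fun x => ρ x * Real.log (ρ x)) (hmoment : Integrable fun x => ρ x * ‖x‖ ^ 2)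
    {ε : ℝ} (hε : 0 < ε) :
    ∃ Ψ ℓ, Reachable Ψ ℓ ∧ IsDivergenceLE volume ρ (pullbackDensity Ψ ℓ gaussDensity) ε := by
  obtain ⟨Ψ, ℓ, hΨ, hint, hle⟩ := exists_reachable_integral_divIntegrand_le hρ hlog hmoment hε
  refine ⟨Ψ, ℓ, hΨ, ae_of_all _ fun x => mul_pos (Real.exp_pos _) (gaussDensity_pos _), ?_, ?_⟩ <;>
    simpa only [mul_log_div_pullbackDensity_gaussDensity]

lemma exists_stageDensity_ae_eq {μ : Measure (E d)} [SigmaFinite μ] {A Ψ : E d → E d}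
    {ℓA ℓ : E d → ℝ} (hA : Reachable A ℓA) (hμ : (densityMeasure gaussDensity).map A = μ)
    (hΨ : Reachable Ψ ℓ) {T : ℝ} (hT : 0 < T) :
    ∃ (n : ℕ) (τ : ℝ) (p : ℕ → Param d), 0 < n ∧ 0 < τ ∧ n * τ = T ∧
      stageDensity p τ (lebesgueDensity μ) n =ᵐ[volume] pullbackDensity Ψ ℓ gaussDensity := by
  obtain ⟨n, hn, hstage⟩ := (hA.comp hΨ).exists_stageInv_eq
  have hn' : (0 : ℝ) < n := Nat.cast_pos.2 hn
  obtain ⟨p, hinv, hlog⟩ := hstage (T / n) (by positivity)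
  refine ⟨n, T / n, p, hn, by positivity, mul_div_cancel₀ T hn'.ne', ?_⟩
  rw [stageDensity, hinv, hlog, pullbackDensity_comp]
  exact hΨ.hasLogJacobian.pullbackDensity_congr_ae (hA.pullbackDensity_lebesgueDensity hμ)

lemma IsFlow.klDiv_map_le {p : ℕ → Param d} {τ : ℝ} {n : ℕ} (hτ : 0 < τ) (hn : 0 < n)
    {Φ : ℝ → E d → E d} (hΦ : IsFlow (n * τ) (control p τ) Φ) {ρ : E d → ℝ}
    (hρ : IsProbDensity ρ) {μ : Measure (E d)} [IsProbabilityMeasure μ] (hμ : μ ≪ volume) {ε : ℝ}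
    (h : IsDivergenceLE volume ρ (stageDensity p τ (lebesgueDensity μ) n) ε) :
    InformationTheory.klDiv (densityMeasure ρ) (μ.map (Φ (n * τ))) ≤ ENNReal.ofReal ε := by
  have hmap : μ.map (Φ (n * τ)) = densityMeasure (stageDensity p τ (lebesgueDensity μ) n) := by
    rw [hΦ.eq_stageMap hτ hn, ← map_densityMeasure_stageMap, densityMeasure_lebesgueDensity hμ]
  have hprob := hρ.isProbabilityMeasure
  have hprob' : IsProbabilityMeasure (densityMeasure (stageDensity p τ (lebesgueDensity μ) n)) := by
    rw [← hmap, hΦ.eq_stageMap hτ hn]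
    exact Measure.isProbabilityMeasure_map (continuous_stageMap p τ n).aemeasurable
  rw [densityMeasure] at hprob hprob'
  rw [hmap]
  exact h.klDiv_le hρ.integrable.1.aemeasurable
    (integrable_stageDensity p τ Measure.integrable_toReal_rnDeriv n).1.aemeasurable hρ.nonneg

end Approximation

end NeuralFlow

end

theorem theorem1_general (d : ℕ) (mB : EuclideanSpace ℝ (Fin d)) (SB : Matrix (Fin d) (Fin d) ℝ)
    (hSB : SB.PosDef)
    (ρstar : EuclideanSpace ℝ (Fin d) → ℝ) (hρ : NeuralFlow.IsProbDensity ρstar)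
    (hlog : Integrable (fun x => ρstar x * Real.log (ρstar x)))
    (hmoment : Integrable (fun x => ρstar x * ‖x‖ ^ 2))
    (T ε : ℝ) (hT : 0 < T) (hε : 0 < ε) :
    ∃ θ : ℝ → NeuralFlow.Param d, NeuralFlow.IsPiecewiseConstant T θ ∧
      (∃ ρ, NeuralFlow.IsSolution T θ
        (NeuralFlow.lebesgueDensity (ProbabilityTheory.multivariateGaussian mB SB)) ρ) ∧
      (∀ ρ, NeuralFlow.IsSolution T θ
        (NeuralFlow.lebesgueDensity (ProbabilityTheory.multivariateGaussian mB SB)) ρ →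
          (∀ᵐ x, 0 < ρ T x) ∧
          Integrable (fun x => ρstar x * Real.log (ρstar x / ρ T x)) ∧
          ∫ x, ρstar x * Real.log (ρstar x / ρ T x) ≤ ε) ∧
      (∃ Φ, NeuralFlow.IsFlow T θ Φ) ∧
      (∀ Φ, NeuralFlow.IsFlow T θ Φ →
        InformationTheory.klDiv (NeuralFlow.densityMeasure ρstar)
          ((ProbabilityTheory.multivariateGaussian mB SB).map (Φ T)) ≤ ENNReal.ofReal ε) := by
  obtain ⟨Ψ, ℓ, hΨ, hdiv⟩ := NeuralFlow.exists_reachable_isDivergenceLE hρ hlog hmoment hε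
  obtain ⟨A, ℓA, hA, hAB⟩ := NeuralFlow.exists_reachable_map_gaussDensity mB hSB
  obtain ⟨n, τ, p, hn, hτ, rfl, hdens⟩ := NeuralFlow.exists_stageDensity_ae_eq hA hAB hΨ hT
  have hstage := hdiv.congr_ae hdens
  refine ⟨NeuralFlow.control p τ, NeuralFlow.isPiecewiseConstant_control p hτ n,
    ⟨_, NeuralFlow.isSolution_stageSolution p hτ hn Measure.integrable_toReal_rnDeriv
      (hA.exists_ae_abs_lebesgueDensity_le hAB)⟩, fun ρ hsol => ?_,
    ⟨_, NeuralFlow.isFlow_stageCurve p hτ hn⟩, fun Φ hΦ =>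
      hΦ.klDiv_map_le hτ hn hρ (hA.absolutelyContinuous_of_map_eq hAB) hstage⟩
  obtain ⟨hpos, hint, hle⟩ := hstage.congr_ae (hsol.eq_stageDensity hτ)
  exact ⟨hpos, hint, hle⟩

theorem theorem1 (d : ℕ) (mB : EuclideanSpace ℝ (Fin d)) (SB : Matrix (Fin d) (Fin d) ℝ)
    (hSB : SB.PosDef)
    (ρstar : EuclideanSpace ℝ (Fin d) → ℝ) (hρ : NeuralFlow.IsProbDensity ρstar)
    (hlog : Integrable (fun x => ρstar x * Real.log (ρstar x)))
    (M σ : ℝ) (hM : 0 < M) (hσ : 0 < σ)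
    (htail : ∀ x, M ≤ ‖x‖ → ρstar x ≤
      1 / (2 * Real.pi * σ ^ 2) ^ ((d : ℝ) / 2) * Real.exp (-‖x‖ ^ 2 / (2 * σ ^ 2)))
    (T ε : ℝ) (hT : 0 < T) (hε : 0 < ε) :
    ∃ θ : ℝ → NeuralFlow.Param d, NeuralFlow.IsPiecewiseConstant T θ ∧
      -- the solution of the continuity equation exists, and satisfies the estimate
      (∃ ρ, NeuralFlow.IsSolution T θ
        (NeuralFlow.lebesgueDensity (ProbabilityTheory.multivariateGaussian mB SB)) ρ) ∧
      (∀ ρ, NeuralFlow.IsSolution T θ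
        (NeuralFlow.lebesgueDensity (ProbabilityTheory.multivariateGaussian mB SB)) ρ →
          (∀ᵐ x, 0 < ρ T x) ∧
          Integrable (fun x => ρstar x * Real.log (ρstar x / ρ T x)) ∧
          ∫ x, ρstar x * Real.log (ρstar x / ρ T x) ≤ ε) ∧
      -- the flow exists, and satisfies the equivalent estimate
      (∃ Φ, NeuralFlow.IsFlow T θ Φ) ∧
      (∀ Φ, NeuralFlow.IsFlow T θ Φ →
        InformationTheory.klDiv (NeuralFlow.densityMeasure ρstar)
          ((ProbabilityTheory.multivariateGaussian mB SB).map (Φ T)) ≤ ENNReal.ofReal ε) := by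
  exact theorem1_general d mB SB hSB ρstar hρ hlog
    (NeuralFlow.integrable_mul_sq_norm_of_tail hρ.nonneg hρ.integrable hσ htail) T ε hT hε
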